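/- Let $0\le p\le n$ be integers and equip $\mathbb C^n$ with the pseudo-Hermitian form $$\langle\langle z,w\rangle\rangle_p=-\sum_{j=1}^{p}z_j\bar w_j+\sum_{j=p+1}^{n}z_j\bar w_j ,$$ the pseudo-Riemannian metric $\langle\cdot,\cdot\rangle_{2p}=\mathrm{Re}\,\langle\langle\cdot,\cdot\rangle\rangle_p$ and the symplectic form $\omega_p=-\mathrm{Im}\,\langle\langle\cdot,\cdot\rangle\rangle_p$. Let $\langle x,x\rangle_p=-\sum_{j\le p}x_j^2+\sum_{j>p}x_j^2$ on $\mathbb R^n$. Let $SO(p,n-p)$ be the group of real $n\times n$ matrices of determinant $1$ preserving $\langle\cdot,\cdot\rangle_p$, acting on $\mathbb C^n$ by $A(x+iy)=Ax+iAy$. Let $M$ be a connected (Hausdorff, second countable) smooth $n$-manifold and $f:M\to\mathbb C^n$ a smooth immersion, with image $\mathcal L=f(M)$, such that - $f$ is Lagrangian: $f^*\omega_p=0$; - $f$ is minimal: the induced metric $f^*\langle\cdot,\cdot\rangle_{2p}$ is non-degenerate, and $f$ is a critical point of the volume with respect to compactly supported variations; - $\mathcal L$ is $SO(p,n-p)$-equivariant: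 $A\mathcal L\subseteq\mathcal L$ for all $A\in SO(p,n-p)$. Then $\mathcal L$ is congruent to an open subset of a model $S$: there are a real-linear isomorphism $A$ of $\mathbb C^n$ preserving $\langle\cdot,\cdot\rangle_{2p}$, a vector $b\in\mathbb C^n$ and an open set $U\subseteq\mathbb C^n$ with $\mathcal L=A(S\cap U)+b$, where $S$ is - either an affine Lagrangian $n$-plane (an affine subspace of real dimension $n$ on whose direction $\omega_p$ vanishes), - or a Lagrangian catenoid $$S=\{\gamma x : \gamma\in\mathbb C,\ x\in\mathbb R^n,\ \langle x,x\rangle_p=\epsilon,\ \mathrm{Im}\,\gamma^n=c\},\qquad \epsilon\in\{1,-1\},\ c\in\mathbb R\setminus\{0\}.$$ If $n\neq 2$, the map $A$ can moreover be chosen to preserve $\langle\langle\cdot,\cdot\rangle\rangle_p$. -/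

import Mathlib

open scoped Manifold ContDiff Matrix

noncomputable section

/-- The sign of the `j`-th coordinate: the first `p` coordinates are negative. -/
def sgnCoeff (p : ℕ) {n : ℕ} (j : Fin n) : ℝ := if (j : ℕ) < p then -1 else 1

/-- The pseudo-Hermitian form `-∑_{j ≤ p} z_j conj w_j + ∑_{j > p} z_j conj w_j` on `ℂⁿ`. -/
def pseudoHerm (p : ℕ) {n : ℕ} (z w : Fin n → ℂ) : ℂ :=
  ∑ j, (sgnCoeff p j : ℂ) * (z j * (starRingEnd ℂ) (w j))

/-- The pseudo-Riemannian metric, of signature `(2p, 2(n-p))`: the real part of the form. -/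
def pseudoMetric (p : ℕ) {n : ℕ} (z w : Fin n → ℂ) : ℝ := (pseudoHerm p z w).re

/-- The symplectic form: minus the imaginary part of the form. -/
def pseudoOmega (p : ℕ) {n : ℕ} (z w : Fin n → ℂ) : ℝ := -(pseudoHerm p z w).im

/-- `SO(p, n-p)`: the real matrices of determinant one that preserve
`-∑_{j ≤ p} x_j² + ∑_{j > p} x_j²`. -/
def indefiniteSO (p n : ℕ) : Set (Matrix (Fin n) (Fin n) ℝ) :=
  {A | Aᵀ * Matrix.diagonal (sgnCoeff p) * A = Matrix.diagonal (sgnCoeff p) ∧ A.det = 1}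

/-- The set `S` is invariant under the action `A (x + i y) = A x + i A y` of `SO(p, n-p)`. -/
def IsSOInvariant (p : ℕ) {n : ℕ} (S : Set (Fin n → ℂ)) : Prop :=
  ∀ A ∈ indefiniteSO p n, ∀ z ∈ S, A.map Complex.ofReal *ᵥ z ∈ S

/-- The quadric `{x ∈ ℝⁿ | ⟨x, x⟩_p = ε}`. -/
def quadric (p n : ℕ) (ε : ℝ) : Set (Fin n → ℝ) :=
  {x | ∑ j, sgnCoeff p j * x j ^ 2 = ε}

/-- The set `{γ x | x ∈ ℝⁿ, ⟨x, x⟩_p = ε, γ ∈ ℂ, Im γⁿ = c}`. -/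
def lagrangianCatenoid (p n : ℕ) (ε c : ℝ) : Set (Fin n → ℂ) :=
  {z | ∃ γ : ℂ, ∃ x ∈ quadric p n ε, (γ ^ n).im = c ∧ z = fun j => γ * (x j : ℂ)}

/-- `P` is an affine subspace of real dimension `n` whose direction is `ω_p`-isotropic. -/
def IsAffineLagrangianPlane (p : ℕ) {n : ℕ} (P : AffineSubspace ℝ (Fin n → ℂ)) : Prop :=
  (P : Set (Fin n → ℂ)).Nonempty ∧ Module.finrank ℝ P.direction = n ∧
    ∀ v ∈ P.direction, ∀ w ∈ P.direction, pseudoOmega p v w = 0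

/-- The volume, over a region `K` of the parameter domain, of the parametrized submanifold `u`
with respect to the (possibly indefinite) induced metric: the integral over `K` of
`|det (⟨∂ᵢu, ∂ⱼu⟩)|^{1/2}`. -/
def paramVolume (p : ℕ) {n : ℕ} (u : EuclideanSpace ℝ (Fin n) → (Fin n → ℂ))
    (K : Set (EuclideanSpace ℝ (Fin n))) : ℝ :=
  ∫ y in K, √|Matrix.det (Matrix.of fun i j : Fin n =>
    pseudoMetric p (fderiv ℝ u y (EuclideanSpace.single i (1 : ℝ)))
      (fderiv ℝ u y (EuclideanSpace.single j (1 : ℝ))))|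

section Immersed

variable {n : ℕ} {M : Type*} [TopologicalSpace M] [ChartedSpace (EuclideanSpace ℝ (Fin n)) M]

/-- `f` is a smooth immersion of the `n`-manifold `M` into `ℂⁿ`. -/
def IsSmoothImmersion (f : M → (Fin n → ℂ)) : Prop :=
  ContMDiff (𝓡 n) 𝓘(ℝ, Fin n → ℂ) ∞ f ∧
    ∀ x : M, Function.Injective (mfderiv (𝓡 n) 𝓘(ℝ, Fin n → ℂ) f x)

/-- The symplectic form vanishes on the tangent spaces of the (`n`-dimensional) immersed
submanifold. -/
def IsLagrangianImmersion (p : ℕ) (f : M → (Fin n → ℂ)) : Prop :=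
  ∀ (x : M) (v w : TangentSpace (𝓡 n) x),
    pseudoOmega p (mfderiv (𝓡 n) 𝓘(ℝ, Fin n → ℂ) f x v)
      (mfderiv (𝓡 n) 𝓘(ℝ, Fin n → ℂ) f x w) = 0

/-- The induced metric is non-degenerate. -/
def IsNondegenerateImmersion (p : ℕ) (f : M → (Fin n → ℂ)) : Prop :=
  ∀ (x : M) (v : TangentSpace (𝓡 n) x),
    (∀ w : TangentSpace (𝓡 n) x, pseudoMetric p (mfderiv (𝓡 n) 𝓘(ℝ, Fin n → ℂ) f x v)
      (mfderiv (𝓡 n) 𝓘(ℝ, Fin n → ℂ) f x w) = 0) → v = 0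

/-- The immersion is a critical point of the volume for compactly supported variations: for every
smooth coordinate chart `e` and every smooth variation field `V` with compact support in the
range of the chart, the volume of `f ∘ e⁻¹ + t V` over the support of `V` has derivative zero at
`t = 0`. (The first variation is linear in the variation field, so, by a partition of unity,
fields supported in charts account for all compactly supported ones.) -/
def IsVolumeCritical (p : ℕ) (f : M → (Fin n → ℂ)) : Prop :=
  ∀ e ∈ IsManifold.maximalAtlas (𝓡 n) ∞ M,
    ∀ V : EuclideanSpace ℝ (Fin n) → (Fin n → ℂ),
      ContDiff ℝ ∞ V → HasCompactSupport V → tsupport V ⊆ e.target →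
        HasDerivAt (fun t : ℝ => paramVolume p (fun y => f (e.symm y) + t • V y) (tsupport V))
          0 0

/-- A minimal submanifold: non-degenerate and critical for the volume. -/
def IsMinimalImmersion (p : ℕ) (f : M → (Fin n → ℂ)) : Prop :=
  IsNondegenerateImmersion p f ∧ IsVolumeCritical p f

end Immersed

end

open scoped Manifold ContDiff Matrix

noncomputable section

namespace MinimalLagrangian

open Complex

/-! ### Linear algebra of the pseudo-Hermitian form -/

section Form

variable {p n : ℕ}

/-! The tangent space `T` of a Lagrangian immersion with non-degenerate metric satisfies `T ⊕ iT =
ℂⁿ`, so the determinant of a real frame of `T` is a nonzero complex number, well defined up to a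
real factor. Its phase is the Lagrangian angle. Testing criticality of the volume on the fields `φ ·
i ∂ⱼu` shows that this angle is locally constant (`im_trace_eq_zero_of_critical`, `exists_phase`).
After multiplication of `f` by a unit complex number all frame determinants are real: the immersion
is special Lagrangian (`exists_isSpecial`).

Invariance is assumed for the set `f(M)` only, and `f` need not be injective, so the group is not
known to act on `M`. A Baire argument (`exists_derivative_mem_tangentImage`) still shows that the
vector fields of the Lie algebra are `ω`-orthogonal to every tangent space
(`pseudoOmega_generator_eq_zero`), hence tangent, because `T` is its own symplectic complement. If
`n ≥ 3`, isotropy applied to two generators forces all coordinates of a point to have the same phase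
modulo `π`, so that `z = γ x` with `x` real. A frame made of `n - 1` generators and a tangent vector
`w` has determinant a real multiple of `zⱼⁿ⁻² B(z, w)`, with `B` the complex bilinear form; its
reality means that `firstIntegral`, equal to `2 ⟨x,x⟩ⁿ (Im γⁿ)²` at `γ x`, is constant along the
immersion. It is a polynomial in the real and imaginary parts of `z`, so no local choice of `γ` is
needed.

A nonzero constant places the image in a catenoid. If the constant is zero, every tangent space is
`κ ℝⁿ` for one of the finitely many `κ` with `κ²ⁿ = 1`; connectedness makes `κ` constant and the
image lies in an affine plane. In both cases the inverse function theorem shows that the image is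
open in the model (`exists_isOpen_range_eq_inter`).

If `n = 2` there is one generator, up to sign, and the phases may differ; instead `Im (z₀ z̄₁)` and
`Im B(z, z)` are two constants. In definite signature a rotation of the imaginary parts, isometric
but in general not complex linear, makes the former vanish; in signature `(1, 1)` it vanishes
because the image is symmetric under `-1`. -/

lemma sgnCoeff_mul_self (j : Fin n) : sgnCoeff p j * sgnCoeff p j = 1 := by
  unfold sgnCoeff; split_ifs <;> norm_num

lemma sgnCoeff_ne_zero (j : Fin n) : sgnCoeff p j ≠ 0 := by
  unfold sgnCoeff; split_ifs <;> norm_num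

lemma pseudoHerm_add_left (z w v : Fin n → ℂ) :
    pseudoHerm p (z + w) v = pseudoHerm p z v + pseudoHerm p w v := by
  simp only [pseudoHerm, ← Finset.sum_add_distrib, Pi.add_apply]
  exact Finset.sum_congr rfl fun j _ => by ring

lemma pseudoHerm_add_right (z w v : Fin n → ℂ) :
    pseudoHerm p z (w + v) = pseudoHerm p z w + pseudoHerm p z v := by
  simp only [pseudoHerm, ← Finset.sum_add_distrib, Pi.add_apply, map_add]
  exact Finset.sum_congr rfl fun j _ => by ring

lemma pseudoHerm_smul_left (c : ℂ) (z w : Fin n → ℂ) :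
    pseudoHerm p (c • z) w = c * pseudoHerm p z w := by
  simp only [pseudoHerm, Finset.mul_sum, Pi.smul_apply, smul_eq_mul]
  exact Finset.sum_congr rfl fun j _ => by ring

lemma pseudoHerm_smul_right (c : ℂ) (z w : Fin n → ℂ) :
    pseudoHerm p z (c • w) = (starRingEnd ℂ) c * pseudoHerm p z w := by
  simp only [pseudoHerm, Finset.mul_sum, Pi.smul_apply, smul_eq_mul, map_mul]
  exact Finset.sum_congr rfl fun j _ => by ring

lemma pseudoHerm_conj_symm (z w : Fin n → ℂ) :
    (starRingEnd ℂ) (pseudoHerm p z w) = pseudoHerm p w z := by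
  simp only [pseudoHerm, map_sum, map_mul, conj_ofReal, conj_conj]
  exact Finset.sum_congr rfl fun j _ => by ring

lemma pseudoHerm_real_smul_left (r : ℝ) (z w : Fin n → ℂ) :
    pseudoHerm p (r • z) w = r * pseudoHerm p z w := by
  rw [← pseudoHerm_smul_left]; rfl

lemma pseudoHerm_real_smul_right (r : ℝ) (z w : Fin n → ℂ) :
    pseudoHerm p z (r • w) = r * pseudoHerm p z w := by
  rw [← conj_ofReal, ← pseudoHerm_smul_right]; rfl

lemma pseudoMetric_add_left (z w v : Fin n → ℂ) :
    pseudoMetric p (z + w) v = pseudoMetric p z v + pseudoMetric p w v := by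
  simp [pseudoMetric, pseudoHerm_add_left]

lemma pseudoMetric_add_right (z w v : Fin n → ℂ) :
    pseudoMetric p z (w + v) = pseudoMetric p z w + pseudoMetric p z v := by
  simp [pseudoMetric, pseudoHerm_add_right]

lemma pseudoMetric_smul_left (r : ℝ) (z w : Fin n → ℂ) :
    pseudoMetric p (r • z) w = r * pseudoMetric p z w := by
  simp [pseudoMetric, pseudoHerm_real_smul_left]

lemma pseudoMetric_smul_right (r : ℝ) (z w : Fin n → ℂ) :
    pseudoMetric p z (r • w) = r * pseudoMetric p z w := by
  simp [pseudoMetric, pseudoHerm_real_smul_right]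

lemma pseudoMetric_symm (z w : Fin n → ℂ) : pseudoMetric p z w = pseudoMetric p w z := by
  simp [pseudoMetric, ← pseudoHerm_conj_symm z w]

lemma pseudoOmega_add_left (z w v : Fin n → ℂ) :
    pseudoOmega p (z + w) v = pseudoOmega p z v + pseudoOmega p w v := by
  simp only [pseudoOmega, pseudoHerm_add_left, add_im]; ring

lemma pseudoOmega_smul_left (r : ℝ) (z w : Fin n → ℂ) :
    pseudoOmega p (r • z) w = r * pseudoOmega p z w := by
  simp [pseudoOmega, pseudoHerm_real_smul_left]

lemma pseudoOmega_I_smul_left (z w : Fin n → ℂ) :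
    pseudoOmega p (I • z) w = -pseudoMetric p z w := by
  simp [pseudoOmega, pseudoMetric, pseudoHerm_smul_left]

lemma pseudoMetric_I_smul_left (z w : Fin n → ℂ) :
    pseudoMetric p (I • z) w = pseudoOmega p z w := by
  simp [pseudoOmega, pseudoMetric, pseudoHerm_smul_left]

/-- The complex bilinear form with the same real values as the pseudo-Hermitian form. -/
def pseudoBilin (p : ℕ) {n : ℕ} (z w : Fin n → ℂ) : ℂ :=
  ∑ j, (sgnCoeff p j : ℂ) * (z j * w j)

lemma pseudoBilin_add_right (z w v : Fin n → ℂ) :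
    pseudoBilin p z (w + v) = pseudoBilin p z w + pseudoBilin p z v := by
  simp only [pseudoBilin, ← Finset.sum_add_distrib, Pi.add_apply]
  exact Finset.sum_congr rfl fun j _ => by ring

lemma pseudoBilin_smul_right (c : ℂ) (z w : Fin n → ℂ) :
    pseudoBilin p z (c • w) = c * pseudoBilin p z w := by
  simp only [pseudoBilin, Finset.mul_sum, Pi.smul_apply, smul_eq_mul]
  exact Finset.sum_congr rfl fun j _ => by ring

lemma pseudoBilin_smul_left (c : ℂ) (z w : Fin n → ℂ) :
    pseudoBilin p (c • z) w = c * pseudoBilin p z w := by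
  simp only [pseudoBilin, Finset.mul_sum, Pi.smul_apply, smul_eq_mul]
  exact Finset.sum_congr rfl fun j _ => by ring

lemma pseudoBilin_single_right (z : Fin n → ℂ) (j : Fin n) :
    pseudoBilin p z (Pi.single j 1) = sgnCoeff p j * z j := by
  simp [pseudoBilin, Pi.single_apply]

/-- The inclusion of `ℝⁿ` in `ℂⁿ`. -/
def realVec {n : ℕ} (x : Fin n → ℝ) : Fin n → ℂ := fun j => (x j : ℂ)

lemma pseudoHerm_realVec_right (z : Fin n → ℂ) (x : Fin n → ℝ) :
    pseudoHerm p z (realVec x) = pseudoBilin p (realVec x) z := by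
  simp only [pseudoHerm, pseudoBilin, realVec, conj_ofReal]
  exact Finset.sum_congr rfl fun j _ => by ring

lemma pseudoBilin_realVec (x y : Fin n → ℝ) :
    pseudoBilin p (realVec x) (realVec y) = ((∑ j, sgnCoeff p j * (x j * y j) : ℝ) : ℂ) := by
  simp [pseudoBilin, realVec]

/-- The generator of the rotations (or boosts) of the `(i, j)`-plane. -/
def generator (p : ℕ) {n : ℕ} (i j : Fin n) (z : Fin n → ℂ) : Fin n → ℂ :=
  (sgnCoeff p j * z j : ℂ) • Pi.single i 1 - (sgnCoeff p i * z i : ℂ) • Pi.single j 1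

/-- This rewrites `ω`-orthogonality to an orbit direction as the polarization of `Im (zᵢ z̄ⱼ)`, a
form that does not see the signature. It becomes the field `rotation` of `IsSpecial`. -/
lemma pseudoOmega_generator (i j : Fin n) (z w : Fin n → ℂ) :
    pseudoOmega p (generator p i j z) w =
      sgnCoeff p i * sgnCoeff p j *
        ((z i * (starRingEnd ℂ) (w j)).im + (w i * (starRingEnd ℂ) (z j)).im) := by
  have h : pseudoHerm p (generator p i j z) w = ((sgnCoeff p i * sgnCoeff p j : ℝ) : ℂ) *
      (z j * (starRingEnd ℂ) (w i) - z i * (starRingEnd ℂ) (w j)) := by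
    rw [generator, sub_eq_add_neg, ← neg_smul, pseudoHerm_add_left, pseudoHerm_smul_left,
      pseudoHerm_smul_left]
    simp [pseudoHerm, Pi.single_apply]
    ring
  rw [pseudoOmega, h, im_ofReal_mul]
  simp
  ring

/-- The tangent space of a Lagrangian immersion with non-degenerate induced metric. -/
structure IsLagrangianSubspace (p : ℕ) {n : ℕ} (T : Submodule ℝ (Fin n → ℂ)) : Prop where
  finrank_eq : Module.finrank ℝ T = n
  isotropic : ∀ v ∈ T, ∀ w ∈ T, pseudoOmega p v w = 0
  nondegenerate : ∀ v ∈ T, (∀ w ∈ T, pseudoMetric p v w = 0) → v = 0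

namespace IsLagrangianSubspace

variable {T : Submodule ℝ (Fin n → ℂ)} (hT : IsLagrangianSubspace p T)
include hT

/-- Pairing with `T` under `ω` kills `a` by isotropy and turns `i b` into `-⟨b, ·⟩`, so
non-degeneracy gives `T ∩ iT = 0`. With the dimension count, `ℂⁿ = T ⊕ iT`. -/
lemma eq_zero_of_add_I_smul {a b : Fin n → ℂ} (ha : a ∈ T) (hb : b ∈ T) (h : a + I • b = 0) :
    a = 0 ∧ b = 0 := by
  have hb0 : b = 0 := by
    refine hT.nondegenerate b hb fun w hw => ?_
    have h1 : pseudoOmega p (a + I • b) w = 0 := by rw [h]; simp [pseudoOmega, pseudoHerm]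
    rw [pseudoOmega_add_left, hT.isotropic a ha w hw, pseudoOmega_I_smul_left] at h1
    linarith
  subst hb0
  simpa using h

lemma exists_add_I_smul (v : Fin n → ℂ) : ∃ a ∈ T, ∃ b ∈ T, v = a + I • b := by
  let L : (T × T) →ₗ[ℝ] (Fin n → ℂ) :=
    { toFun := fun q => (q.1 : Fin n → ℂ) + I • (q.2 : Fin n → ℂ)
      map_add' := fun q r => by simp only [Prod.fst_add, Prod.snd_add, Submodule.coe_add, smul_add]; abel
      map_smul' := fun r q => by
        simp only [Prod.smul_fst, Prod.smul_snd, Submodule.coe_smul, smul_add, RingHom.id_apply]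
        rw [smul_comm] }
  have hinj : Function.Injective L := by
    rw [← LinearMap.ker_eq_bot, LinearMap.ker_eq_bot']
    rintro ⟨a, b⟩ h
    obtain ⟨h1, h2⟩ := hT.eq_zero_of_add_I_smul a.2 b.2 h
    exact Prod.ext (Subtype.ext h1) (Subtype.ext h2)
  have hsurj : Function.Surjective L := by
    rw [← LinearMap.injective_iff_surjective_of_finrank_eq_finrank]
    · exact hinj
    · rw [Module.finrank_prod, hT.finrank_eq, Module.finrank_pi_fintype]
      simp [Complex.finrank_real_complex, mul_two]
  obtain ⟨⟨a, b⟩, h⟩ := hsurj v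
  exact ⟨a, a.2, b, b.2, h.symm⟩

/-- A Lagrangian subspace is its own symplectic complement. -/
lemma mem_of_pseudoOmega_eq_zero {v : Fin n → ℂ} (hv : ∀ w ∈ T, pseudoOmega p v w = 0) :
    v ∈ T := by
  obtain ⟨a, ha, b, hb, rfl⟩ := hT.exists_add_I_smul v
  have : b = 0 := by
    refine hT.nondegenerate b hb fun w hw => ?_
    have := hv w hw
    rw [pseudoOmega_add_left, hT.isotropic a ha w hw, pseudoOmega_I_smul_left] at this
    linarith
  subst this
  simpa using ha

/-- Since `T ∩ iT = 0`, separating real and imaginary parts of the coefficients turns a complex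
relation into two real ones. -/
lemma det_ne_zero {v : Fin n → Fin n → ℂ} (hv : ∀ i, v i ∈ T) (hli : LinearIndependent ℝ v) :
    (Matrix.of v).det ≠ 0 := by
  rw [← isUnit_iff_ne_zero, ← Matrix.isUnit_iff_isUnit_det,
    ← Matrix.linearIndependent_rows_iff_isUnit]
  rw [Fintype.linearIndependent_iff] at hli ⊢
  intro c hc
  have h : (∑ i, (c i).re • v i) + I • (∑ i, (c i).im • v i) = 0 := by
    rw [← hc, Finset.smul_sum, ← Finset.sum_add_distrib]
    refine Finset.sum_congr rfl fun i _ => ?_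
    ext k
    simp only [Pi.add_apply, Pi.smul_apply, real_smul, smul_eq_mul, Matrix.row, Matrix.of_apply]
    conv_rhs => rw [← re_add_im (c i)]
    ring
  obtain ⟨h1, h2⟩ := hT.eq_zero_of_add_I_smul
    (Submodule.sum_mem _ fun i _ => T.smul_mem _ (hv i))
    (Submodule.sum_mem _ fun i _ => T.smul_mem _ (hv i)) h
  intro i
  exact Complex.ext (hli _ h1 i) (hli _ h2 i)

/-- `T` spans `ℂⁿ` over `ℂ`, and the bilinear form is non-degenerate. -/
lemma smul_eq_zero_of_pseudoBilin {z : Fin n → ℂ} (h : ∀ w ∈ T, pseudoBilin p z w = 0) : z = 0 := by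
  have h' : ∀ v, pseudoBilin p z v = 0 := by
    intro v
    obtain ⟨a, ha, b, hb, rfl⟩ := hT.exists_add_I_smul v
    rw [pseudoBilin_add_right, pseudoBilin_smul_right, h a ha, h b hb]
    simp
  ext j
  have := h' (Pi.single j 1)
  rw [pseudoBilin_single_right] at this
  simpa [sgnCoeff_ne_zero] using this

end IsLagrangianSubspace

/-- The determinant of the frame made of the generators through the `j`-th coordinate and of a
further vector. -/
lemma det_generator_update (z w : Fin n → ℂ) (j : Fin n) :
    (sgnCoeff p j * z j) *
      (Matrix.of (Function.update (fun i => generator p i j z) j w)).det =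
      (sgnCoeff p j * z j) ^ (n - 1) * pseudoBilin p z w := by
  set b : Fin n → ℂ := fun k => sgnCoeff p k * z k with hb
  set M := Matrix.of (Function.update (fun i => generator p i j z) j w) with hM
  have hP : ((1 : Matrix (Fin n) (Fin n) ℂ).updateCol j b).det = b j := by
    rw [← Matrix.cramer_apply, Matrix.cramer_one]; rfl
  -- Replacing the `j`-th column of the identity by `b` makes the `j`-th column of the product
  -- consist of the values `B(z, row)`. These vanish on the generators, leaving `b j` times the
  -- identity outside the `j`-th row.
  have hMP : M * (1 : Matrix (Fin n) (Fin n) ℂ).updateCol j b =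
      (b j • (1 : Matrix (Fin n) (Fin n) ℂ)).updateRow j
        (Function.update w j (pseudoBilin p z w)) := by
    ext i k
    rw [Matrix.mul_apply]
    by_cases hk : k = j
    · subst hk
      by_cases hi : i = k
      · subst hi
        simp [hM, pseudoBilin, hb]
        exact Finset.sum_congr rfl fun l _ => by ring
      · simp [hM, hi, hb, generator, sub_mul, Finset.sum_sub_distrib, Pi.single_apply]
        ring
    · by_cases hi : i = j
      · subst hi
        simp [hM, hk, Matrix.one_apply]
      · simp [hM, hk, Ne.symm hk, hi, hb, Matrix.one_apply, generator, Pi.single_apply,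
          eq_comm]
  have hdet := congrArg Matrix.det hMP
  rw [Matrix.det_mul, hP, ← Matrix.cramer_transpose_apply, Matrix.transpose_smul,
    Matrix.transpose_one, Matrix.cramer_smul] at hdet
  simp only [Matrix.cramer_one] at hdet
  simp only [Fintype.card_fin, LinearMap.smul_apply, Pi.smul_apply, Module.End.one_apply,
    Function.update_self, smul_eq_mul] at hdet
  rw [mul_comm] at hdet
  exact hdet

/-- The special Lagrangian condition, for a tangent space that contains the generators. -/
lemma im_pow_mul_pseudoBilin {T : Submodule ℝ (Fin n → ℂ)} {z w : Fin n → ℂ}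
    (hn : 2 ≤ n) (hgen : ∀ i j, generator p i j z ∈ T)
    (hdet : ∀ v : Fin n → Fin n → ℂ, (∀ i, v i ∈ T) → (Matrix.of v).det.im = 0)
    (hw : w ∈ T) {j : Fin n} (hj : z j ≠ 0) : (z j ^ (n - 2) * pseudoBilin p z w).im = 0 := by
  have h1 := det_generator_update (p := p) z w j
  have hs : (sgnCoeff p j : ℂ) * z j ≠ 0 :=
    mul_ne_zero (by exact_mod_cast sgnCoeff_ne_zero j) hj
  have h2 : n - 1 = (n - 2) + 1 := by omega
  rw [h2, pow_succ', mul_assoc _ (_ ^ _)] at h1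
  have h3 := mul_left_cancel₀ hs h1
  have h4 := hdet (Function.update (fun i => generator p i j z) j w) (by
    intro i
    by_cases hi : i = j
    · subst hi; simpa using hw
    · simpa [hi] using hgen i j)
  rw [h3, mul_pow, mul_assoc, ← ofReal_pow, im_ofReal_mul] at h4
  rcases mul_eq_zero.1 h4 with h5 | h5
  · exact absurd h5 (pow_ne_zero _ (sgnCoeff_ne_zero j))
  · exact h5

/-- A vector whose coordinates have the same complex phase is a multiple of a real vector. -/
lemma exists_smul_realVec {z : Fin n → ℂ} (hz : ∀ i k, (z i * (starRingEnd ℂ) (z k)).im = 0)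
    {j : Fin n} (hj : z j ≠ 0) : ∃ x : Fin n → ℝ, z = z j • realVec x ∧ x j = 1 := by
  refine ⟨fun k => (z k / z j).re, ?_, by simp [hj]⟩
  ext k
  have h1 : (z k / z j).im = 0 := by
    have h2 : z k / z j = ((normSq (z j))⁻¹ : ℝ) * (z k * (starRingEnd ℂ) (z j)) := by
      rw [div_eq_mul_inv, inv_def]; ring
    rw [h2, im_ofReal_mul, hz k j, mul_zero]
  have h3 : ((z k / z j).re : ℂ) = z k / z j := Complex.ext (by simp) (by simp [h1])
  simp only [realVec, Pi.smul_apply, smul_eq_mul, h3]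
  field_simp

lemma pseudoHerm_smul_realVec (γ : ℂ) (x : Fin n → ℝ) (w : Fin n → ℂ) :
    pseudoHerm p w (γ • realVec x) = (starRingEnd ℂ) γ * pseudoBilin p (realVec x) w := by
  rw [pseudoHerm_smul_right, pseudoHerm_realVec_right]

lemma pseudoMetric_smul_realVec_self (γ : ℂ) (x : Fin n → ℝ) :
    pseudoMetric p (γ • realVec x) (γ • realVec x) =
      normSq γ * ∑ j, sgnCoeff p j * x j ^ 2 := by
  rw [pseudoMetric, pseudoHerm_smul_realVec, pseudoBilin_smul_right, pseudoBilin_realVec,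
    ← mul_assoc, mul_comm _ γ, mul_conj, ← ofReal_mul, ofReal_re]
  simp only [sq]

lemma pseudoBilin_smul_realVec_self (γ : ℂ) (x : Fin n → ℝ) :
    pseudoBilin p (γ • realVec x) (γ • realVec x) =
      γ ^ 2 * ((∑ j, sgnCoeff p j * x j ^ 2 : ℝ) : ℂ) := by
  rw [pseudoBilin_smul_left, pseudoBilin_smul_right, pseudoBilin_realVec]
  simp only [sq]
  ring

/-- A first integral of special Lagrangian submanifolds foliated by orbits. -/
def firstIntegral (p : ℕ) {n : ℕ} (z : Fin n → ℂ) : ℝ :=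
  pseudoMetric p z z ^ n - (pseudoBilin p z z ^ n).re

/-- The factor comes from `|w|² - Re w² = 2 (Im w)²` with `w = γⁿ`. -/
lemma firstIntegral_smul_realVec (γ : ℂ) (x : Fin n → ℝ) :
    firstIntegral p (γ • realVec x) =
      2 * (∑ j, sgnCoeff p j * x j ^ 2) ^ n * (γ ^ n).im ^ 2 := by
  rw [firstIntegral, pseudoMetric_smul_realVec_self, pseudoBilin_smul_realVec_self, mul_pow,
    mul_pow, ← ofReal_pow, re_mul_ofReal, ← pow_mul, mul_comm 2 n, pow_mul, ← map_pow, sq (γ ^ n),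
    mul_re, normSq_apply]
  ring

/-- The differential of the first integral, up to a factor. -/
lemma firstIntegral_derivative_eq {z w : Fin n → ℂ} (hn : 2 ≤ n)
    (hz : ∀ i k, (z i * (starRingEnd ℂ) (z k)).im = 0)
    (hw : ∀ j, z j ≠ 0 → (z j ^ (n - 2) * pseudoBilin p z w).im = 0) :
    pseudoMetric p z z ^ (n - 1) * pseudoMetric p w z =
      (pseudoBilin p z z ^ (n - 1) * pseudoBilin p z w).re := by
  by_cases h0 : ∃ j, z j ≠ 0
  · obtain ⟨j, hj⟩ := h0
    obtain ⟨x, hx, -⟩ := exists_smul_realVec hz hj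
    have hw' := hw j hj
    set γ := z j
    obtain ⟨m, rfl⟩ : ∃ m, n = m + 2 := ⟨n - 2, by omega⟩
    rw [hx] at hw' ⊢
    rw [pseudoMetric_smul_realVec_self, pseudoBilin_smul_realVec_self, pseudoMetric,
      pseudoHerm_smul_realVec, pseudoBilin_smul_left]
    rw [pseudoBilin_smul_left] at hw'
    simp only [Nat.add_sub_cancel] at hw' ⊢
    have e : m + 2 - 1 = m + 1 := rfl
    rw [e]
    set β := pseudoBilin p (realVec x) w
    set σ := ∑ j, sgnCoeff p j * x j ^ 2
    have hr : ((γ ^ m * (γ * β)).re : ℂ) = γ ^ m * (γ * β) :=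
      Complex.ext (by simp) (by simp [hw'])
    set r := (γ ^ m * (γ * β)).re
    -- With `r = γᵐ · γ β` real, both sides of the claim reduce to `σᵐ⁺¹ r Re γᵐ⁺²`: one produces
    -- `γᵐ⁺²` and the other its conjugate.
    have h1 : ((normSq γ * σ) ^ (m + 1) * ((starRingEnd ℂ) γ * β).re) =
        σ ^ (m + 1) * r * (γ ^ (m + 2)).re := by
      have : (((normSq γ * σ) ^ (m + 1) : ℝ) : ℂ) * ((starRingEnd ℂ) γ * β) =
          ((σ ^ (m + 1) * r : ℝ) : ℂ) * (starRingEnd ℂ) (γ ^ (m + 2)) := by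
        push_cast
        rw [hr, ← mul_conj, map_pow]
        ring
      have := congrArg re this
      rwa [re_ofReal_mul, re_ofReal_mul, conj_re] at this
    rw [h1]
    have h2 : (γ ^ 2 * (σ : ℂ)) ^ (m + 1) * (γ * β) =
        ((σ ^ (m + 1) * r : ℝ) : ℂ) * γ ^ (m + 2) := by
      push_cast
      rw [hr]
      ring
    rw [h2, re_ofReal_mul]
  · push Not at h0
    have hz0 : z = 0 := funext h0
    subst hz0
    have : n - 1 ≠ 0 := by omega
    simp [pseudoBilin, pseudoMetric, pseudoHerm]

/-- On a level `0` of the first integral, a tangent space is a rotated real subspace. -/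
lemma im_conj_mul_eq_zero {z w : Fin n → ℂ} (hn : 2 ≤ n) {γ : ℂ} {x : Fin n → ℝ}
    (hz : z = γ • realVec x) {j : Fin n} (hxj : x j = 1) (hγ : γ ≠ 0)
    (hσ : ∑ j, sgnCoeff p j * x j ^ 2 ≠ 0) (hγn : (γ ^ n).im = 0)
    (hw : (γ ^ (n - 2) * pseudoBilin p z w).im = 0)
    (hzw : ∀ i k, (z i * (starRingEnd ℂ) (w k)).im + (w i * (starRingEnd ℂ) (z k)).im = 0)
    (k : Fin n) : ((starRingEnd ℂ) γ * w k).im = 0 := by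
  obtain ⟨m, rfl⟩ : ∃ m, n = m + 2 := ⟨n - 2, by omega⟩
  simp only [Nat.add_sub_cancel] at hw
  have hN : normSq γ ≠ 0 := by simpa using hγ
  set y : Fin (m + 2) → ℝ := fun k => ((starRingEnd ℂ) γ * w k).im with hy
  -- Infinitesimal invariance makes the imaginary part `y` of `γ̄ w` proportional to `x`; the phase
  -- condition below kills the factor of proportionality, since `σ` and `Re γⁿ` are nonzero.
  have hyx : ∀ i k, x i * y k = x k * y i := by
    intro i k
    have := hzw i k
    rw [hz] at this
    simp only [Pi.smul_apply, realVec, smul_eq_mul, hy, mul_im, mul_re, map_mul, conj_re, conj_im,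
      ofReal_re, ofReal_im] at this ⊢
    linarith
  have hyj : ∀ k, y k = x k * y j := fun k => by have := hyx j k; rw [hxj] at this; linarith
  have h1 : ((starRingEnd ℂ) γ * pseudoBilin p (realVec x) w).im =
      (∑ j, sgnCoeff p j * x j ^ 2) * y j := by
    rw [pseudoBilin, Finset.mul_sum, im_sum, Finset.sum_mul]
    refine Finset.sum_congr rfl fun k _ => ?_
    have : (starRingEnd ℂ) γ * (↑(sgnCoeff p k) * (realVec x k * w k)) =
        ((sgnCoeff p k * x k : ℝ) : ℂ) * ((starRingEnd ℂ) γ * w k) := by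
      simp only [realVec]; push_cast; ring
    rw [this, im_ofReal_mul]
    change _ * y k = _
    rw [hyj k]; ring
  rw [hz, pseudoBilin_smul_left] at hw
  have hr : ((γ ^ (m + 2)).re : ℂ) = γ ^ (m + 2) := Complex.ext (by simp) (by simp [hγn])
  have hr0 : (γ ^ (m + 2)).re ≠ 0 := by
    intro h0; rw [h0] at hr
    exact pow_ne_zero (m + 2) hγ (by rw [← hr]; simp)
  have h2 : (normSq γ : ℂ) * (γ ^ m * (γ * pseudoBilin p (realVec x) w)) =
      ((γ ^ (m + 2)).re : ℂ) * ((starRingEnd ℂ) γ * pseudoBilin p (realVec x) w) := by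
    rw [hr, ← mul_conj]; ring
  have h3 := congrArg im h2
  rw [im_ofReal_mul, im_ofReal_mul, hw, h1] at h3
  have h4 : y j = 0 := by
    have : (γ ^ (m + 2)).re * ((∑ j, sgnCoeff p j * x j ^ 2) * y j) = 0 := by rw [← h3]; simp
    simpa [hr0, hσ] using this
  change y k = 0
  rw [hyj k, h4, mul_zero]

end Form

end MinimalLagrangian

namespace MinimalLagrangian

open Complex MeasureTheory Topology

/-! ### The first variation of the volume -/

section Calculus

/-- Jacobi's formula for the derivative of a determinant. -/
lemma hasDerivAt_det {𝕜 : Type*} [RCLike 𝕜] {n : ℕ} {G : ℝ → Matrix (Fin n) (Fin n) 𝕜}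
    {G' : Matrix (Fin n) (Fin n) 𝕜} {t : ℝ}
    (h : ∀ i j, HasDerivAt (fun s => G s i j) (G' i j) t) :
    HasDerivAt (fun s => (G s).det) (Matrix.trace ((G t).adjugate * G')) t := by
  have h1 : Matrix.trace ((G t).adjugate * G') = ∑ σ : Equiv.Perm (Fin n),
      (Equiv.Perm.sign σ : ℤ) • ∑ i, (∏ j ∈ Finset.univ.erase i, G t (σ j) j) • G' (σ i) i := by
    have h2 : ∀ i, ((G t).adjugate * G') i i = ((G t).updateCol i (fun k => G' k i)).det := by
      intro i
      rw [← Matrix.cramer_apply, Matrix.cramer_eq_adjugate_mulVec]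
      rfl
    simp only [Matrix.trace, Matrix.diag_apply, h2, Matrix.det_apply, Finset.smul_sum]
    rw [Finset.sum_comm]
    refine Finset.sum_congr rfl fun σ _ => Finset.sum_congr rfl fun i _ => ?_
    rw [← Finset.mul_prod_erase _ _ (Finset.mem_univ i), Units.smul_def]
    congr 1
    rw [smul_eq_mul, mul_comm]
    congr 1
    · exact Finset.prod_congr rfl fun j hj => by
        rw [Matrix.updateCol_ne (Finset.ne_of_mem_erase hj)]
    · simp
  rw [h1]
  simp only [Matrix.det_apply, Units.smul_def]
  refine HasDerivAt.fun_sum fun σ _ => ?_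
  exact (HasDerivAt.fun_finsetProd (u := Finset.univ) (f := fun i s => G s (σ i) i)
    (f' := fun i => G' (σ i) i) fun i _ => h (σ i) i).const_smul ((Equiv.Perm.sign σ : ℤ))

/-- Differentiation under the integral sign of a square root of an absolute value. -/
lemma hasDerivAt_integral_sqrt_abs {E : Type*} [TopologicalSpace E] [T2Space E]
    [MeasurableSpace E] [OpensMeasurableSpace E] [SecondCountableTopology E]
    {μ : Measure E} [IsFiniteMeasureOnCompacts μ] {K : Set E} (hK : IsCompact K)
    {d d' : ℝ → E → ℝ}
    (hd : ContinuousOn (fun q : ℝ × E => d q.1 q.2) (Set.univ ×ˢ K))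
    (hd' : ContinuousOn (fun q : ℝ × E => d' q.1 q.2) (Set.univ ×ˢ K))
    (hder : ∀ t, ∀ y ∈ K, HasDerivAt (fun s => d s y) (d' t y) t)
    (h0 : ∀ y ∈ K, d 0 y ≠ 0) {τ : E → ℝ} (hτ : ∀ y ∈ K, d' 0 y = d 0 y * τ y) :
    HasDerivAt (fun t => ∫ y in K, √|d t y| ∂μ) (∫ y in K, √|d 0 y| * τ y / 2 ∂μ) 0 := by
  -- By the tube lemma, non-vanishing of `d 0` on the compact `K` persists on `K` for all `t` in an
  -- interval around `0`, where the square root is smooth and its derivative bounded.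
  obtain ⟨r, hr, hne⟩ : ∃ r > 0, ∀ t ∈ Set.Icc (-r) r, ∀ y ∈ K, d t y ≠ 0 := by
    by_contra! hcon
    obtain ⟨U, hU, hU'⟩ := (continuousOn_iff'.1 hd {x | x ≠ 0} isOpen_ne)
    have hsub : ({0} : Set ℝ) ×ˢ K ⊆ U := by
      rintro ⟨t, y⟩ ⟨ht, hy⟩
      have ht0 : t = 0 := ht
      subst ht0
      have : ((0 : ℝ), y) ∈ (fun q : ℝ × E => d q.1 q.2) ⁻¹' {x | x ≠ 0} ∩ Set.univ ×ˢ K :=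
        ⟨h0 y hy, Set.mem_univ _, hy⟩
      rw [hU'] at this
      exact this.1
    obtain ⟨A, B, hA, hB, hA0, hKB, hAB⟩ := generalized_tube_lemma isCompact_singleton hK hU hsub
    obtain ⟨δ, hδ, hball⟩ := Metric.isOpen_iff.1 hA 0 (hA0 rfl)
    obtain ⟨t, ht, y, hy, hty⟩ := hcon (δ / 2) (half_pos hδ)
    have htA : t ∈ A := hball (by
      rw [Metric.mem_ball, Real.dist_eq, sub_zero]
      exact (abs_le.2 ht).trans_lt (half_lt_self hδ))
    have : (t, y) ∈ U ∩ Set.univ ×ˢ K := ⟨hAB ⟨htA, hKB hy⟩, Set.mem_univ _, hy⟩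
    rw [← hU'] at this
    exact this.1 hty
  set F' : ℝ → E → ℝ := fun t y => d t y * d' t y / |d t y| / (2 * √|d t y|) with hF'
  have hcomp : IsCompact (Set.Icc (-r) r ×ˢ K) := isCompact_Icc.prod hK
  have hsub : Set.Icc (-r) r ×ˢ K ⊆ Set.univ ×ˢ K := Set.prod_mono (Set.subset_univ _) le_rfl
  have hF'c : ContinuousOn (fun q : ℝ × E => F' q.1 q.2) (Set.Icc (-r) r ×ˢ K) := by
    have h1 := hd.mono hsub
    have h2 := hd'.mono hsub
    refine ((h1.mul h2).div h1.abs fun q hq => ?_).div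
      (continuousOn_const.mul h1.abs.sqrt) fun q hq => ?_
    · exact abs_ne_zero.2 (hne _ hq.1 _ hq.2)
    · have := abs_pos.2 (hne _ hq.1 _ hq.2)
      positivity
  obtain ⟨C, hC⟩ := hcomp.exists_bound_of_continuousOn hF'c
  have hslice : ∀ t, ContinuousOn (fun y => d t y) K := fun t =>
    hd.comp (f := fun y => (t, y)) (by fun_prop) fun y hy => ⟨Set.mem_univ _, hy⟩
  have h00 : (0 : ℝ) ∈ Set.Icc (-r) r := ⟨by linarith, hr.le⟩
  have hs : Set.Icc (-r) r ∈ 𝓝 (0 : ℝ) := Icc_mem_nhds (by linarith) hr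
  have key := hasDerivAt_integral_of_dominated_loc_of_deriv_le (μ := μ.restrict K) (x₀ := (0 : ℝ))
    (F := fun t y => √|d t y|) (F' := F') (bound := fun _ => C) hs
    (Filter.Eventually.of_forall fun t =>
      (hslice t).abs.sqrt.aestronglyMeasurable hK.measurableSet)
    ((hslice 0).abs.sqrt.integrableOn_compact hK)
    ((hF'c.comp (f := fun y => ((0 : ℝ), y)) (by fun_prop)
      fun y hy => ⟨h00, hy⟩).aestronglyMeasurable hK.measurableSet)
    ((ae_restrict_iff' hK.measurableSet).2 (Filter.Eventually.of_forall
      fun y hy t ht => hC (t, y) ⟨ht, hy⟩))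
    (integrableOn_const hK.measure_lt_top.ne)
    ((ae_restrict_iff' hK.measurableSet).2 (Filter.Eventually.of_forall fun y hy t ht => by
      have hn := hne t ht y hy
      -- Writing `|d|` as `√(d²)` avoids a distinction of signs.
      have h1 := (((hder t y hy).fun_pow 2).sqrt (pow_ne_zero 2 hn)).sqrt (by
        rw [Real.sqrt_sq_eq_abs]; exact abs_ne_zero.2 hn)
      simp only [Real.sqrt_sq_eq_abs] at h1
      refine h1.congr_deriv ?_
      simp only [hF']
      norm_num
      rw [mul_assoc 2, mul_div_mul_left _ _ two_ne_zero]))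
  refine key.2.congr_deriv ?_
  refine setIntegral_congr_fun hK.measurableSet fun y hy => ?_
  have hp : 0 < |d 0 y| := abs_pos.2 (h0 y hy)
  simp only [hF', hτ y hy]
  have h2 : d 0 y * (d 0 y * τ y) = √|d 0 y| * √|d 0 y| * |d 0 y| * τ y := by
    rw [Real.mul_self_sqrt hp.le, abs_mul_abs_self]; ring
  rw [h2]
  have : √|d 0 y| ≠ 0 := (Real.sqrt_pos.2 hp).ne'
  field_simp

end Calculus

end MinimalLagrangian

namespace MinimalLagrangian

open Complex MeasureTheory Topology

/-! ### First variation along normal fields -/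

section Variation

variable {p n : ℕ}

/-- The complex Jacobian matrix; its rows are the images of the standard basis vectors. -/
def jac (u : EuclideanSpace ℝ (Fin n) → (Fin n → ℂ)) (y : EuclideanSpace ℝ (Fin n)) :
    Matrix (Fin n) (Fin n) ℂ :=
  Matrix.of fun a => fderiv ℝ u y (EuclideanSpace.single a (1 : ℝ))

/-- The Gram matrix of a frame. -/
def gram (p : ℕ) {n : ℕ} (F : Fin n → Fin n → ℂ) : Matrix (Fin n) (Fin n) ℝ :=
  Matrix.of fun a b => pseudoMetric p (F a) (F b)

lemma gram_transpose (F : Fin n → Fin n → ℂ) : (gram p F)ᵀ = gram p F := by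
  ext a b; exact pseudoMetric_symm _ _

lemma pseudoHerm_eq_gram {F : Fin n → Fin n → ℂ}
    (hF : ∀ a b, pseudoOmega p (F a) (F b) = 0) (a b : Fin n) :
    pseudoHerm p (F a) (F b) = (gram p F a b : ℂ) := by
  have := hF a b
  refine Complex.ext rfl ?_
  simp only [pseudoOmega, neg_eq_zero] at this
  simp [this]

/-- On an isotropic frame the Hermitian and the real Gram matrices agree, so the latter is `F · diag
· Fᴴ` and its determinant is `± |det F|²`. -/
lemma gram_det_ne_zero {F : Fin n → Fin n → ℂ} (hF : ∀ a b, pseudoOmega p (F a) (F b) = 0)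
    (hdet : (Matrix.of F).det ≠ 0) : (gram p F).det ≠ 0 := by
  have h : (gram p F).map (Complex.ofRealHom) =
      Matrix.of F * Matrix.diagonal (fun j => (sgnCoeff p j : ℂ)) * (Matrix.of F)ᴴ := by
    ext a b
    rw [Matrix.mul_apply]
    simp only [Matrix.map_apply, ofRealHom_eq_coe, ← pseudoHerm_eq_gram hF a b, pseudoHerm,
      Matrix.mul_diagonal, Matrix.conjTranspose_apply, Matrix.of_apply,
      starRingEnd_apply]
    exact Finset.sum_congr rfl fun j _ => by ring
  have h2 := congrArg Matrix.det h
  rw [← RingHom.mapMatrix_apply, ← RingHom.map_det] at h2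
  intro h0
  rw [h0, map_zero, Matrix.det_mul, Matrix.det_mul, Matrix.det_diagonal,
    Matrix.det_conjTranspose] at h2
  have h3 := h2.symm
  rw [mul_eq_zero, mul_eq_zero] at h3
  rcases h3 with (h3 | h3) | h3
  · exact hdet h3
  · rw [Finset.prod_eq_zero_iff] at h3
    obtain ⟨j, -, hj⟩ := h3
    exact sgnCoeff_ne_zero j (by exact_mod_cast hj)
  · exact hdet (star_eq_zero.1 h3)

/-- The first order variation of the Gram determinant in the direction `I H`. -/
lemma trace_adjugate_gram {F H W : Fin n → Fin n → ℂ} {r : ℝ} {s : Fin n → ℝ} {j : Fin n}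
    (hF : ∀ a b, pseudoOmega p (F a) (F b) = 0) (hdet : (Matrix.of F).det ≠ 0)
    (hW : ∀ a, W a = I • (s a • F j + r • H a)) :
    Matrix.trace ((gram p F).adjugate * Matrix.of fun a b =>
      pseudoMetric p (W a) (F b) + pseudoMetric p (F a) (W b)) =
      (gram p F).det * (-2 * r * (Matrix.trace (Matrix.of H * (Matrix.of F)⁻¹)).im) := by
  set C : Matrix (Fin n) (Fin n) ℂ := Matrix.of H * (Matrix.of F)⁻¹ with hC
  set Ci : Matrix (Fin n) (Fin n) ℝ := C.map Complex.im with hCi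
  have hH : ∀ a, H a = ∑ c, C a c • F c := by
    intro a
    have h1 : C * Matrix.of F = Matrix.of H := by
      rw [hC, Matrix.mul_assoc, Matrix.nonsing_inv_mul _ (isUnit_iff_ne_zero.2 hdet),
        Matrix.mul_one]
    ext k
    have := congrFun (congrFun h1 a) k
    simp only [Matrix.mul_apply, Matrix.of_apply] at this
    simp [← this]
  have hsum : ∀ (c : Fin n → ℂ) b, pseudoHerm p (∑ k, c k • F k) (F b) =
      ∑ k, c k * (gram p F k b : ℂ) := by
    intro c b
    let L : (Fin n → ℂ) →ₗ[ℂ] ℂ :=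
      { toFun := fun z => pseudoHerm p z (F b)
        map_add' := fun z w => pseudoHerm_add_left z w _
        map_smul' := fun c z => pseudoHerm_smul_left c z _ }
    change L _ = _
    rw [map_sum]
    refine Finset.sum_congr rfl fun k _ => ?_
    rw [map_smul, smul_eq_mul]
    congr 1
    exact pseudoHerm_eq_gram hF k b
  -- The multiples of `i F j` are orthogonal to the frame by isotropy, so derivatives of the cut-off
  -- function drop out. Of the coefficients of `H` in the frame `F`, only the imaginary parts
  -- survive multiplication by `i`.
  have hWF : ∀ a b, pseudoMetric p (W a) (F b) = -(r * (Ci * gram p F) a b) := by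
    intro a b
    rw [hW a, pseudoMetric_I_smul_left, pseudoOmega_add_left, pseudoOmega_smul_left,
      pseudoOmega_smul_left, hF, hH a, pseudoOmega, hsum, im_sum, Matrix.mul_apply]
    simp [hCi]
  have hmat : (Matrix.of fun a b => pseudoMetric p (W a) (F b) + pseudoMetric p (F a) (W b)) =
      -(r • (Ci * gram p F + (Ci * gram p F)ᵀ)) := by
    ext a b
    simp only [Matrix.of_apply, Matrix.neg_apply, Matrix.smul_apply, Matrix.add_apply,
      Matrix.transpose_apply, smul_eq_mul]
    rw [pseudoMetric_symm (F a), hWF, hWF]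
    ring
  have htr1 : Matrix.trace ((gram p F).adjugate * (Ci * gram p F)) =
      (gram p F).det * Ci.trace := by
    rw [Matrix.trace_mul_comm, Matrix.mul_assoc, Matrix.mul_adjugate, Matrix.mul_smul,
      Matrix.mul_one, Matrix.trace_smul, smul_eq_mul]
  have htr2 : Matrix.trace ((gram p F).adjugate * (Ci * gram p F)ᵀ) =
      (gram p F).det * Ci.trace := by
    rw [← Matrix.trace_transpose, Matrix.transpose_mul, Matrix.transpose_transpose,
      Matrix.adjugate_transpose, gram_transpose, Matrix.trace_mul_comm, htr1]
  have htr : Ci.trace = C.trace.im := by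
    simp [Matrix.trace, hCi, im_sum]
  rw [hmat, Matrix.mul_neg, Matrix.mul_smul, Matrix.mul_add, Matrix.trace_neg, Matrix.trace_smul,
    Matrix.trace_add, htr1, htr2, htr, smul_eq_mul]
  ring

lemma continuousOn_pseudoMetric {X : Type*} [TopologicalSpace X] {v w : X → (Fin n → ℂ)}
    {s : Set X} (hv : ContinuousOn v s) (hw : ContinuousOn w s) :
    ContinuousOn (fun x => pseudoMetric p (v x) (w x)) s := by
  have hv' := continuousOn_pi.1 hv
  have hw' := continuousOn_pi.1 hw
  refine continuous_re.comp_continuousOn (continuousOn_finsetSum _ fun j _ => ?_)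
  exact continuousOn_const.mul ((hv' j).mul (continuous_conj.comp_continuousOn (hw' j)))

lemma continuousOn_gram {X : Type*} [TopologicalSpace X] {F : X → Fin n → Fin n → ℂ} {s : Set X}
    (hF : ∀ a, ContinuousOn (fun x => F x a) s) : ContinuousOn (fun x => gram p (F x)) s :=
  continuousOn_pi.2 fun a => continuousOn_pi.2 fun b => continuousOn_pseudoMetric (hF a) (hF b)

variable {u : EuclideanSpace ℝ (Fin n) → (Fin n → ℂ)} {O : Set (EuclideanSpace ℝ (Fin n))}

/-- In the application `V = φ · i ∂ⱼu`, with `s` the partial derivatives of `φ` and `H` the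
derivatives of the frame. Only `φ` enters the first variation, so no integration by parts is needed.
-/
lemma hasDerivAt_paramVolume (hO : IsOpen O) (hu : ContDiffOn ℝ ∞ u O)
    (hLag : ∀ y ∈ O, ∀ a b, pseudoOmega p (jac u y a) (jac u y b) = 0)
    (hdet : ∀ y ∈ O, (jac u y).det ≠ 0)
    {V : EuclideanSpace ℝ (Fin n) → (Fin n → ℂ)} (hV : ContDiff ℝ ∞ V)
    {K : Set (EuclideanSpace ℝ (Fin n))} (hK : IsCompact K) (hKO : K ⊆ O)
    {j : Fin n} {φ : EuclideanSpace ℝ (Fin n) → ℝ}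
    {H : EuclideanSpace ℝ (Fin n) → Fin n → Fin n → ℂ}
    {s : EuclideanSpace ℝ (Fin n) → Fin n → ℝ}
    (hVH : ∀ y ∈ K, ∀ a, jac V y a = I • (s y a • jac u y j + φ y • H y a)) :
    HasDerivAt (fun t : ℝ => paramVolume p (fun y => u y + t • V y) K)
      (∫ y in K, √|(gram p (jac u y)).det| *
        (-2 * φ y * (Matrix.trace (Matrix.of (H y) * (jac u y)⁻¹)).im) / 2) 0 := by
  set F : ℝ → EuclideanSpace ℝ (Fin n) → Fin n → Fin n → ℂ :=
    fun t y a => jac u y a + t • jac V y a with hF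
  set G' : ℝ → EuclideanSpace ℝ (Fin n) → Matrix (Fin n) (Fin n) ℝ := fun t y =>
    Matrix.of fun a b => pseudoMetric p (jac V y a) (F t y b) + pseudoMetric p (F t y a) (jac V y b)
    with hG'
  have hjacu : ∀ a, ContinuousOn (fun y => jac u y a) K := fun a =>
    ((hu.continuousOn_fderiv_of_isOpen hO (by simp)).clm_apply continuousOn_const).mono hKO
  have hjacV : ∀ a, Continuous (fun y => jac V y a) := fun a =>
    (hV.continuous_fderiv (by simp)).clm_apply continuous_const
  have hVc : ∀ a, ContinuousOn (fun q : ℝ × EuclideanSpace ℝ (Fin n) => jac V q.2 a)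
      (Set.univ ×ˢ K) := fun a => ((hjacV a).comp continuous_snd).continuousOn
  have hUc : ∀ a, ContinuousOn (fun q : ℝ × EuclideanSpace ℝ (Fin n) => jac u q.2 a)
      (Set.univ ×ˢ K) := fun a => (hjacu a).comp continuousOn_snd fun q hq => hq.2
  have hFc : ∀ a, ContinuousOn (fun q : ℝ × EuclideanSpace ℝ (Fin n) => F q.1 q.2 a)
      (Set.univ ×ˢ K) := fun a => (hUc a).add (continuousOn_fst.smul (hVc a))
  have hGc : ContinuousOn (fun q : ℝ × EuclideanSpace ℝ (Fin n) => gram p (F q.1 q.2))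
      (Set.univ ×ˢ K) := continuousOn_gram hFc
  have hG'c : ContinuousOn (fun q : ℝ × EuclideanSpace ℝ (Fin n) => G' q.1 q.2)
      (Set.univ ×ˢ K) := continuousOn_pi.2 fun a => continuousOn_pi.2 fun b =>
    (continuousOn_pseudoMetric (hVc a) (hFc b)).add (continuousOn_pseudoMetric (hFc a) (hVc b))
  have hder : ∀ t, ∀ y ∈ K, HasDerivAt (fun r => (gram p (F r y)).det)
      (Matrix.trace ((gram p (F t y)).adjugate * G' t y)) t := by
    intro t y hy
    refine hasDerivAt_det fun a b => ?_
    have h1 : ∀ r, gram p (F r y) a b = pseudoMetric p (jac u y a) (jac u y b) +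
        r * (pseudoMetric p (jac V y a) (jac u y b) + pseudoMetric p (jac u y a) (jac V y b)) +
        r ^ 2 * pseudoMetric p (jac V y a) (jac V y b) := by
      intro r
      simp only [gram, hF, Matrix.of_apply, pseudoMetric_add_left, pseudoMetric_add_right,
        pseudoMetric_smul_left, pseudoMetric_smul_right]
      ring
    have h2 : ∀ A B C : ℝ, HasDerivAt (fun r => A + r * B + r ^ 2 * C) (B + 2 * t * C) t := by
      intro A B C
      refine ((((hasDerivAt_id' t).mul_const B).const_add A).fun_add
        (((hasDerivAt_id' t).fun_pow 2).mul_const C)).congr_deriv ?_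
      norm_num
    refine ((h2 _ _ _).congr_of_eventuallyEq (Filter.Eventually.of_forall h1)).congr_deriv ?_
    simp only [hG', hF, Matrix.of_apply, pseudoMetric_add_left, pseudoMetric_add_right,
      pseudoMetric_smul_left, pseudoMetric_smul_right]
    ring
  have hF0 : ∀ y, F 0 y = jac u y := fun y => by funext a; simp [hF]
  have hdc : ContinuousOn (fun q : ℝ × EuclideanSpace ℝ (Fin n) => (gram p (F q.1 q.2)).det)
      (Set.univ ×ˢ K) := by
    rw [continuousOn_iff_continuous_domRestrict] at hGc ⊢
    exact hGc.matrix_det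
  have hdc' : ContinuousOn (fun q : ℝ × EuclideanSpace ℝ (Fin n) =>
      Matrix.trace ((gram p (F q.1 q.2)).adjugate * G' q.1 q.2)) (Set.univ ×ˢ K) := by
    rw [continuousOn_iff_continuous_domRestrict] at hGc hG'c ⊢
    exact (hGc.matrix_adjugate.matrix_mul hG'c).matrix_trace
  have key := hasDerivAt_integral_sqrt_abs (μ := volume) hK
    (d := fun t y => (gram p (F t y)).det)
    (d' := fun t y => Matrix.trace ((gram p (F t y)).adjugate * G' t y)) hdc hdc' hder
    (fun y hy => by
      rw [hF0]; exact gram_det_ne_zero (hLag y (hKO hy)) (hdet y (hKO hy)))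
    (τ := fun y => -2 * φ y * (Matrix.trace (Matrix.of (H y) * (jac u y)⁻¹)).im)
    (fun y hy => by
      simp only [hG', hF0]
      exact trace_adjugate_gram (hLag y (hKO hy)) (hdet y (hKO hy)) (hVH y hy))
  simp only [hF0] at key
  refine key.congr_of_eventuallyEq (Filter.Eventually.of_forall fun t => ?_)
  refine setIntegral_congr_fun hK.measurableSet fun y hy => ?_
  have hdu : DifferentiableAt ℝ u y :=
    (hu.contDiffAt (hO.mem_nhds (hKO hy))).differentiableAt (by simp)
  have hdV : DifferentiableAt ℝ V y := (hV.differentiable (by simp)) y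
  rw [show fderiv ℝ (fun y => u y + t • V y) y = fderiv ℝ u y + t • fderiv ℝ V y by
    exact (hdu.hasFDerivAt.add (hdV.hasFDerivAt.const_smul t)).fderiv]
  rfl

end Variation

end MinimalLagrangian

namespace MinimalLagrangian

open Complex MeasureTheory Topology

/-! ### Constancy of the Lagrangian angle -/

section Angle

variable {p n : ℕ}

lemma trace_mul_inv (H F : Matrix (Fin n) (Fin n) ℂ) :
    Matrix.trace (H * F⁻¹) = F.det⁻¹ * Matrix.trace (H * F.adjugate) := by
  rw [Matrix.inv_def, Matrix.mul_smul, Matrix.trace_smul, smul_eq_mul, Ring.inverse_eq_inv']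

variable {u : EuclideanSpace ℝ (Fin n) → (Fin n → ℂ)} {O : Set (EuclideanSpace ℝ (Fin n))}

/-- The derivative of the complex Jacobian matrix in the direction of the `j`-th coordinate. -/
def jacDeriv (u : EuclideanSpace ℝ (Fin n) → (Fin n → ℂ)) (j : Fin n)
    (y : EuclideanSpace ℝ (Fin n)) : Matrix (Fin n) (Fin n) ℂ :=
  Matrix.of fun a => fderiv ℝ (fderiv ℝ u) y (EuclideanSpace.single j (1 : ℝ))
    (EuclideanSpace.single a (1 : ℝ))

lemma differentiableAt_det_jac (hO : IsOpen O) (hu : ContDiffOn ℝ ∞ u O)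
    {y : EuclideanSpace ℝ (Fin n)} (hy : y ∈ O) :
    DifferentiableAt ℝ (fun y => (jac u y).det) y := by
  simp only [Matrix.det_apply]
  refine DifferentiableAt.fun_sum fun σ _ => ?_
  refine DifferentiableAt.fun_const_smul ?_ _
  have hc : ∀ a k, ContDiffAt ℝ 1 (fun y => jac u y a k) y := fun a k =>
    contDiffAt_pi.1 ((((hu.fderiv_of_isOpen hO (m := 1) (WithTop.coe_le_coe.2 (le_top : (1 + 1 : ℕ∞) ≤ ⊤))).contDiffAt
      (hO.mem_nhds hy)).clm_apply contDiffAt_const)) k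
  exact (contDiffAt_prod fun i _ => hc (σ i) i).differentiableAt (by simp)

/-- Divided by the determinant, this is `∂ⱼ log det = tr (∂ⱼF · F⁻¹)`: the imaginary part in the
first variation is the derivative of the Lagrangian angle. -/
lemma fderiv_det_jac (hO : IsOpen O) (hu : ContDiffOn ℝ ∞ u O)
    {y : EuclideanSpace ℝ (Fin n)} (hy : y ∈ O) (j : Fin n) :
    fderiv ℝ (fun y => (jac u y).det) y (EuclideanSpace.single j (1 : ℝ)) =
      Matrix.trace ((jac u y).adjugate * jacDeriv u j y) := by
  have hd : DifferentiableAt ℝ (fderiv ℝ u) y :=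
    ((hu.fderiv_of_isOpen hO (m := ∞) (by simp)).contDiffAt (hO.mem_nhds hy)).differentiableAt
      (by simp)
  set c : ℝ → EuclideanSpace ℝ (Fin n) := fun s => y + s • EuclideanSpace.single j (1 : ℝ) with hc
  have hc0 : c 0 = y := by simp [hc]
  have hcd : HasDerivAt c (EuclideanSpace.single j (1 : ℝ)) 0 := by
    exact (((hasDerivAt_id' (0 : ℝ)).smul_const
      (EuclideanSpace.single j (1 : ℝ))).const_add y).congr_deriv (one_smul _ _)
  have h1 : HasDerivAt (fun s => (jac u (c s)).det)
      (Matrix.trace ((jac u (c 0)).adjugate * jacDeriv u j y)) 0 := by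
    refine hasDerivAt_det fun a k => ?_
    have h2 : HasDerivAt (fun s => fderiv ℝ u (c s))
        (fderiv ℝ (fderiv ℝ u) y (EuclideanSpace.single j (1 : ℝ))) 0 := by
      have := hd.hasFDerivAt
      rw [← hc0] at this
      exact (this.comp_hasDerivAt 0 hcd).congr_deriv (by rw [hc0])
    have h3 := h2.clm_apply (hasDerivAt_const (0 : ℝ) (EuclideanSpace.single a (1 : ℝ)))
    exact (hasDerivAt_pi.1 h3 k).congr_deriv (by simp [jacDeriv])
  have h4 : HasDerivAt (fun s => (jac u (c s)).det)
      (fderiv ℝ (fun y => (jac u y).det) y (EuclideanSpace.single j (1 : ℝ))) 0 := by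
    have := (differentiableAt_det_jac hO hu hy).hasFDerivAt
    rw [← hc0] at this
    exact (this.comp_hasDerivAt 0 hcd).congr_deriv (by rw [hc0])
  rw [h4.unique h1, hc0]

lemma continuousOn_im_trace (hO : IsOpen O) (hu : ContDiffOn ℝ ∞ u O)
    (hdet : ∀ y ∈ O, (jac u y).det ≠ 0) (j : Fin n) :
    ContinuousOn (fun y => (Matrix.trace (jacDeriv u j y * (jac u y)⁻¹)).im) O := by
  have h1 : ContinuousOn (fderiv ℝ u) O := hu.continuousOn_fderiv_of_isOpen hO (by simp)
  have h2 : ContinuousOn (fderiv ℝ (fderiv ℝ u)) O :=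
    (hu.fderiv_of_isOpen hO (m := ∞) (by simp)).continuousOn_fderiv_of_isOpen hO (by simp)
  have hJ : ContinuousOn (jac u) O :=
    continuousOn_pi.2 fun a => h1.clm_apply continuousOn_const
  have hH : ContinuousOn (jacDeriv u j) O :=
    continuousOn_pi.2 fun a => (h2.clm_apply continuousOn_const).clm_apply continuousOn_const
  simp only [trace_mul_inv]
  have hd : ContinuousOn (fun y => (jac u y).det) O := by
    rw [continuousOn_iff_continuous_domRestrict] at hJ ⊢
    exact hJ.matrix_det
  have ht : ContinuousOn (fun y => Matrix.trace (jacDeriv u j y * (jac u y).adjugate)) O := by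
    rw [continuousOn_iff_continuous_domRestrict] at hJ hH ⊢
    exact (hH.matrix_mul hJ.matrix_adjugate).matrix_trace
  exact continuous_im.comp_continuousOn ((hd.inv₀ hdet).mul ht)

/-- This is the fundamental lemma of the calculus of variations: near a point where the derivative
of the angle is nonzero, a bump function times `i ∂ⱼu` would have a nonzero first variation. -/
lemma im_trace_eq_zero_of_critical (hO : IsOpen O) (hu : ContDiffOn ℝ ∞ u O)
    (hLag : ∀ y ∈ O, ∀ a b, pseudoOmega p (jac u y a) (jac u y b) = 0)
    (hdet : ∀ y ∈ O, (jac u y).det ≠ 0)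
    (hcrit : ∀ V : EuclideanSpace ℝ (Fin n) → (Fin n → ℂ), ContDiff ℝ ∞ V →
      HasCompactSupport V → tsupport V ⊆ O →
        HasDerivAt (fun t : ℝ => paramVolume p (fun y => u y + t • V y) (tsupport V)) 0 0)
    {y₀ : EuclideanSpace ℝ (Fin n)} (hy₀ : y₀ ∈ O) (j : Fin n) :
    (Matrix.trace (jacDeriv u j y₀ * (jac u y₀)⁻¹)).im = 0 := by
  set τ : EuclideanSpace ℝ (Fin n) → ℝ :=
    fun y => (Matrix.trace (jacDeriv u j y * (jac u y)⁻¹)).im with hτ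
  have hτc : ContinuousOn τ O := continuousOn_im_trace hO hu hdet j
  by_contra hne
  change τ y₀ ≠ 0 at hne
  obtain ⟨r, hr, hball⟩ : ∃ r > 0, ∀ y ∈ Metric.ball y₀ r, y ∈ O ∧ 0 < τ y * τ y₀ := by
    have h1 : ∀ᶠ y in 𝓝 y₀, 0 < τ y * τ y₀ :=
      (((hτc y₀ hy₀).continuousAt (hO.mem_nhds hy₀)).mul continuousAt_const).eventually
        (lt_mem_nhds (mul_self_pos.2 hne))
    exact Metric.eventually_nhds_iff_ball.1 ((show ∀ᶠ y in 𝓝 y₀, y ∈ O from hO.mem_nhds hy₀).and h1)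
  let φ : ContDiffBump y₀ := ⟨r / 4, r / 2, by positivity, by linarith⟩
  have hφsub : tsupport φ ⊆ Metric.ball y₀ r := by
    rw [φ.tsupport_eq]
    exact Metric.closedBall_subset_ball (by change r / 2 < r; linarith)
  have hφsupp : Function.support φ = Metric.ball y₀ (r / 2) := φ.support_eq
  set w : EuclideanSpace ℝ (Fin n) → (Fin n → ℂ) := fun y => I • jac u y j with hw
  have hws : ContDiffOn ℝ ∞ w O :=
    ((hu.fderiv_of_isOpen hO (m := ∞) (by simp)).clm_apply contDiffOn_const).const_smul I
  set V : EuclideanSpace ℝ (Fin n) → (Fin n → ℂ) := fun y => φ y • w y with hVdef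
  have hVts : tsupport V ⊆ tsupport φ := tsupport_smul_subset_left φ w
  have hVO : tsupport V ⊆ O := fun y hy => (hball y (hφsub (hVts hy))).1
  have hVs : ContDiff ℝ ∞ V := contDiff_iff_contDiffAt.2 fun y => by
    by_cases hy : y ∈ tsupport V
    · exact φ.contDiff.contDiffAt.smul (hws.contDiffAt (hO.mem_nhds (hVO hy)))
    · exact contDiffAt_const.congr_of_eventuallyEq (notMem_tsupport_iff_eventuallyEq.1 hy)
  have hVc : HasCompactSupport V := φ.hasCompactSupport.mono' (subset_closure.trans hVts)
  have hVH : ∀ y ∈ tsupport V, ∀ a, jac V y a =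
      I • ((fderiv ℝ φ y (EuclideanSpace.single a (1 : ℝ))) • jac u y j +
        φ y • jacDeriv u j y a) := by
    intro y hy a
    have hyO := hVO hy
    have hd : DifferentiableAt ℝ (fderiv ℝ u) y :=
      ((hu.fderiv_of_isOpen hO (m := ∞) (by simp)).contDiffAt (hO.mem_nhds hyO)).differentiableAt
        (by simp)
    -- Symmetry of the second derivative turns `∂ₐ(∂ⱼu)`, which arises from differentiating `V`,
    -- into row `a` of `jacDeriv u j`, the `j`-derivative of the frame.
    have hsymm : IsSymmSndFDerivAt ℝ u y :=
      (hu.contDiffAt (hO.mem_nhds hyO)).isSymmSndFDerivAt (by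
        rw [minSmoothness_of_isRCLikeNormedField]; exact WithTop.coe_le_coe.2 (le_top : (2 : ℕ∞) ≤ ⊤))
    have h1 : HasFDerivAt w (I • (fderiv ℝ (fderiv ℝ u) y).flip
        (EuclideanSpace.single j (1 : ℝ))) y := by
      have := (hd.hasFDerivAt.clm_apply
        (hasFDerivAt_const (EuclideanSpace.single j (1 : ℝ)) y)).const_smul I
      refine this.congr_fderiv ?_
      simp
    have h2 := (φ.contDiff (n := 1)).differentiable (by simp) y
    have h3 := (h2.hasFDerivAt.smul h1).fderiv
    have h4 : jac V y a = fderiv ℝ (fun y => φ y • w y) y (EuclideanSpace.single a (1 : ℝ)) := rfl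
    rw [h4, show (fun y => φ y • w y) = ((φ : EuclideanSpace ℝ (Fin n) → ℝ) • w) from rfl, h3]
    simp only [_root_.add_apply, _root_.smul_apply,
      ContinuousLinearMap.flip_apply, ContinuousLinearMap.smulRight_apply, hw, jacDeriv]
    rw [hsymm.eq]
    ext k
    simp
    ring
  have hder := hasDerivAt_paramVolume (p := p) hO hu hLag hdet hVs hVc.isCompact hVO
    (H := fun y => jacDeriv u j y) hVH
  have h0 := hder.unique (hcrit V hVs hVc hVO)
  -- The extra factor `τ y₀` makes the integrand non-negative whatever the sign of `τ` near `y₀`.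
  set g : EuclideanSpace ℝ (Fin n) → ℝ := fun y =>
    √|(gram p (jac u y)).det| * φ y * (τ y * τ y₀) with hg
  have hg0 : ∫ y in tsupport V, g y = 0 := by
    have : ∀ y, g y = (-τ y₀) * (√|(gram p (jac u y)).det| *
        (-2 * φ y * (Matrix.trace (Matrix.of (fun a => jacDeriv u j y a) *
          (jac u y)⁻¹)).im) / 2) := by
      intro y
      have e : (Matrix.trace (Matrix.of (fun a => jacDeriv u j y a) * (jac u y)⁻¹)).im = τ y := rfl
      rw [e, hg]
      ring
    simp only [this]
    rw [integral_const_mul, h0, mul_zero]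
  have hgc : ContinuousOn g (tsupport V) := by
    have hJ : ContinuousOn (fun y => (gram p (jac u y)).det) O := by
      have : ContinuousOn (fun y => gram p (jac u y)) O := continuousOn_gram fun a =>
        (hu.continuousOn_fderiv_of_isOpen hO (by simp)).clm_apply continuousOn_const
      rw [continuousOn_iff_continuous_domRestrict] at this ⊢
      exact this.matrix_det
    exact (((hJ.abs.sqrt).mul φ.continuous.continuousOn).mul
      (hτc.mul continuousOn_const)).mono hVO
  have hgnn : 0 ≤ᵐ[volume.restrict (tsupport V)] g := by
    refine (ae_restrict_iff' hVc.isCompact.measurableSet).2 (Filter.Eventually.of_forall ?_)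
    intro y hy
    exact mul_nonneg (mul_nonneg (Real.sqrt_nonneg _) φ.nonneg)
      (hball y (hφsub (hVts hy))).2.le
  have hpos : 0 < ∫ y in tsupport V, g y := by
    rw [setIntegral_pos_iff_support_of_nonneg_ae hgnn (hgc.integrableOn_compact hVc.isCompact)]
    refine (Metric.measure_ball_pos volume y₀ (half_pos hr)).trans_le (measure_mono fun y hy => ?_)
    have hφy : φ y ≠ 0 := by rw [← Function.mem_support, hφsupp]; exact hy
    obtain ⟨hyO, hyτ⟩ := hball y (Metric.ball_subset_ball (by linarith) hy)
    refine ⟨?_, subset_closure ?_⟩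
    · have : 0 < |(gram p (jac u y)).det| :=
        abs_pos.2 (gram_det_ne_zero (hLag y hyO) (hdet y hyO))
      exact mul_ne_zero (mul_ne_zero (Real.sqrt_pos.2 this).ne' hφy) hyτ.ne'
    · intro h
      have h5 : jac u y j = 0 := by simpa [hVdef, hw, hφy] using h
      exact hdet y hyO (Matrix.det_eq_zero_of_row_eq_zero j fun k => congrFun h5 k)
  exact hpos.ne' hg0

/-- The phase of the complex Jacobian determinant of a critical Lagrangian immersion is locally
constant. -/
lemma fderiv_det_div_conj (hO : IsOpen O) (hu : ContDiffOn ℝ ∞ u O)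
    (hLag : ∀ y ∈ O, ∀ a b, pseudoOmega p (jac u y a) (jac u y b) = 0)
    (hdet : ∀ y ∈ O, (jac u y).det ≠ 0)
    (hcrit : ∀ V : EuclideanSpace ℝ (Fin n) → (Fin n → ℂ), ContDiff ℝ ∞ V →
      HasCompactSupport V → tsupport V ⊆ O →
        HasDerivAt (fun t : ℝ => paramVolume p (fun y => u y + t • V y) (tsupport V)) 0 0)
    {y : EuclideanSpace ℝ (Fin n)} (hy : y ∈ O) :
    HasFDerivAt (fun y => (jac u y).det / (starRingEnd ℂ) (jac u y).det)
      (0 : EuclideanSpace ℝ (Fin n) →L[ℝ] ℂ) y := by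
  have hD := differentiableAt_det_jac hO hu hy
  have hc0 : (starRingEnd ℂ) (jac u y).det ≠ 0 := by simpa using hdet y hy
  have hDc : HasFDerivAt (fun y => (starRingEnd ℂ) (jac u y).det)
      (conjCLE.toContinuousLinearMap.comp (fderiv ℝ (fun y => (jac u y).det) y)) y :=
    conjCLE.toContinuousLinearMap.hasFDerivAt.comp y hD.hasFDerivAt
  -- The logarithmic derivative of the determinant is real, so the determinant and its conjugate
  -- have the same one and their quotient has derivative zero.
  have hreal : ∀ v, (fderiv ℝ (fun y => (jac u y).det) y v *
      (starRingEnd ℂ) (jac u y).det).im = 0 := by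
    intro v
    have hbase : ∀ j, (fderiv ℝ (fun y => (jac u y).det) y (EuclideanSpace.single j (1 : ℝ)) *
        (starRingEnd ℂ) (jac u y).det).im = 0 := by
      intro j
      have h1 := im_trace_eq_zero_of_critical hO hu hLag hdet hcrit hy j
      rw [trace_mul_inv] at h1
      rw [fderiv_det_jac hO hu hy, Matrix.trace_mul_comm]
      have h2 : Matrix.trace (jacDeriv u j y * (jac u y).adjugate) *
          (starRingEnd ℂ) (jac u y).det = (normSq (jac u y).det : ℂ) *
            ((jac u y).det⁻¹ * Matrix.trace (jacDeriv u j y * (jac u y).adjugate)) := by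
        rw [← mul_conj]
        field_simp [hdet y hy]
      rw [h2, im_ofReal_mul, h1, mul_zero]
    have hv : v = ∑ j, v j • EuclideanSpace.single j (1 : ℝ) := by
      ext k
      simp [Finset.sum_apply, Pi.single_apply]
    rw [hv, map_sum, Finset.sum_mul, im_sum]
    refine Finset.sum_eq_zero fun j _ => ?_
    rw [map_smul, real_smul, mul_assoc, im_ofReal_mul, hbase, mul_zero]
  have h := hD.hasFDerivAt.mul ((hasFDerivAt_inv' (𝕜 := ℝ) hc0).comp y hDc)
  refine h.congr_fderiv ?_
  ext v
  have hv : (fderiv ℝ (fun y => (jac u y).det) y v) * (starRingEnd ℂ) (jac u y).det =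
      (jac u y).det * (starRingEnd ℂ) (fderiv ℝ (fun y => (jac u y).det) y v) := by
    rw [← conj_eq_iff_im.2 (hreal v), map_mul, conj_conj, mul_comm]
  simp
  field_simp
  rw [← hv]
  ring

end Angle

end MinimalLagrangian

namespace MinimalLagrangian

open Complex MeasureTheory Topology

/-! ### Immersions read in charts -/

section Immersion

variable {n p : ℕ} {M : Type*} [TopologicalSpace M] [ChartedSpace (EuclideanSpace ℝ (Fin n)) M]

/-- The differential of a map to `ℂⁿ`, as a map between fixed vector spaces. -/
def differential (f : M → (Fin n → ℂ)) (x : M) : EuclideanSpace ℝ (Fin n) →L[ℝ] (Fin n → ℂ) :=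
  mfderiv (𝓡 n) 𝓘(ℝ, Fin n → ℂ) f x

/-- The image of the tangent space in `ℂⁿ`. -/
def tangentImage (f : M → (Fin n → ℂ)) (x : M) : Submodule ℝ (Fin n → ℂ) :=
  LinearMap.range (differential f x).toLinearMap

/-- The map `f` read in the preferred chart at `x`. -/
def inChart (f : M → (Fin n → ℂ)) (x : M) : EuclideanSpace ℝ (Fin n) → (Fin n → ℂ) :=
  fun y => f ((chartAt (EuclideanSpace ℝ (Fin n)) x).symm y)

lemma mem_tangentImage {f : M → (Fin n → ℂ)} {x : M} {w : Fin n → ℂ} :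
    w ∈ tangentImage f x ↔ ∃ v, differential f x v = w := Iff.rfl

variable {f : M → (Fin n → ℂ)}

lemma finrank_tangentImage (hf : IsSmoothImmersion f) (x : M) :
    Module.finrank ℝ (tangentImage f x) = n := by
  have h : Function.Injective (differential f x).toLinearMap := hf.2 x
  rw [tangentImage, LinearMap.finrank_range_of_inj h, finrank_euclideanSpace_fin]

lemma apply_chartAt (f : M → (Fin n → ℂ)) (x : M) :
    inChart f x (chartAt (EuclideanSpace ℝ (Fin n)) x x) = f x := by
  simp [inChart]

/-- A function on a connected manifold with zero derivative in the charts is constant. -/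
lemma eq_of_hasFDerivAt_zero {G : Type*} [NormedAddCommGroup G] [NormedSpace ℝ G]
    [ConnectedSpace M] {g : M → G}
    (hg : ∀ x, ∀ y ∈ (chartAt (EuclideanSpace ℝ (Fin n)) x).target,
      HasFDerivAt (fun y => g ((chartAt (EuclideanSpace ℝ (Fin n)) x).symm y))
        (0 : EuclideanSpace ℝ (Fin n) →L[ℝ] G) y) (x x' : M) : g x = g x' := by
  have hloc : IsLocallyConstant g := by
    rw [IsLocallyConstant.iff_eventually_eq]
    intro x
    set e := chartAt (EuclideanSpace ℝ (Fin n)) x with he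
    have hopen := e.open_target.isOpen_inter_preimage_of_fderiv_eq_zero (𝕜 := ℝ)
      (f := fun y => g (e.symm y))
      (fun y hy => (hg x y hy).differentiableAt.differentiableWithinAt)
      (fun y hy => (hg x y hy).fderiv) {g x}
    have hx : e x ∈ e.target ∩ (fun y => g (e.symm y)) ⁻¹' {g x} :=
      ⟨mem_chart_target _ x, by simp [he]⟩
    have h1 := (e.continuousAt (mem_chart_source _ x)).eventually (hopen.mem_nhds hx)
    have h2 := e.open_source.mem_nhds (mem_chart_source (EuclideanSpace ℝ (Fin n)) x)
    filter_upwards [h1, h2] with z hz hz'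
    have := hz.2
    simpa [e.left_inv hz'] using this
  exact hloc.apply_eq_of_isPreconnected isPreconnected_univ (Set.mem_univ _) (Set.mem_univ _)

lemma isLagrangianSubspace_tangentImage (hf : IsSmoothImmersion f)
    (hLag : IsLagrangianImmersion p f) (hnd : IsNondegenerateImmersion p f) (x : M) :
    IsLagrangianSubspace p (tangentImage f x) where
  finrank_eq := finrank_tangentImage hf x
  isotropic := by
    rintro _ ⟨v, rfl⟩ _ ⟨w, rfl⟩
    exact hLag x v w
  nondegenerate := by
    rintro _ ⟨v, rfl⟩ h
    have : v = 0 := hnd x v fun w => h _ ⟨w, rfl⟩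
    rw [this, map_zero]

variable [IsManifold (𝓡 n) ∞ M]

lemma contDiffOn_inChart (hf : IsSmoothImmersion f) (x : M) :
    ContDiffOn ℝ ∞ (inChart f x) (chartAt (EuclideanSpace ℝ (Fin n)) x).target := by
  rw [← contMDiffOn_iff_contDiffOn]
  exact hf.1.comp_contMDiffOn (contMDiffOn_chart_symm (I := 𝓡 n) (x := x))

/-- Derivatives in a chart and the manifold differential differ by a linear automorphism of the
source, so they have the same image and are injective together. -/
lemma fderiv_inChart (hf : IsSmoothImmersion f) (x : M) {y : EuclideanSpace ℝ (Fin n)}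
    (hy : y ∈ (chartAt (EuclideanSpace ℝ (Fin n)) x).target) :
    ∃ L : EuclideanSpace ℝ (Fin n) ≃L[ℝ] EuclideanSpace ℝ (Fin n),
      fderiv ℝ (inChart f x) y =
        (differential f ((chartAt (EuclideanSpace ℝ (Fin n)) x).symm y)).comp
          L.toContinuousLinearMap := by
  have : IsManifold (𝓡 n) 1 M := IsManifold.of_le (n := ∞) (by simp)
  have he := (mdifferentiable_chart (I := 𝓡 n) x).symm
  refine ⟨he.mfderiv hy, ?_⟩
  have h1 := mfderiv_comp y (hf.1.mdifferentiableAt (by simp)) (he.mdifferentiableAt hy)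
  rw [← mfderiv_eq_fderiv]
  exact h1

lemma range_fderiv_inChart (hf : IsSmoothImmersion f) (x : M) {y : EuclideanSpace ℝ (Fin n)}
    (hy : y ∈ (chartAt (EuclideanSpace ℝ (Fin n)) x).target) (w : Fin n → ℂ) :
    w ∈ tangentImage f ((chartAt (EuclideanSpace ℝ (Fin n)) x).symm y) ↔
      ∃ v, fderiv ℝ (inChart f x) y v = w := by
  obtain ⟨L, hL⟩ := fderiv_inChart hf x hy
  rw [mem_tangentImage, hL]
  constructor
  · rintro ⟨v, rfl⟩
    exact ⟨L.symm v, by simp⟩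
  · rintro ⟨v, rfl⟩
    exact ⟨L v, rfl⟩

lemma injective_fderiv_inChart (hf : IsSmoothImmersion f) (x : M) {y : EuclideanSpace ℝ (Fin n)}
    (hy : y ∈ (chartAt (EuclideanSpace ℝ (Fin n)) x).target) :
    Function.Injective (fderiv ℝ (inChart f x) y) := by
  obtain ⟨L, hL⟩ := fderiv_inChart hf x hy
  rw [hL]
  exact (hf.2 _).comp L.injective

lemma tangentImage_chartAt (hf : IsSmoothImmersion f) (x : M) (w : Fin n → ℂ) :
    w ∈ tangentImage f x ↔
      ∃ v, fderiv ℝ (inChart f x) (chartAt (EuclideanSpace ℝ (Fin n)) x x) v = w := by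
  have := range_fderiv_inChart hf x (mem_chart_target _ x) w
  simpa using this

lemma hasFDerivAt_inChart (hf : IsSmoothImmersion f) (x : M) {y : EuclideanSpace ℝ (Fin n)}
    (hy : y ∈ (chartAt (EuclideanSpace ℝ (Fin n)) x).target) :
    HasFDerivAt (inChart f x) (fderiv ℝ (inChart f x) y) y :=
  (((contDiffOn_inChart hf x).contDiffAt ((chartAt _ x).open_target.mem_nhds hy)).differentiableAt
    (by simp)).hasFDerivAt

/-- A function on `ℂⁿ` whose differential vanishes on the tangent spaces is constant along a
connected immersed submanifold. -/
lemma comp_eq_of_derivative_zero {G : Type*} [NormedAddCommGroup G] [NormedSpace ℝ G]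
    [ConnectedSpace M] (hf : IsSmoothImmersion f) {Φ : (Fin n → ℂ) → G}
    {Φ' : (Fin n → ℂ) → (Fin n → ℂ) →L[ℝ] G} (hΦ : ∀ z, HasFDerivAt Φ (Φ' z) z)
    (h0 : ∀ x, ∀ v ∈ tangentImage f x, Φ' (f x) v = 0) (x x' : M) : Φ (f x) = Φ (f x') := by
  refine eq_of_hasFDerivAt_zero (n := n) (g := fun x => Φ (f x)) (fun x y hy => ?_) x x'
  refine ((hΦ (inChart f x y)).comp y (hasFDerivAt_inChart hf x hy)).congr_fderiv ?_
  ext v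
  exact h0 _ _ ((range_fderiv_inChart hf x hy _).2 ⟨v, rfl⟩)

lemma linearIndependent_single (n : ℕ) :
    LinearIndependent ℝ (fun a : Fin n => EuclideanSpace.single a (1 : ℝ)) := by
  have := (EuclideanSpace.basisFun (Fin n) ℝ).toBasis.linearIndependent
  rw [OrthonormalBasis.coe_toBasis] at this
  exact (funext fun a => EuclideanSpace.basisFun_apply (Fin n) ℝ a) ▸ this

/-- Determinants of frames of a real subspace are real multiples of each other. -/
lemma exists_det_eq_real_mul {L : EuclideanSpace ℝ (Fin n) →L[ℝ] (Fin n → ℂ)}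
    {v : Fin n → Fin n → ℂ} (hv : ∀ i, ∃ w, L w = v i) :
    ∃ r : ℝ, (Matrix.of v).det =
      r * (Matrix.of fun a => L (EuclideanSpace.single a (1 : ℝ))).det := by
  choose w hw using hv
  refine ⟨(Matrix.of fun i a => w i a).det, ?_⟩
  have h : Matrix.of v = (Matrix.of fun i a => w i a).map Complex.ofRealHom *
      Matrix.of fun a => L (EuclideanSpace.single a (1 : ℝ)) := by
    ext i k
    have hwi : w i = ∑ j, w i j • EuclideanSpace.single j (1 : ℝ) := by
      ext k
      simp [Finset.sum_apply, Pi.single_apply]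
    rw [Matrix.of_apply, ← hw i]
    conv_lhs => rw [hwi, map_sum]
    simp [Matrix.mul_apply, Finset.sum_apply]
  rw [h, Matrix.det_mul, ← RingHom.mapMatrix_apply, ← RingHom.map_det]
  rfl

/-- A connected critical Lagrangian immersion has a constant phase. -/
lemma exists_phase [ConnectedSpace M] (hf : IsSmoothImmersion f)
    (hLag : IsLagrangianImmersion p f) (hmin : IsMinimalImmersion p f) :
    ∃ θ : ℂ, ‖θ‖ = 1 ∧ ∀ x, ∀ v : Fin n → Fin n → ℂ, (∀ i, v i ∈ tangentImage f x) →
      (Matrix.of v).det = θ * (starRingEnd ℂ) (Matrix.of v).det := by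
  set D : M → ℂ := fun x =>
    (Matrix.of fun a => differential f x (EuclideanSpace.single a (1 : ℝ))).det with hD
  have hL := isLagrangianSubspace_tangentImage hf hLag hmin.1
  have hD0 : ∀ x, D x ≠ 0 := fun x =>
    (hL x).det_ne_zero (fun a => ⟨_, rfl⟩)
      ((linearIndependent_single n).map' (differential f x).toLinearMap
        (LinearMap.ker_eq_bot.2 (hf.2 x)))
  have hjac : ∀ x, ∀ y ∈ (chartAt (EuclideanSpace ℝ (Fin n)) x).target,
      (jac (inChart f x) y).det ≠ 0 := fun x y hy =>
    (hL _).det_ne_zero (fun a => (range_fderiv_inChart hf x hy _).2 ⟨_, rfl⟩)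
      ((linearIndependent_single n).map' (fderiv ℝ (inChart f x) y).toLinearMap
        (LinearMap.ker_eq_bot.2 (injective_fderiv_inChart hf x hy)))
  have hconst : ∀ x x', D x / (starRingEnd ℂ) (D x) = D x' / (starRingEnd ℂ) (D x') := by
    refine eq_of_hasFDerivAt_zero (n := n) (g := fun x => D x / (starRingEnd ℂ) (D x)) fun x y hy => ?_
    have hO := (chartAt (EuclideanSpace ℝ (Fin n)) x).open_target
    have h := fderiv_det_div_conj (p := p) hO (contDiffOn_inChart hf x)
      (fun y hy a b => (hL _).isotropic _ ((range_fderiv_inChart hf x hy _).2 ⟨_, rfl⟩) _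
        ((range_fderiv_inChart hf x hy _).2 ⟨_, rfl⟩)) (hjac x)
      (fun V hV hVc hVO => hmin.2 _ (IsManifold.chart_mem_maximalAtlas x) V hV hVc hVO) hy
    refine h.congr_of_eventuallyEq ?_
    filter_upwards [hO.mem_nhds hy] with y' hy'
    -- `D` is computed in the preferred chart of each point and need not be continuous. The
    -- determinant in the fixed chart differs from it by a real factor, which cancels in the
    -- quotient by the conjugate.
    obtain ⟨r, hr⟩ := exists_det_eq_real_mul (v := jac (inChart f x) y')
      (L := differential f ((chartAt (EuclideanSpace ℝ (Fin n)) x).symm y'))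
      (fun a => (range_fderiv_inChart hf x hy' _).2 ⟨_, rfl⟩)
    have hr' : (jac (inChart f x) y').det =
      r * D ((chartAt (EuclideanSpace ℝ (Fin n)) x).symm y') := hr
    have hr0 : (r : ℂ) ≠ 0 := by
      intro h0
      exact hjac x y' hy' (by rw [hr', h0, zero_mul])
    rw [hr', map_mul, conj_ofReal, mul_div_mul_left _ _ hr0]
  obtain ⟨x₀⟩ : Nonempty M := inferInstance
  have hc0 : ∀ x, (starRingEnd ℂ) (D x) ≠ 0 := fun x => by simpa using hD0 x
  refine ⟨D x₀ / (starRingEnd ℂ) (D x₀), ?_, fun x v hv => ?_⟩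
  · rw [norm_div, RCLike.norm_conj, div_self (norm_ne_zero_iff.2 (hD0 x₀))]
  · obtain ⟨r, hr⟩ := exists_det_eq_real_mul (L := differential f x) hv
    have hr' : (Matrix.of v).det = r * D x := hr
    rw [hr', hconst x₀ x, map_mul, conj_ofReal]
    have := hc0 x
    field_simp

end Immersion

end MinimalLagrangian

namespace MinimalLagrangian

open Complex MeasureTheory Topology

/-! ### One-parameter subgroups of the indefinite orthogonal group -/

section Group

variable {n p : ℕ}

/-- The signature matrix. -/
def sgnMatrix (p n : ℕ) : Matrix (Fin n) (Fin n) ℝ := Matrix.diagonal (sgnCoeff p)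

lemma sgnMatrix_mul_self : sgnMatrix p n * sgnMatrix p n = 1 := by
  rw [sgnMatrix, Matrix.diagonal_mul_diagonal]
  simp only [sgnCoeff_mul_self]
  exact Matrix.diagonal_one

lemma det_mul_self_of_preserves {A : Matrix (Fin n) (Fin n) ℝ}
    (hA : Aᵀ * sgnMatrix p n * A = sgnMatrix p n) : A.det * A.det = 1 := by
  have h0 : (sgnMatrix p n).det * (sgnMatrix p n).det = 1 := by
    rw [← Matrix.det_mul, sgnMatrix_mul_self, Matrix.det_one]
  have h1 := congrArg Matrix.det hA
  rw [Matrix.det_mul, Matrix.det_mul, Matrix.det_transpose] at h1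
  have h2 : (A.det * A.det) * ((sgnMatrix p n).det * (sgnMatrix p n).det) =
      (sgnMatrix p n).det * (sgnMatrix p n).det := by linear_combination (sgnMatrix p n).det * h1
  rwa [h0, mul_one] at h2

lemma exp_preserves {X : Matrix (Fin n) (Fin n) ℝ} (hX : Xᵀ * sgnMatrix p n = -(sgnMatrix p n * X)) :
    (NormedSpace.exp X)ᵀ * sgnMatrix p n * NormedSpace.exp X = sgnMatrix p n := by
  have hinv : (sgnMatrix p n)⁻¹ = sgnMatrix p n := Matrix.inv_eq_left_inv sgnMatrix_mul_self
  have hunit : IsUnit (sgnMatrix p n) := ⟨⟨_, _, sgnMatrix_mul_self, sgnMatrix_mul_self⟩, rfl⟩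
  have h1 : Xᵀ = sgnMatrix p n * (-X) * (sgnMatrix p n)⁻¹ := by
    rw [hinv, Matrix.mul_neg, ← hX, Matrix.mul_assoc, sgnMatrix_mul_self, Matrix.mul_one]
  rw [← Matrix.exp_transpose, h1, Matrix.exp_conj _ _ hunit, hinv, Matrix.mul_assoc _ _ (sgnMatrix p n),
    sgnMatrix_mul_self, Matrix.mul_one, Matrix.mul_assoc, ← Matrix.exp_add_of_commute _ _
      (Commute.neg_left (Commute.refl X))]
  simp

/-- Preserving the form gives only determinant `±1`; it is `1` because the exponential is the square
of `exp (tX/2)`. -/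
lemma exp_mem_indefiniteSO {X : Matrix (Fin n) (Fin n) ℝ}
    (hX : Xᵀ * sgnMatrix p n = -(sgnMatrix p n * X)) (t : ℝ) :
    NormedSpace.exp (t • X) ∈ indefiniteSO p n := by
  have hs : ∀ s : ℝ, (s • X)ᵀ * sgnMatrix p n = -(sgnMatrix p n * (s • X)) := fun s => by
    rw [Matrix.transpose_smul, Matrix.smul_mul, hX, Matrix.mul_smul, smul_neg]
  refine ⟨exp_preserves (hs t), ?_⟩
  have h1 : NormedSpace.exp (t • X) =
      NormedSpace.exp ((t / 2) • X) * NormedSpace.exp ((t / 2) • X) := by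
    rw [← Matrix.exp_add_of_commute _ _ (Commute.refl _), ← add_smul, add_halves]
  rw [h1, Matrix.det_mul]
  exact det_mul_self_of_preserves (exp_preserves (hs (t / 2)))

/-- The action of real matrices on `ℂⁿ`. -/
def realAction (n : ℕ) : Matrix (Fin n) (Fin n) ℝ →ₗ[ℝ] (Fin n → ℂ) →L[ℝ] (Fin n → ℂ) where
  toFun A := LinearMap.toContinuousLinearMap
    ((Matrix.mulVecLin (A.map Complex.ofReal)).restrictScalars ℝ)
  map_add' A B := by
    ext z j
    simp [Matrix.mulVec, dotProduct, add_mul, Finset.sum_add_distrib]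
  map_smul' r A := by
    ext z j
    simp [Matrix.mulVec, dotProduct, Finset.mul_sum, mul_assoc]

lemma realAction_apply (A : Matrix (Fin n) (Fin n) ℝ) (z : Fin n → ℂ) :
    realAction n A z = A.map Complex.ofReal *ᵥ z := rfl

lemma realAction_mul (A B : Matrix (Fin n) (Fin n) ℝ) (z : Fin n → ℂ) :
    realAction n (A * B) z = realAction n A (realAction n B z) := by
  have : (A * B).map Complex.ofReal = A.map Complex.ofReal * B.map Complex.ofReal :=
    Matrix.map_mul (f := Complex.ofRealHom)
  rw [realAction_apply, realAction_apply, realAction_apply, this, Matrix.mulVec_mulVec]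

lemma pseudoHerm_eq_dotProduct (z w : Fin n → ℂ) :
    pseudoHerm p z w = z ⬝ᵥ ((sgnMatrix p n).map Complex.ofReal *ᵥ star w) := by
  simp only [pseudoHerm, dotProduct, sgnMatrix, Matrix.diagonal_map (Complex.ofReal_zero),
    Matrix.mulVec_diagonal, Pi.star_apply, starRingEnd_apply]
  exact Finset.sum_congr rfl fun j _ => by ring

lemma pseudoHerm_realAction {A : Matrix (Fin n) (Fin n) ℝ} (hA : A ∈ indefiniteSO p n)
    (z w : Fin n → ℂ) : pseudoHerm p (realAction n A z) (realAction n A w) = pseudoHerm p z w := by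
  have h1 : (A.map Complex.ofReal)ᵀ * (sgnMatrix p n).map Complex.ofReal * A.map Complex.ofReal =
      (sgnMatrix p n).map Complex.ofReal := by
    have := congrArg (fun B : Matrix (Fin n) (Fin n) ℝ => B.map Complex.ofRealHom) hA.1
    simp only [Matrix.map_mul] at this
    exact this
  have h2 : star (A.map Complex.ofReal *ᵥ w) = A.map Complex.ofReal *ᵥ star w := by
    ext j
    simp [Matrix.mulVec, dotProduct]
  rw [pseudoHerm_eq_dotProduct, pseudoHerm_eq_dotProduct, realAction_apply, realAction_apply, h2]
  conv_rhs => rw [← h1, ← Matrix.mulVec_mulVec, ← Matrix.mulVec_mulVec, Matrix.dotProduct_mulVec,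
    Matrix.vecMul_transpose]

/-- The matrix of an infinitesimal rotation (or boost). -/
def generatorMatrix (p : ℕ) {n : ℕ} (i j : Fin n) : Matrix (Fin n) (Fin n) ℝ :=
  sgnCoeff p j • Matrix.single i j 1 - sgnCoeff p i • Matrix.single j i 1

lemma generatorMatrix_skew (i j : Fin n) :
    (generatorMatrix p i j)ᵀ * sgnMatrix p n = -(sgnMatrix p n * generatorMatrix p i j) := by
  ext a b
  simp only [generatorMatrix, sgnMatrix, Matrix.mul_diagonal, Matrix.neg_apply,
    Matrix.diagonal_mul, Matrix.transpose_apply, Matrix.sub_apply, Matrix.smul_apply,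
    Matrix.single_apply, smul_eq_mul]
  have h1 : (i = b ∧ j = a) ↔ (j = a ∧ i = b) := and_comm
  have h2 : (j = b ∧ i = a) ↔ (i = a ∧ j = b) := and_comm
  simp only [h1, h2]
  by_cases h3 : j = a ∧ i = b <;> by_cases h4 : i = a ∧ j = b
  · obtain ⟨rfl, rfl⟩ := h3
    obtain ⟨rfl, -⟩ := h4
    simp
  · obtain ⟨rfl, rfl⟩ := h3
    simp only [h4, if_false, and_self, if_true]
    ring
  · obtain ⟨rfl, rfl⟩ := h4
    simp only [h3, if_false, and_self, if_true]
    ring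
  · simp [h3, h4]

lemma realAction_generatorMatrix (i j : Fin n) (z : Fin n → ℂ) :
    realAction n (generatorMatrix p i j) z = generator p i j z := by
  ext k
  simp [realAction_apply, generatorMatrix, generator, Matrix.mulVec, dotProduct,
    Matrix.single_apply, Pi.single_apply]
  congr 1
  · rcases eq_or_ne i k with rfl | h
    · simp [apply_ite Complex.ofReal]
    · simp [h, h.symm]
  · rcases eq_or_ne j k with rfl | h
    · simp [apply_ite Complex.ofReal]
    · simp [h, h.symm]

open scoped Matrix.Norms.Operator in
lemma hasDerivAt_realAction_exp (X : Matrix (Fin n) (Fin n) ℝ) (t : ℝ) :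
    HasDerivAt (fun s : ℝ => realAction n (NormedSpace.exp (s • X)))
      (realAction n (NormedSpace.exp (t • X) * X)) t :=
  (LinearMap.toContinuousLinearMap (realAction n)).hasFDerivAt.comp_hasDerivAt t
    (hasDerivAt_exp_smul_const X t)

end Group

end MinimalLagrangian

namespace MinimalLagrangian

open Complex MeasureTheory Topology

/-! ### Maps into the image of an immersion, and infinitesimal invariance -/

section Invariance

variable {n p : ℕ}

/-- An injective linear map from a finite-dimensional space has a linear left inverse. -/
lemma exists_clm_left_inverse {E F : Type*} [NormedAddCommGroup E] [NormedSpace ℝ E]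
    [NormedAddCommGroup F] [NormedSpace ℝ F] [FiniteDimensional ℝ F] {L : E →L[ℝ] F}
    (hL : Function.Injective L) : ∃ π : F →L[ℝ] E, ∀ v, π (L v) = v := by
  obtain ⟨g, hg⟩ := L.toLinearMap.exists_leftInverse_of_injective (LinearMap.ker_eq_bot.2 hL)
  exact ⟨LinearMap.toContinuousLinearMap g, fun v => LinearMap.congr_fun hg v⟩

/-- An immersion has differentiable local left inverses. -/
lemma exists_local_left_inverse {E F : Type*} [NormedAddCommGroup E] [NormedSpace ℝ E]
    [CompleteSpace E] [NormedAddCommGroup F] [NormedSpace ℝ F] [FiniteDimensional ℝ F]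
    {u : E → F} {y₀ : E} (hu : ContDiffAt ℝ 1 u y₀) (hinj : Function.Injective (fderiv ℝ u y₀)) :
    ∃ S : F → E, ∀ᶠ y in 𝓝 y₀, S (u y) = y ∧ DifferentiableAt ℝ S (u y) := by
  obtain ⟨π, hπ⟩ := exists_clm_left_inverse hinj
  have hh : ContDiffAt ℝ 1 (fun y => π (u y)) y₀ := π.contDiff.contDiffAt.comp y₀ hu
  have hd : HasFDerivAt (fun y => π (u y))
      ((ContinuousLinearEquiv.refl ℝ E : E ≃L[ℝ] E) : E →L[ℝ] E) y₀ := by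
    refine (π.hasFDerivAt.comp y₀ (hu.differentiableAt (by simp)).hasFDerivAt).congr_fderiv ?_
    ext v
    exact hπ v
  set g := hh.localInverse hd one_ne_zero with hg
  have h1 : ∀ᶠ y in 𝓝 y₀, g (π (u y)) = y :=
    (hh.hasStrictFDerivAt' hd one_ne_zero).eventually_left_inverse
  have h2 : ∀ᶠ w in 𝓝 (π (u y₀)), DifferentiableAt ℝ g w := by
    have := (hh.to_localInverse hd one_ne_zero).eventually (by simp)
    filter_upwards [this] with w hw
    exact hw.differentiableAt (by simp)
  have h3 : ∀ᶠ y in 𝓝 y₀, DifferentiableAt ℝ g (π (u y)) := hh.continuousAt.eventually h2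
  refine ⟨fun w => g (π w), ?_⟩
  filter_upwards [h1, h3] with y hy1 hy2
  exact ⟨hy1, hy2.comp (u y) π.differentiableAt⟩

variable {M : Type*} [TopologicalSpace M] [SecondCountableTopology M]
  [ChartedSpace (EuclideanSpace ℝ (Fin n)) M] [IsManifold (𝓡 n) ∞ M] {f : M → (Fin n → ℂ)}

/-- A differentiable map with values in the image of an immersion is somewhere tangent to it. -/
lemma exists_derivative_mem_tangentImage (hf : IsSmoothImmersion f) {X : Type*}
    [NormedAddCommGroup X] [NormedSpace ℝ X] [CompleteSpace X] {N : Set X} (hN : IsOpen N)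
    (hne : N.Nonempty) {F : X → (Fin n → ℂ)} {F' : X → X →L[ℝ] (Fin n → ℂ)}
    (hF : ∀ x ∈ N, HasFDerivAt F (F' x) x) (hFr : ∀ x ∈ N, F x ∈ Set.range f) :
    ∃ x ∈ N, ∃ q, f q = F x ∧ ∀ a, F' x a ∈ tangentImage f q := by
  -- Around each point there is a compact piece on whose image one map `S`, differentiable at the
  -- points of that image, recovers the chart coordinates.
  have hloc : ∀ q : M, ∃ K : Set M, ∃ S : (Fin n → ℂ) → EuclideanSpace ℝ (Fin n),
      K ∈ 𝓝 q ∧ IsCompact K ∧ ∀ q' ∈ K, q' ∈ (chartAt (EuclideanSpace ℝ (Fin n)) q).source ∧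
        S (f q') = chartAt (EuclideanSpace ℝ (Fin n)) q q' ∧ DifferentiableAt ℝ S (f q') := by
    intro q
    set e := chartAt (EuclideanSpace ℝ (Fin n)) q with he
    have := ChartedSpace.locallyCompactSpace (EuclideanSpace ℝ (Fin n)) M
    have hq : e q ∈ e.target := mem_chart_target _ q
    obtain ⟨S, hS⟩ := exists_local_left_inverse (y₀ := e q)
      (((contDiffOn_inChart hf q).contDiffAt (e.open_target.mem_nhds hq)).of_le (by simp))
      (injective_fderiv_inChart hf q hq)
    have h1 := (e.continuousAt (mem_chart_source _ q)).eventually hS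
    have h2 := e.open_source.mem_nhds (mem_chart_source (EuclideanSpace ℝ (Fin n)) q)
    obtain ⟨K, hK, hKs, hKc⟩ := local_compact_nhds (Filter.inter_mem h1 h2)
    refine ⟨K, S, hK, hKc, fun q' hq' => ?_⟩
    obtain ⟨h3, h4⟩ := hKs hq'
    have h5 : inChart f q (e q') = f q' := by simp [inChart, ← he, e.left_inv h4]
    have h6 : S (inChart f q (e q')) = e q' ∧ DifferentiableAt ℝ S (inChart f q (e q')) := h3
    rw [h5] at h6
    exact ⟨h4, h6⟩
  choose K S hK hKc hKS using hloc
  obtain ⟨s, hs, hcov⟩ := TopologicalSpace.countable_cover_nhds hK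
  have : Countable s := hs
  have : BaireSpace N := hN.baireSpace
  have : Nonempty N := hne.to_subtype
  have hFc : Continuous (fun x : N => F x) := by
    rw [continuous_iff_continuousAt]
    exact fun x => (hF x x.2).continuousAt.comp continuous_subtype_val.continuousAt
  have hfc : Continuous f := hf.1.continuous
  -- Countably many of the compact images `f(K q)` cover the image of `f`, so by Baire one of their
  -- closed preimages under `F` has an interior point. Near it `F` factors through a single sheet of
  -- the immersion.
  obtain ⟨⟨q, hq⟩, hint⟩ := nonempty_interior_of_iUnion_of_closed (X := N) (ι := s)
    (f := fun q => (fun x : N => F x) ⁻¹' (f '' K q))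
    (fun q => ((hKc q).image hfc).isClosed.preimage hFc) (by
      refine Set.eq_univ_of_forall fun x => ?_
      obtain ⟨q', hq'⟩ := hFr x x.2
      have : q' ∈ ⋃ q ∈ s, K q := hcov ▸ Set.mem_univ q'
      simp only [Set.mem_iUnion] at this ⊢
      obtain ⟨q, hqs, hqK⟩ := this
      exact ⟨⟨q, hqs⟩, q', hqK, hq'⟩)
  obtain ⟨x, hx⟩ := hint
  rw [mem_interior_iff_mem_nhds, mem_nhds_subtype_iff_nhdsWithin, hN.nhdsWithin_eq x.2] at hx
  have hev : ∀ᶠ x' in 𝓝 (x : X), ∃ q' ∈ K q, f q' = F x' := by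
    filter_upwards [hx] with x' hx'
    obtain ⟨x'', ⟨q', hq', h⟩, rfl⟩ := hx'
    exact ⟨q', hq', h⟩
  refine ⟨x, x.2, ?_⟩
  obtain ⟨q', hq', hfq'⟩ := hev.self_of_nhds
  refine ⟨q', hfq', fun a => ?_⟩
  obtain ⟨h1, h2, h3⟩ := hKS q q' hq'
  set e := chartAt (EuclideanSpace ℝ (Fin n)) q with he
  have htgt : e q' ∈ e.target := e.map_source h1
  have hS : HasFDerivAt (fun x' => S q (F x'))
      ((fderiv ℝ (S q) (f q')).comp (F' x)) x := by
    have h4 := h3.hasFDerivAt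
    rw [hfq'] at h4 ⊢
    exact h4.comp (x : X) (hF x x.2)
  have hcomp : HasFDerivAt (fun x' => inChart f q (S q (F x')))
      ((fderiv ℝ (inChart f q) (e q')).comp ((fderiv ℝ (S q) (f q')).comp (F' x))) x := by
    have h5 : S q (F x) = e q' := by rw [← hfq', h2]
    have h6 := hasFDerivAt_inChart hf q htgt
    rw [← h5] at h6 ⊢
    exact h6.comp (x : X) hS
  -- On this sheet `f` in the chart, composed with `S`, is the identity. The chain rule therefore
  -- puts the image of `F'` in the tangent space.
  have hEq : (fun x' => inChart f q (S q (F x'))) =ᶠ[𝓝 (x : X)] F := by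
    filter_upwards [hev] with x' hx'
    obtain ⟨q'', hq'', h⟩ := hx'
    obtain ⟨h1', h2', -⟩ := hKS q q'' hq''
    rw [← h, h2', inChart, e.left_inv h1']
  have huniq := (hcomp.congr_of_eventuallyEq hEq.symm).unique (hF x x.2)
  have h7 := (range_fderiv_inChart hf q htgt (F' x a)).2
    ⟨fderiv ℝ (S q) (f q') (F' x a), DFunLike.congr_fun huniq a⟩
  rwa [e.left_inv h1] at h7

/-- A submanifold whose image is invariant is infinitesimally invariant. -/
lemma pseudoOmega_generator_eq_zero (hf : IsSmoothImmersion f) (hLag : IsLagrangianImmersion p f)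
    (hinv : IsSOInvariant p (Set.range f)) (i j : Fin n) (q : M) {v : Fin n → ℂ}
    (hv : v ∈ tangentImage f q) : pseudoOmega p (generator p i j (f q)) v = 0 := by
  set e := chartAt (EuclideanSpace ℝ (Fin n)) q with he
  set u := inChart f q with hu
  have hus := contDiffOn_inChart hf q
  set X := generatorMatrix p i j with hX
  have hiso : ∀ x, ∀ v ∈ tangentImage f x, ∀ w ∈ tangentImage f x, pseudoOmega p v w = 0 := by
    rintro x _ ⟨v, rfl⟩ _ ⟨w, rfl⟩
    exact hLag x v w
  set A : ℝ → Matrix (Fin n) (Fin n) ℝ := fun t => NormedSpace.exp (t • X) with hA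
  have hASO : ∀ t, A t ∈ indefiniteSO p n := exp_mem_indefiniteSO (generatorMatrix_skew i j)
  -- the set of parameters where the claim holds is dense
  have hdense : ∀ N ⊆ e.target, IsOpen N → N.Nonempty → ∃ y ∈ N, ∀ η,
      pseudoOmega p (generator p i j (u y)) (fderiv ℝ u y η) = 0 := by
    intro N hNe hN hNne
    have hF : ∀ x ∈ (Set.univ ×ˢ N : Set (ℝ × EuclideanSpace ℝ (Fin n))),
        HasFDerivAt (fun x : ℝ × EuclideanSpace ℝ (Fin n) => realAction n (A x.1) (u x.2))
        ((realAction n (A x.1)).comp ((fderiv ℝ u x.2).comp (ContinuousLinearMap.snd ℝ _ _)) +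
          (ContinuousLinearMap.fst ℝ ℝ (EuclideanSpace ℝ (Fin n))).smulRight
            (realAction n (A x.1 * X) (u x.2))) x := by
      rintro ⟨t, y⟩ ⟨-, hy⟩
      have h1 : HasFDerivAt (fun x : ℝ × EuclideanSpace ℝ (Fin n) => realAction n (A x.1))
          ((ContinuousLinearMap.fst ℝ ℝ (EuclideanSpace ℝ (Fin n))).smulRight (realAction n (A t * X))) (t, y) :=
        (HasFDerivAt.comp (g := fun s => realAction n (A s)) (f := Prod.fst) (t, y)
          (hasDerivAt_realAction_exp X t).hasFDerivAt hasFDerivAt_fst).congr_fderiv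
          (by ext <;> simp [hA])
      have h2 : HasFDerivAt (fun x : ℝ × EuclideanSpace ℝ (Fin n) => u x.2)
          ((fderiv ℝ u y).comp (ContinuousLinearMap.snd ℝ _ _)) (t, y) :=
        (hasFDerivAt_inChart hf q (hNe hy)).comp (t, y) hasFDerivAt_snd
      exact (h1.clm_apply h2).congr_fderiv (by ext <;> simp)
    obtain ⟨⟨t, y⟩, ⟨-, hy⟩, q', -, htan⟩ := exists_derivative_mem_tangentImage hf
      (isOpen_univ.prod hN) (Set.univ_nonempty.prod hNne) hF (by
        rintro ⟨t, y⟩ -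
        exact hinv (A t) (hASO t) _ ⟨_, rfl⟩)
    refine ⟨y, hy, fun η => ?_⟩
    -- The time direction gives `A(t) X u` and the space direction `A(t) du(η)`. Both lie in the
    -- same isotropic tangent space, and `A(t)` preserves `ω`.
    have h := hiso q' _ (htan (1, 0)) _ (htan (0, η))
    simp at h
    rw [realAction_mul, pseudoOmega, pseudoHerm_realAction (hASO t),
      realAction_generatorMatrix] at h
    exact h
  obtain ⟨η, rfl⟩ := (tangentImage_chartAt hf q v).1 hv
  have hq : e q ∈ e.target := mem_chart_target _ q
  have huq : u (e q) = f q := apply_chartAt f q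
  have hcont : ContinuousOn (fun y => pseudoOmega p (generator p i j (u y)) (fderiv ℝ u y η))
      e.target := by
    have h1 : ContinuousOn u e.target := hus.continuousOn
    have h2 : ContinuousOn (fun y => fderiv ℝ u y η) e.target :=
      (hus.continuousOn_fderiv_of_isOpen e.open_target (by simp)).clm_apply continuousOn_const
    have h3 : ContinuousOn (fun y => I • generator p i j (u y)) e.target := by
      have h4 := continuousOn_pi.1 h1
      exact (((continuousOn_const.mul (h4 j)).smul continuousOn_const).sub
        ((continuousOn_const.mul (h4 i)).smul continuousOn_const)).const_smul I
    refine (continuousOn_pseudoMetric (p := p) h3 h2).congr fun y _ => ?_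
    exact (pseudoMetric_I_smul_left _ _).symm
  by_contra hne
  have hev : ∀ᶠ y in 𝓝 (e q), y ∈ e.target ∧
      pseudoOmega p (generator p i j (u y)) (fderiv ℝ u y η) ≠ 0 := by
    have h1 := ((hcont _ hq).continuousAt (e.open_target.mem_nhds hq)).eventually_ne
      (by rw [huq]; exact hne)
    exact (show ∀ᶠ y in 𝓝 (e q), y ∈ e.target from e.open_target.mem_nhds hq).and h1
  obtain ⟨N, hN, hNo, hqN⟩ := eventually_nhds_iff.1 hev
  obtain ⟨y, hy, hy0⟩ := hdense N (fun y hy => (hN y hy).1) hNo ⟨_, hqN⟩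
  exact (hN y hy).2 (hy0 η)

end Invariance

end MinimalLagrangian

namespace MinimalLagrangian

open Complex MeasureTheory Topology

/-! ### Immersed submanifolds of the models are open -/

section Openness

variable {n p : ℕ}

/-- A map with injective strict derivative is locally injective. -/
lemma exists_nhds_injOn {E F : Type*} [NormedAddCommGroup E] [NormedSpace ℝ E] [CompleteSpace E]
    [NormedAddCommGroup F] [NormedSpace ℝ F] [FiniteDimensional ℝ F] {Ψ : E → F} {Ψ' : E →L[ℝ] F}
    {z : E} (h : HasStrictFDerivAt Ψ Ψ' z) (hinj : Function.Injective Ψ') :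
    ∃ O ∈ 𝓝 z, Set.InjOn Ψ O := by
  obtain ⟨π, hπ⟩ := exists_clm_left_inverse hinj
  have h1 : HasStrictFDerivAt (fun w => π (Ψ w))
      ((ContinuousLinearEquiv.refl ℝ E : E ≃L[ℝ] E) : E →L[ℝ] E) z := by
    refine (π.hasStrictFDerivAt.comp z h).congr_fderiv ?_
    ext v
    exact hπ v
  refine ⟨_, h1.eventually_left_inverse, fun a ha b hb hab => ?_⟩
  have ha' : h1.localInverse _ _ _ (π (Ψ a)) = a := ha
  have hb' : h1.localInverse _ _ _ (π (Ψ b)) = b := hb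
  rw [← ha', hab, hb']

variable {M : Type*} [TopologicalSpace M]
  [ChartedSpace (EuclideanSpace ℝ (Fin n)) M] [IsManifold (𝓡 n) ∞ M] {f : M → (Fin n → ℂ)}

/-- The image of an immersion is open in a level set whose dimension is not larger. -/
lemma exists_isOpen_range_eq_inter {G : Type*} [NormedAddCommGroup G] [NormedSpace ℝ G]
    [FiniteDimensional ℝ G] (hf : IsSmoothImmersion f) {S : Set (Fin n → ℂ)}
    (hS : Set.range f ⊆ S)
    (hΦ : ∀ x, ∃ (Φ : (Fin n → ℂ) → G) (Φ' : (Fin n → ℂ) →L[ℝ] G),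
      HasStrictFDerivAt Φ Φ' (f x) ∧ (∀ z ∈ S, Φ z = Φ (f x)) ∧
        Module.finrank ℝ (LinearMap.ker Φ'.toLinearMap) ≤ n) :
    ∃ U : Set (Fin n → ℂ), IsOpen U ∧ Set.range f = S ∩ U := by
  have key : ∀ x, ∀ᶠ z in 𝓝 (f x), z ∈ S → z ∈ Set.range f := by
    intro x
    obtain ⟨Φ, Φ', hd, hconst, hker⟩ := hΦ x
    set e := chartAt (EuclideanSpace ℝ (Fin n)) x with he
    set u := inChart f x with hu
    have hx : e x ∈ e.target := mem_chart_target _ x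
    have hux : u (e x) = f x := apply_chartAt f x
    have hD := hasFDerivAt_inChart hf x hx
    have hDinj := injective_fderiv_inChart hf x hx
    set D := fderiv ℝ u (e x) with hDdef
    obtain ⟨π, hπ⟩ := exists_clm_left_inverse hDinj
    have hΦD : ∀ η, Φ' (D η) = 0 := by
      have h1 : HasFDerivAt (fun y => Φ (u y)) (Φ'.comp D) (e x) := by
        have := hd.hasFDerivAt
        rw [← hux] at this
        exact this.comp (e x) hD
      have h2 : (fun y => Φ (u y)) = fun _ => Φ (f x) :=
        funext fun y => hconst _ (hS ⟨_, rfl⟩)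
      rw [h2] at h1
      have h3 := h1.unique (hasFDerivAt_const _ _)
      exact fun η => DFunLike.congr_fun h3 η
    -- The bound on the kernel forces equality. Hence `(Φ, π)` has injective derivative, and a point
    -- of `S` near `f x` is determined by its value under `π`, while `π ∘ u` already covers a
    -- neighbourhood of `π (f x)`.
    have hrange : LinearMap.range D.toLinearMap = LinearMap.ker Φ'.toLinearMap := by
      refine Submodule.eq_of_le_of_finrank_le ?_ ?_
      · rintro _ ⟨η, rfl⟩
        exact hΦD η
      · rw [LinearMap.finrank_range_of_inj hDinj, finrank_euclideanSpace_fin]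
        exact hker
    obtain ⟨O, hO, hinj⟩ := exists_nhds_injOn (hd.prodMk π.hasStrictFDerivAt) (by
      rw [← ContinuousLinearMap.coe_coe, ← LinearMap.ker_eq_bot, LinearMap.ker_eq_bot']
      intro v hv
      have hv1 : Φ' v = 0 := congrArg Prod.fst hv
      have hv2 : π v = 0 := congrArg Prod.snd hv
      have : v ∈ LinearMap.range D.toLinearMap := by rw [hrange]; exact hv1
      obtain ⟨η, rfl⟩ := this
      have h4 : π (D η) = 0 := hv2
      rw [hπ] at h4
      rw [h4, map_zero])
    have hcd : ContDiffAt ℝ 1 u (e x) :=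
      ((contDiffOn_inChart hf x).contDiffAt (e.open_target.mem_nhds hx)).of_le (by simp)
    have hstrict : HasStrictFDerivAt (fun y => π (u y))
        ((ContinuousLinearEquiv.refl ℝ (EuclideanSpace ℝ (Fin n)) :
          EuclideanSpace ℝ (Fin n) ≃L[ℝ] EuclideanSpace ℝ (Fin n)) :
          EuclideanSpace ℝ (Fin n) →L[ℝ] EuclideanSpace ℝ (Fin n)) (e x) := by
      refine (π.hasStrictFDerivAt.comp (e x) (hcd.hasStrictFDerivAt (by simp))).congr_fderiv ?_
      ext1 v
      exact hπ v
    have hB : {y | u y ∈ O} ∈ 𝓝 (e x) := hcd.continuousAt (by rw [hux]; exact hO)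
    have himg := Filter.image_mem_map (m := fun y => π (u y)) hB
    rw [hstrict.map_nhds_eq_of_equiv, hux] at himg
    filter_upwards [hO, π.continuous.continuousAt himg] with z hz hzπ hzS
    obtain ⟨y, hy, hyz⟩ := hzπ
    have hyS : u y ∈ S := hS ⟨_, rfl⟩
    have : u y = z := hinj hy hz (Prod.ext ((hconst _ hyS).trans (hconst _ hzS).symm) hyz)
    exact ⟨_, this⟩
  refine ⟨interior {z | z ∈ S → z ∈ Set.range f}, isOpen_interior, ?_⟩
  ext z
  constructor
  · rintro ⟨x, rfl⟩
    exact ⟨hS ⟨x, rfl⟩, mem_interior_iff_mem_nhds.2 (key x)⟩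
  · rintro ⟨h1, h2⟩
    exact interior_subset h2 h1

lemma fderiv_apply_eq_of_hasDerivAt {E F : Type*} [NormedAddCommGroup E] [NormedSpace ℝ E]
    [NormedAddCommGroup F] [NormedSpace ℝ F] {Φ : E → F} {z v : E} {d : F}
    (hΦ : DifferentiableAt ℝ Φ z) (h : HasDerivAt (fun t : ℝ => Φ (z + t • v)) d 0) :
    fderiv ℝ Φ z v = d :=
  (hΦ.hasFDerivAt.hasLineDerivAt v).unique h

lemma contDiff_pseudoBilin_self : ContDiff ℝ 1 fun z : Fin n → ℂ => pseudoBilin p z z :=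
  ContDiff.sum fun j _ => contDiff_const.mul ((contDiff_apply ℝ ℂ j).mul (contDiff_apply ℝ ℂ j))

lemma hasDerivAt_pseudoBilin (z v : Fin n → ℂ) :
    HasDerivAt (fun t : ℝ => pseudoBilin p (z + t • v) (z + t • v)) (2 * pseudoBilin p z v) 0 := by
  have h2 : ∀ t : ℝ, pseudoBilin p (z + t • v) (z + t • v) =
      pseudoBilin p z z + (t : ℂ) * (2 * pseudoBilin p z v) + (t : ℂ) ^ 2 * pseudoBilin p v v := by
    intro t
    simp only [pseudoBilin, Finset.mul_sum, ← Finset.sum_add_distrib, Pi.add_apply, Pi.smul_apply,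
      real_smul]
    exact Finset.sum_congr rfl fun j _ => by ring
  simp only [h2]
  have hid : HasDerivAt (fun t : ℝ => (t : ℂ)) 1 0 := ofRealCLM.hasDerivAt
  refine (((hid.mul_const (2 * pseudoBilin p z v)).const_add (pseudoBilin p z z)).fun_add
    ((hid.fun_pow 2).mul_const (pseudoBilin p v v))).congr_deriv ?_
  norm_num

lemma fderiv_pseudoBilin_self (z v : Fin n → ℂ) :
    fderiv ℝ (fun z => pseudoBilin p z z) z v = 2 * pseudoBilin p z v :=
  fderiv_apply_eq_of_hasDerivAt (contDiff_pseudoBilin_self.differentiable (by simp) z)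
    (hasDerivAt_pseudoBilin z v)

lemma contDiff_firstIntegral : ContDiff ℝ 1 (firstIntegral p (n := n)) := by
  have hre : ∀ {g : (Fin n → ℂ) → ℂ}, ContDiff ℝ 1 g → ContDiff ℝ 1 fun z => (g z).re :=
    fun hg => reCLM.contDiff.comp hg
  have hcoord : ∀ j : Fin n, ContDiff ℝ 1 fun z : Fin n → ℂ => z j := fun j => contDiff_apply ℝ ℂ j
  have hconj : ∀ j : Fin n, ContDiff ℝ 1 fun z : Fin n → ℂ => (starRingEnd ℂ) (z j) :=
    fun j => conjCLE.contDiff.comp (hcoord j)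
  refine ContDiff.sub ((hre ?_).pow n) (hre (ContDiff.pow ?_ n))
  · exact ContDiff.sum fun j _ => contDiff_const.mul ((hcoord j).mul (hconj j))
  · exact contDiff_pseudoBilin_self

lemma fderiv_firstIntegral (z v : Fin n → ℂ) : fderiv ℝ (firstIntegral p) z v =
    2 * n * (pseudoMetric p z z ^ (n - 1) * pseudoMetric p v z -
      (pseudoBilin p z z ^ (n - 1) * pseudoBilin p z v).re) := by
  refine fderiv_apply_eq_of_hasDerivAt (contDiff_firstIntegral.differentiable (by simp) z) ?_
  have h1 : ∀ t : ℝ, pseudoMetric p (z + t • v) (z + t • v) =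
      pseudoMetric p z z + t * (2 * pseudoMetric p v z) + t ^ 2 * pseudoMetric p v v := by
    intro t
    rw [pseudoMetric_add_left, pseudoMetric_add_right, pseudoMetric_add_right,
      pseudoMetric_smul_left, pseudoMetric_smul_left, pseudoMetric_smul_right,
      pseudoMetric_smul_right, pseudoMetric_symm z v]
    ring
  have hA : HasDerivAt (fun t : ℝ => pseudoMetric p (z + t • v) (z + t • v))
      (2 * pseudoMetric p v z) 0 := by
    simp only [h1]
    refine ((((hasDerivAt_id' (0 : ℝ)).mul_const (2 * pseudoMetric p v z)).const_add
      (pseudoMetric p z z)).fun_add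
        (((hasDerivAt_id' (0 : ℝ)).fun_pow 2).mul_const (pseudoMetric p v v))).congr_deriv ?_
    norm_num
  have hB := hasDerivAt_pseudoBilin (p := p) z v
  have hre := reCLM.hasFDerivAt.comp_hasDerivAt (0 : ℝ) (hB.fun_pow n)
  have h := (hA.fun_pow n).fun_sub hre
  simp only [zero_smul, add_zero] at h
  refine h.congr_deriv ?_
  have : (n : ℂ) * pseudoBilin p z z ^ (n - 1) * (2 * pseudoBilin p z v) =
      ((2 * n : ℝ) : ℂ) * (pseudoBilin p z z ^ (n - 1) * pseudoBilin p z v) := by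
    push_cast; ring
  rw [reCLM_apply, this, re_ofReal_mul]
  ring

/-- The bilinear map whose vanishing says that two coordinates have the same phase. -/
def phaseDefect {n : ℕ} (j : Fin n) (z : Fin n → ℂ) : Fin n → ℝ :=
  fun k => (z k * (starRingEnd ℂ) (z j)).im

lemma contDiff_phaseDefect (j : Fin n) : ContDiff ℝ 1 (phaseDefect j) := by
  have hcoord : ∀ j : Fin n, ContDiff ℝ 1 fun z : Fin n → ℂ => z j := fun j => contDiff_apply ℝ ℂ j
  have hconj : ∀ j : Fin n, ContDiff ℝ 1 fun z : Fin n → ℂ => (starRingEnd ℂ) (z j) :=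
    fun j => conjCLE.contDiff.comp (hcoord j)
  exact contDiff_pi.2 fun k => imCLM.contDiff.comp ((hcoord k).mul (hconj j))

lemma fderiv_phaseDefect (j : Fin n) (z v : Fin n → ℂ) (k : Fin n) :
    fderiv ℝ (phaseDefect j) z v k =
      (z k * (starRingEnd ℂ) (v j)).im + (v k * (starRingEnd ℂ) (z j)).im := by
  have h := fderiv_apply_eq_of_hasDerivAt (v := v)
    (d := fun k => (z k * (starRingEnd ℂ) (v j)).im + (v k * (starRingEnd ℂ) (z j)).im)
    ((contDiff_phaseDefect j).differentiable (by simp) z) (by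
      refine hasDerivAt_pi.2 fun k => ?_
      have h1 : ∀ t : ℝ, phaseDefect j (z + t • v) k = (z k * (starRingEnd ℂ) (z j)).im +
          t * ((z k * (starRingEnd ℂ) (v j)).im + (v k * (starRingEnd ℂ) (z j)).im) +
          t ^ 2 * (v k * (starRingEnd ℂ) (v j)).im := by
        intro t
        simp [phaseDefect]
        ring
      simp only [h1]
      refine ((((hasDerivAt_id' (0 : ℝ)).mul_const _).const_add _).fun_add
        (((hasDerivAt_id' (0 : ℝ)).fun_pow 2).mul_const _)).congr_deriv ?_
      norm_num)
  rw [h]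

/-- The equations of the Lagrangian catenoid have the maximal rank. -/
lemma finrank_ker_le {γ : ℂ} {x : Fin n → ℝ} {ε c : ℝ} {j : Fin n} (hxj : x j ≠ 0) (hε : ε ≠ 0)
    (hc : c ≠ 0) (hx : ∑ j, sgnCoeff p j * x j ^ 2 = ε) (hγ : (γ ^ n).im = c) :
    Module.finrank ℝ (LinearMap.ker ((fderiv ℝ (phaseDefect j) (γ • realVec x)).prod
      (fderiv ℝ (firstIntegral p) (γ • realVec x))).toLinearMap) ≤ n := by
  have hn : n ≠ 0 := by rintro rfl; exact j.elim0
  have hγ0 : γ ≠ 0 := by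
    rintro rfl; rw [zero_pow hn] at hγ; exact hc (by simpa using hγ.symm)
  set P := (γ ^ n).re with hP
  -- On a kernel vector `γ w` the first equation gives `Im w = b x`, and the second reads `c Re β +
  -- P Im β = 0` with `β = B(x, w)`. If moreover `Re w = -r Im w`, this becomes `(P - c r) b ε = 0`.
  -- The value of `r` makes `P - c r = -1`, so `b = 0` and `Λ` is injective on the kernel.
  set r := (P + 1) / c with hr
  let Λ : (Fin n → ℂ) →ₗ[ℝ] (Fin n → ℝ) :=
    { toFun := fun v k => (v k / γ).re + r * (v k / γ).im
      map_add' := fun v w => by ext k; simp [add_div]; ring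
      map_smul' := fun s v => by ext k; simp [mul_div_assoc]; ring }
  have hinj : Function.Injective (Λ.domRestrict (LinearMap.ker
      ((fderiv ℝ (phaseDefect j) (γ • realVec x)).prod
        (fderiv ℝ (firstIntegral p) (γ • realVec x))).toLinearMap)) := by
    rw [← LinearMap.ker_eq_bot, LinearMap.ker_eq_bot']
    rintro ⟨v, hv⟩ hΛ
    have hv1 : fderiv ℝ (phaseDefect j) (γ • realVec x) v = 0 := congrArg Prod.fst hv
    have hv2 : fderiv ℝ (firstIntegral p) (γ • realVec x) v = 0 := congrArg Prod.snd hv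
    have hΛ' : ∀ k, (v k / γ).re + r * (v k / γ).im = 0 := fun k => congrFun hΛ k
    obtain ⟨w, rfl⟩ : ∃ w : Fin n → ℂ, v = γ • w :=
      ⟨fun k => v k / γ, by ext k; simp [mul_div_cancel₀ _ hγ0]⟩
    simp only [Pi.smul_apply, smul_eq_mul, mul_div_cancel_left₀ _ hγ0] at hΛ'
    set b := (w j).im / x j with hb
    have hwim : ∀ k, (w k).im = b * x k := by
      intro k
      have h1 := congrFun hv1 k
      rw [fderiv_phaseDefect] at h1
      have h2 : normSq γ * (x j * (w k).im - x k * (w j).im) = 0 := by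
        simp only [Pi.smul_apply, realVec, smul_eq_mul, mul_im, mul_re, map_mul, conj_re, conj_im,
          ofReal_re, ofReal_im, Pi.zero_apply] at h1
        rw [normSq_apply]
        linarith
      have h3 : x j * (w k).im - x k * (w j).im = 0 := by
        simpa [hγ0] using h2
      rw [hb]
      field_simp
      linarith
    have hwre : ∀ k, (w k).re = -(r * b) * x k := fun k => by
      have := hΛ' k; rw [hwim] at this; linarith
    have hw : w = ((-(r * b) : ℝ) + b * I : ℂ) • realVec x := by
      ext k
      refine Complex.ext ?_ ?_
      · simp [realVec, hwre k]
      · simp [realVec, hwim k]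
    have hb0 : b = 0 := by
      rw [fderiv_firstIntegral] at hv2
      have h2n : (2 * n : ℝ) ≠ 0 := by positivity
      have h4 := (mul_eq_zero.1 hv2).resolve_left h2n
      rw [hw, pseudoMetric_smul_realVec_self, pseudoMetric, pseudoHerm_smul_realVec,
        pseudoBilin_smul_realVec_self] at h4
      simp only [pseudoBilin_smul_right, pseudoBilin_smul_left, pseudoBilin_realVec, ← sq, hx] at h4
      obtain ⟨m, rfl⟩ : ∃ m, n = m + 1 := ⟨n - 1, by omega⟩
      simp only [Nat.add_sub_cancel] at h4
      set μ : ℂ := ((-(r * b) : ℝ) + b * I : ℂ) with hμ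
      have e1 : (normSq γ * ε) ^ m * ((starRingEnd ℂ) γ * (γ * (μ * (ε : ℂ)))).re =
          ε ^ (m + 1) * (normSq (γ ^ (m + 1)) * μ.re) := by
        have : (starRingEnd ℂ) γ * (γ * (μ * (ε : ℂ))) = ((normSq γ * ε : ℝ) : ℂ) * μ := by
          rw [ofReal_mul, ← mul_conj]; ring
        rw [this, re_ofReal_mul, map_pow]
        ring
      have e2 : ((γ ^ 2 * (ε : ℂ)) ^ m * (γ * (μ * (γ * (ε : ℂ))))).re =
          ε ^ (m + 1) * (γ ^ (m + 1) * γ ^ (m + 1) * μ).re := by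
        have : (γ ^ 2 * (ε : ℂ)) ^ m * (γ * (μ * (γ * (ε : ℂ)))) =
            ((ε ^ (m + 1) : ℝ) : ℂ) * (γ ^ (m + 1) * γ ^ (m + 1) * μ) := by
          push_cast; ring
        rw [this, re_ofReal_mul]
      have hμre : μ.re = -(r * b) := by simp [hμ]
      have hμim : μ.im = b := by simp [hμ]
      have hcr : c * r = P + 1 := by rw [hr]; field_simp
      have e3 : ε ^ (m + 1) * (-2 * c * b) = 0 := by
        rw [← h4, e1, e2, normSq_apply, mul_re, mul_re, mul_im, hγ, hμre, hμim, ← hP]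
        linear_combination (2 * ε ^ (m + 1) * c * b) * hcr
      simpa [hε, hc] using e3
    rw [hb0] at hw
    ext k
    simp [hw]
  simpa using LinearMap.finrank_le_finrank_of_injective hinj

/-- An immersed `n`-manifold in a Lagrangian catenoid is open. -/
lemma exists_isOpen_of_subset_catenoid (hf : IsSmoothImmersion f) {ε c : ℝ}
    (hε : ε ≠ 0) (hc : c ≠ 0) (hS : Set.range f ⊆ lagrangianCatenoid p n ε c) :
    ∃ U : Set (Fin n → ℂ), IsOpen U ∧ Set.range f = lagrangianCatenoid p n ε c ∩ U := by
  refine exists_isOpen_range_eq_inter (G := (Fin n → ℝ) × ℝ) hf hS fun q => ?_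
  obtain ⟨γ, x, hx, hγ, hq⟩ := hS ⟨q, rfl⟩
  have hq' : f q = γ • realVec x := hq
  have hx' : ∑ j, sgnCoeff p j * x j ^ 2 = ε := hx
  obtain ⟨j, hj⟩ : ∃ j, x j ≠ 0 := by
    by_contra! h0
    apply hε
    rw [← hx']
    simp [h0]
  refine ⟨fun z => (phaseDefect j z, firstIntegral p z), _,
    ((contDiff_phaseDefect j).contDiffAt.hasStrictFDerivAt (by simp)).prodMk
      (contDiff_firstIntegral.contDiffAt.hasStrictFDerivAt (by simp)), ?_, ?_⟩
  · have hval : ∀ z ∈ lagrangianCatenoid p n ε c,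
        (phaseDefect j z, firstIntegral p z) = ((0 : Fin n → ℝ), 2 * ε ^ n * c ^ 2) := by
      rintro z ⟨γ', x', h1, h2, h3⟩
      have h3' : z = γ' • realVec x' := h3
      have h1' : ∑ j, sgnCoeff p j * x' j ^ 2 = ε := h1
      refine Prod.ext ?_ ?_
      · funext k
        simp [phaseDefect, h3]
        ring
      · change firstIntegral p z = _
        rw [h3', firstIntegral_smul_realVec, h1', h2]
    intro z hz
    exact (hval z hz).trans (hval _ (hS ⟨q, rfl⟩)).symm
  · rw [hq']
    exact finrank_ker_le hj hε hc hx' hγ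

end Openness

end MinimalLagrangian

namespace MinimalLagrangian

open Complex MeasureTheory Topology

/-! ### Congruence with a model -/

section Congruence

variable {n p : ℕ}

/-- The set `R` is congruent to an open subset of an affine Lagrangian plane or of a Lagrangian
catenoid. -/
def IsCongruentToModel (p : ℕ) {n : ℕ} (R : Set (Fin n → ℂ)) : Prop :=
  ∃ (A : (Fin n → ℂ) ≃ₗ[ℝ] (Fin n → ℂ)) (b : Fin n → ℂ) (S U : Set (Fin n → ℂ)),
    (∀ z w, pseudoMetric p (A z) (A w) = pseudoMetric p z w) ∧
    (n ≠ 2 → ∀ z w, pseudoHerm p (A z) (A w) = pseudoHerm p z w) ∧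
    ((∃ P : AffineSubspace ℝ (Fin n → ℂ), IsAffineLagrangianPlane p P ∧ S = P) ∨
      ∃ ε c : ℝ, (ε = 1 ∨ ε = -1) ∧ c ≠ 0 ∧ S = lagrangianCatenoid p n ε c) ∧
    IsOpen U ∧ R = (fun z => A z + b) '' (S ∩ U)

lemma IsCongruentToModel.image {R : Set (Fin n → ℂ)} (hR : IsCongruentToModel p R)
    (B : (Fin n → ℂ) ≃ₗ[ℝ] (Fin n → ℂ))
    (hB : ∀ z w, pseudoMetric p (B z) (B w) = pseudoMetric p z w)
    (hB' : n ≠ 2 → ∀ z w, pseudoHerm p (B z) (B w) = pseudoHerm p z w) :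
    IsCongruentToModel p (B '' R) := by
  obtain ⟨A, b, S, U, h1, h2, h3, hU, rfl⟩ := hR
  refine ⟨A.trans B, B b, S, U, fun z w => ?_, fun hn z w => ?_, h3, hU, ?_⟩
  · simp [hB, h1]
  · simp [hB' hn, h2 hn]
  · rw [Set.image_image]
    simp

/-- Multiplication by a nonzero complex number. -/
def mulEquiv (n : ℕ) (κ : ℂ) (hκ : κ ≠ 0) : (Fin n → ℂ) ≃ₗ[ℝ] (Fin n → ℂ) :=
  (LinearEquiv.smulOfNeZero ℂ (Fin n → ℂ) κ hκ).restrictScalars ℝ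

lemma pseudoHerm_smul_smul {κ : ℂ} (hκ : ‖κ‖ = 1) (z w : Fin n → ℂ) :
    pseudoHerm p (κ • z) (κ • w) = pseudoHerm p z w := by
  rw [pseudoHerm_smul_left, pseudoHerm_smul_right, ← mul_assoc, mul_conj, normSq_eq_norm_sq, hκ]
  simp

lemma IsCongruentToModel.smul {R : Set (Fin n → ℂ)} (hR : IsCongruentToModel p R) {κ : ℂ}
    (hκ : ‖κ‖ = 1) : IsCongruentToModel p ((fun z => κ • z) '' R) := by
  have hκ0 : κ ≠ 0 := by rintro rfl; simp at hκ
  exact hR.image (mulEquiv n κ hκ0)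
    (fun z w => congrArg re (pseudoHerm_smul_smul hκ z w))
    (fun _ z w => pseudoHerm_smul_smul hκ z w)

lemma isCongruentToModel_of_subset {R S : Set (Fin n → ℂ)}
    (hS : (∃ P : AffineSubspace ℝ (Fin n → ℂ), IsAffineLagrangianPlane p P ∧ S = P) ∨
      ∃ ε c : ℝ, (ε = 1 ∨ ε = -1) ∧ c ≠ 0 ∧ S = lagrangianCatenoid p n ε c)
    (hR : ∃ U : Set (Fin n → ℂ), IsOpen U ∧ R = S ∩ U) : IsCongruentToModel p R := by
  obtain ⟨U, hU, rfl⟩ := hR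
  exact ⟨LinearEquiv.refl ℝ _, 0, S, U, fun _ _ => rfl, fun _ _ _ => rfl, hS, hU, by simp⟩

/-- The coordinates of `z` transverse to `κ ℝⁿ`. -/
def transverse (n : ℕ) (κ : ℂ) : (Fin n → ℂ) →L[ℝ] (Fin n → ℝ) :=
  ContinuousLinearMap.pi fun k =>
    imCLM.comp (((starRingEnd ℂ) κ • ContinuousLinearMap.proj (R := ℂ) (φ := fun _ : Fin n => ℂ)
      k).restrictScalars ℝ)

lemma transverse_apply (κ : ℂ) (z : Fin n → ℂ) (k : Fin n) :
    transverse n κ z k = ((starRingEnd ℂ) κ * z k).im := rfl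

lemma finrank_ker_transverse {κ : ℂ} (hκ : ‖κ‖ = 1) :
    Module.finrank ℝ (LinearMap.ker (transverse n κ).toLinearMap) = n := by
  have hs : LinearMap.range (transverse n κ).toLinearMap = ⊤ := by
    refine LinearMap.range_eq_top.2 fun y => ⟨fun k => κ * (I * y k), ?_⟩
    ext k
    have : (starRingEnd ℂ) κ * (κ * (I * y k)) = I * y k := by
      rw [← mul_assoc, mul_comm _ κ, mul_conj, normSq_eq_norm_sq, hκ]; simp
    change ((starRingEnd ℂ) κ * (κ * (I * y k))).im = y k
    rw [this]; simp
  have h := LinearMap.finrank_range_add_finrank_ker (transverse n κ).toLinearMap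
  rw [hs, finrank_top, Module.finrank_pi_fintype, Module.finrank_pi_fintype] at h
  simp only [Module.finrank_self, finrank_real_complex, Finset.sum_const, Finset.card_univ,
    Fintype.card_fin, smul_eq_mul] at h
  omega

lemma pseudoOmega_eq_zero_of_transverse {κ : ℂ} (hκ : ‖κ‖ = 1) {v w : Fin n → ℂ}
    (hv : transverse n κ v = 0) (hw : transverse n κ w = 0) : pseudoOmega p v w = 0 := by
  have h : pseudoHerm p v w = pseudoHerm p ((starRingEnd ℂ) κ • v) ((starRingEnd ℂ) κ • w) :=
    (pseudoHerm_smul_smul (by simpa using hκ) v w).symm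
  have hv' : ∀ k, ((starRingEnd ℂ) κ * v k).im = 0 := fun k => congrFun hv k
  have hw' : ∀ k, ((starRingEnd ℂ) κ * w k).im = 0 := fun k => congrFun hw k
  rw [pseudoOmega, h, pseudoHerm, im_sum, neg_eq_zero]
  refine Finset.sum_eq_zero fun k _ => ?_
  rw [im_ofReal_mul, mul_im, conj_im, conj_re, Pi.smul_apply, Pi.smul_apply, smul_eq_mul,
    smul_eq_mul, hv' k, hw' k]
  ring

end Congruence

/-! ### Special Lagrangian immersions with infinitesimal invariance -/

section Special

variable {n p : ℕ} {M : Type*} [TopologicalSpace M] [ChartedSpace (EuclideanSpace ℝ (Fin n)) M]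

/-- Immersed submanifolds that are special Lagrangian of phase one and infinitesimally invariant
under `SO(p, n - p)`. -/
structure IsSpecial (p : ℕ) (g : M → (Fin n → ℂ)) : Prop where
  immersion : IsSmoothImmersion g
  lagrangian : ∀ x, IsLagrangianSubspace p (tangentImage g x)
  rotation : ∀ x, ∀ v ∈ tangentImage g x, ∀ i j,
    (g x i * (starRingEnd ℂ) (v j)).im + (v i * (starRingEnd ℂ) (g x j)).im = 0
  det_im : ∀ x, ∀ v : Fin n → Fin n → ℂ, (∀ i, v i ∈ tangentImage g x) →
    (Matrix.of v).det.im = 0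

variable {f g : M → (Fin n → ℂ)}

lemma differential_equiv_comp (L : (Fin n → ℂ) ≃L[ℝ] (Fin n → ℂ)) (hf : IsSmoothImmersion f)
    (x : M) : differential (fun x => L (f x)) x =
      L.toContinuousLinearMap.comp (differential f x) := by
  have h1 := mfderiv_comp (I := 𝓡 n) (I' := 𝓘(ℝ, Fin n → ℂ)) (I'' := 𝓘(ℝ, Fin n → ℂ)) (f := f)
    (g := L) x L.toContinuousLinearMap.differentiableAt.mdifferentiableAt
    (hf.1.mdifferentiableAt (by simp))
  have h2 : mfderiv 𝓘(ℝ, Fin n → ℂ) 𝓘(ℝ, Fin n → ℂ) L (f x) = L.toContinuousLinearMap := by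
    rw [mfderiv_eq_fderiv]
    exact L.fderiv
  rw [h2] at h1
  exact h1

lemma isSmoothImmersion_equiv_comp (L : (Fin n → ℂ) ≃L[ℝ] (Fin n → ℂ))
    (hf : IsSmoothImmersion f) : IsSmoothImmersion fun x => L (f x) := by
  refine ⟨L.contDiff.contMDiff.comp hf.1, fun x => ?_⟩
  have h : Function.Injective (differential (fun x => L (f x)) x) := by
    rw [differential_equiv_comp L hf]
    exact L.injective.comp (hf.2 x)
  exact h

lemma mem_tangentImage_equiv_comp (L : (Fin n → ℂ) ≃L[ℝ] (Fin n → ℂ))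
    (hf : IsSmoothImmersion f) {x : M} {w : Fin n → ℂ} :
    w ∈ tangentImage (fun x => L (f x)) x ↔ ∃ v ∈ tangentImage f x, L v = w := by
  rw [mem_tangentImage, differential_equiv_comp L hf]
  constructor
  · rintro ⟨v, rfl⟩
    exact ⟨_, ⟨v, rfl⟩, rfl⟩
  · rintro ⟨_, ⟨v, rfl⟩, rfl⟩
    exact ⟨v, rfl⟩

namespace IsSpecial

lemma generator_mem (hg : IsSpecial p g) (x : M) (i j : Fin n) :
    generator p i j (g x) ∈ tangentImage g x := by
  refine (hg.lagrangian x).mem_of_pseudoOmega_eq_zero fun w hw => ?_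
  rw [pseudoOmega_generator, hg.rotation x w hw, mul_zero]

lemma im_pow_mul (hg : IsSpecial p g) (hn : 2 ≤ n) (x : M) {w : Fin n → ℂ}
    (hw : w ∈ tangentImage g x) {j : Fin n} (hj : g x j ≠ 0) :
    (g x j ^ (n - 2) * pseudoBilin p (g x) w).im = 0 :=
  im_pow_mul_pseudoBilin hn (hg.generator_mem x) (hg.det_im x) hw hj

/-- In dimension at least three the coordinates have the same argument modulo `π`. -/
lemma im_mul_conj (hg : IsSpecial p g) (hn : 3 ≤ n) (x : M) (i k : Fin n) :
    (g x i * (starRingEnd ℂ) (g x k)).im = 0 := by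
  by_cases hik : i = k
  · rw [hik, mul_conj, ofReal_im]
  -- Isotropy is applied to the rotations of the planes `(i, j)` and `(j, k)`; the auxiliary third
  -- index is where `n ≥ 3` is used.
  obtain ⟨j, hji, hjk⟩ : ∃ j : Fin n, j ≠ i ∧ j ≠ k := by
    have : ({i, k} : Finset (Fin n)).card < Fintype.card (Fin n) := by
      rw [Fintype.card_fin]; exact lt_of_le_of_lt Finset.card_le_two (by omega)
    obtain ⟨j, hj⟩ := Finset.exists_mem_notMem_of_card_lt_card (t := Finset.univ) (s := {i, k}) (by simpa using this)
    exact ⟨j, by simpa using hj⟩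
  have h := hg.rotation x _ (hg.generator_mem x j k) i j
  simp only [generator, Pi.sub_apply, Pi.smul_apply, Pi.single_eq_same, smul_eq_mul, mul_one,
    Pi.single_eq_of_ne hji.symm, Pi.single_eq_of_ne hjk,
    Pi.single_eq_of_ne hik, mul_zero, sub_zero, map_mul, conj_ofReal, sub_self, zero_mul,
    zero_im, add_zero] at h
  rw [mul_left_comm, im_ofReal_mul, mul_eq_zero, or_iff_right (sgnCoeff_ne_zero k)] at h
  exact h

end IsSpecial

variable [IsManifold (𝓡 n) ∞ M]

/-- An immersion tangent to `κ ℝⁿ` covers an open part of an affine plane. -/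
lemma isCongruentToModel_of_transverse [ConnectedSpace M] (hg : IsSmoothImmersion g) {κ : ℂ}
    (hκ : ‖κ‖ = 1) (h : ∀ x, ∀ v ∈ tangentImage g x, transverse n κ v = 0) :
    IsCongruentToModel p (Set.range g) := by
  obtain ⟨x₀⟩ : Nonempty M := inferInstance
  set P : AffineSubspace ℝ (Fin n → ℂ) :=
    AffineSubspace.mk' (g x₀) (LinearMap.ker (transverse n κ).toLinearMap) with hP
  have hconst : ∀ x x', transverse n κ (g x) = transverse n κ (g x') :=
    comp_eq_of_derivative_zero hg (Φ' := fun _ => transverse n κ)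
      (fun z => (transverse n κ).hasFDerivAt) h
  have hmem : ∀ z, z ∈ P ↔ transverse n κ z = transverse n κ (g x₀) := by
    intro z
    rw [hP, AffineSubspace.mem_mk', LinearMap.mem_ker, vsub_eq_sub, map_sub, sub_eq_zero]
    rfl
  refine isCongruentToModel_of_subset (S := P) (Or.inl ⟨P, ⟨⟨g x₀, ?_⟩, ?_, ?_⟩, rfl⟩)
    (exists_isOpen_range_eq_inter (G := Fin n → ℝ) hg ?_ fun x => ⟨transverse n κ, transverse n κ,
      (transverse n κ).hasStrictFDerivAt, fun z hz => ?_, (finrank_ker_transverse hκ).le⟩)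
  · exact (hmem _).2 rfl
  · rw [hP, AffineSubspace.direction_mk', finrank_ker_transverse hκ]
  · rw [hP, AffineSubspace.direction_mk']
    exact fun v hv w hw => pseudoOmega_eq_zero_of_transverse hκ hv hw
  · rintro _ ⟨x, rfl⟩
    exact (hmem _).2 (hconst _ _)
  · rw [(hmem z).1 hz]
    exact hconst _ _

/-- A critical Lagrangian immersion with invariant image becomes special after multiplication by
a complex number of modulus one. -/
lemma exists_isSpecial [ConnectedSpace M] [SecondCountableTopology M] (hn : n ≠ 0)
    (hf : IsSmoothImmersion f) (hLag : IsLagrangianImmersion p f)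
    (hmin : IsMinimalImmersion p f) (hinv : IsSOInvariant p (Set.range f)) :
    ∃ κ : ℂ, ‖κ‖ = 1 ∧ IsSpecial p fun x => (starRingEnd ℂ) κ • f x := by
  obtain ⟨θ, hθ, hdet⟩ := exists_phase hf hLag hmin
  -- Multiplication by `κ̄` scales `det` by `κ̄ⁿ` and its quotient by its conjugate by `κ̄²ⁿ`, so a
  -- `2n`-th root of the phase is required.
  obtain ⟨κ, hκ⟩ := IsAlgClosed.exists_pow_nat_eq θ (n := 2 * n) (by omega)
  have hκ1 : ‖κ‖ = 1 := by
    rw [← pow_eq_one_iff_of_nonneg (norm_nonneg κ) (n := 2 * n) (by omega), ← norm_pow, hκ, hθ]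
  have hκc : (starRingEnd ℂ) κ * κ = 1 := by
    rw [mul_comm, mul_conj, normSq_eq_norm_sq, hκ1]; simp
  have hκ0 : (starRingEnd ℂ) κ ≠ 0 := left_ne_zero_of_mul_eq_one hκc
  have hκn : ‖(starRingEnd ℂ) κ‖ = 1 := by simpa using hκ1
  set L : (Fin n → ℂ) ≃L[ℝ] (Fin n → ℂ) := (mulEquiv n _ hκ0).toContinuousLinearEquiv with hL
  have hLz : ∀ z, L z = (starRingEnd ℂ) κ • z := fun z => rfl
  have hmem : ∀ {x w}, w ∈ tangentImage (fun x => (starRingEnd ℂ) κ • f x) x ↔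
      ∃ v ∈ tangentImage f x, (starRingEnd ℂ) κ • v = w := mem_tangentImage_equiv_comp L hf
  have hgi : IsSmoothImmersion fun x => (starRingEnd ℂ) κ • f x :=
    isSmoothImmersion_equiv_comp L hf
  have hT := isLagrangianSubspace_tangentImage hf hLag hmin.1
  refine ⟨κ, hκ1, hgi, fun x => ⟨finrank_tangentImage hgi x, ?_, ?_⟩, ?_, ?_⟩
  · intro v hv w hw
    obtain ⟨v, hv', rfl⟩ := hmem.1 hv
    obtain ⟨w, hw', rfl⟩ := hmem.1 hw
    rw [pseudoOmega, pseudoHerm_smul_smul hκn]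
    exact (hT x).isotropic v hv' w hw'
  · intro v hv h
    obtain ⟨v, hv', rfl⟩ := hmem.1 hv
    rw [(hT x).nondegenerate v hv' fun w hw => ?_, smul_zero]
    have := h _ (hmem.2 ⟨w, hw, rfl⟩)
    rwa [pseudoMetric, pseudoHerm_smul_smul hκn] at this
  · intro x v hv i j
    obtain ⟨v, hv', rfl⟩ := hmem.1 hv
    have h := pseudoOmega_generator_eq_zero hf hLag hinv i j x hv'
    rw [pseudoOmega_generator, mul_eq_zero, or_iff_right (mul_ne_zero (sgnCoeff_ne_zero i)
      (sgnCoeff_ne_zero j))] at h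
    have key : ∀ a b : ℂ, (starRingEnd ℂ) κ * a * (starRingEnd ℂ) ((starRingEnd ℂ) κ * b) =
        a * (starRingEnd ℂ) b := fun a b => by
      rw [map_mul, conj_conj]; linear_combination (a * (starRingEnd ℂ) b) * hκc
    simp only [Pi.smul_apply, smul_eq_mul, key]
    exact h
  · intro x v hv
    choose u hu huv using fun i => hmem.1 (hv i)
    have h1 : Matrix.of v = (starRingEnd ℂ) κ • Matrix.of u := by
      ext i k
      simp [← huv]
    have h2 := hdet x u hu
    have h3 : (Matrix.of v).det = ((starRingEnd ℂ) κ) ^ n * (Matrix.of u).det := by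
      rw [h1, Matrix.det_smul, Fintype.card_fin]
    rw [← conj_eq_iff_im, h3, map_mul, map_pow, conj_conj]
    have h4 : ((starRingEnd ℂ) κ) ^ n * κ ^ n = 1 := by rw [← mul_pow, hκc, one_pow]
    rw [← hκ] at h2
    conv_rhs => rw [h2]
    rw [two_mul, pow_add]
    linear_combination (-(κ ^ n * (starRingEnd ℂ) (Matrix.of u).det)) * h4

end Special

end MinimalLagrangian

namespace MinimalLagrangian

open Complex MeasureTheory Topology

/-! ### Submanifolds of real multiples of complex numbers -/

/-- A continuous nonvanishing real function on a connected space has a constant sign. -/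
lemma exists_sign {X : Type*} [TopologicalSpace X] [PreconnectedSpace X] {h : X → ℝ}
    (hc : Continuous h) (h0 : ∀ x, h x ≠ 0) : ∃ ε : ℝ, (ε = 1 ∨ ε = -1) ∧ ∀ x, 0 < ε * h x := by
  by_cases hpos : ∀ x, 0 < h x
  · exact ⟨1, Or.inl rfl, by simpa using hpos⟩
  · push Not at hpos
    obtain ⟨a, ha⟩ := hpos
    refine ⟨-1, Or.inr rfl, fun x => ?_⟩
    by_contra! hx
    obtain ⟨y, hy⟩ := intermediate_value_univ a x hc ⟨ha, by linarith⟩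
    exact h0 y hy

/-- A continuous real function on a connected space with constant nonzero square is constant. -/
lemma eq_of_sq_eq {X : Type*} [TopologicalSpace X] [PreconnectedSpace X] {h : X → ℝ}
    (hc : Continuous h) {d : ℝ} (hd : d ≠ 0) (hsq : ∀ x, h x ^ 2 = d) (x y : X) : h x = h y := by
  obtain ⟨ε, -, hpos⟩ := exists_sign hc fun x hx => hd (by rw [← hsq x, hx]; simp)
  rcases sq_eq_sq_iff_eq_or_eq_neg.1 ((hsq x).trans (hsq y).symm) with h1 | h1
  · exact h1
  · have := hpos x
    have := hpos y
    rw [h1] at *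
    linarith

/-- Two real lines `κ ℝ` and `κ' ℝ` in `ℂ` with a common nonzero vector `w` coincide. -/
lemma im_conj_mul_of_common {κ κ' w z : ℂ} (hκ : ‖κ‖ = 1) (hw : w ≠ 0)
    (h1 : ((starRingEnd ℂ) κ * w).im = 0) (h2 : ((starRingEnd ℂ) κ' * w).im = 0)
    (h3 : ((starRingEnd ℂ) κ * z).im = 0) : ((starRingEnd ℂ) κ' * z).im = 0 := by
  have hκc : κ * (starRingEnd ℂ) κ = 1 := by rw [mul_conj, normSq_eq_norm_sq, hκ]; simp
  have h : ((starRingEnd ℂ) κ' * w) * (starRingEnd ℂ) ((starRingEnd ℂ) κ * w) *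
      ((starRingEnd ℂ) κ * z) = (normSq w : ℂ) * ((starRingEnd ℂ) κ' * z) := by
    rw [map_mul, conj_conj, ← mul_conj]
    linear_combination ((starRingEnd ℂ) κ' * w * (starRingEnd ℂ) w * z) * hκc
  have h4 := congrArg im h
  rw [im_ofReal_mul, mul_im (_ * _) ((starRingEnd ℂ) κ * z), mul_im _ ((starRingEnd ℂ) _), conj_im,
    h1, h2, h3] at h4
  simpa [hw] using h4.symm

section

variable {n p : ℕ} {M : Type*} [TopologicalSpace M] [ChartedSpace (EuclideanSpace ℝ (Fin n)) M]
  {g : M → (Fin n → ℂ)}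

lemma exists_smul_realVec_of_ne_zero {z : Fin n → ℂ}
    (hz : ∀ i k, (z i * (starRingEnd ℂ) (z k)).im = 0) (h0 : z ≠ 0) :
    ∃ (j : Fin n) (x : Fin n → ℝ), z j ≠ 0 ∧ z = z j • realVec x ∧ x j = 1 := by
  obtain ⟨j, hj⟩ := Function.ne_iff.1 h0
  obtain ⟨x, hx⟩ := exists_smul_realVec hz hj
  exact ⟨j, x, hj, hx⟩

lemma pseudoMetric_zero_left (w : Fin n → ℂ) : pseudoMetric p 0 w = 0 := by
  simp [pseudoMetric, pseudoHerm]

lemma pseudoBilin_zero_left (w : Fin n → ℂ) : pseudoBilin p 0 w = 0 := by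
  simp [pseudoBilin]

/-- Normalization of the real part of a multiple of a real vector. -/
lemma exists_smul_realVec_quadric {z : Fin n → ℂ}
    (hz : ∀ i k, (z i * (starRingEnd ℂ) (z k)).im = 0) {ε : ℝ} (hε : ε = 1 ∨ ε = -1)
    (hpos : 0 < ε * pseudoMetric p z z) :
    ∃ (γ : ℂ) (x : Fin n → ℝ), x ∈ quadric p n ε ∧ z = γ • realVec x := by
  have h0 : z ≠ 0 := by
    rintro rfl
    simp [pseudoMetric_zero_left] at hpos
  obtain ⟨j, x, hj, hx, -⟩ := exists_smul_realVec_of_ne_zero hz h0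
  set σ := ∑ j, sgnCoeff p j * x j ^ 2 with hσ
  have hσpos : 0 < ε * σ := by
    rw [hx, pseudoMetric_smul_realVec_self, mul_left_comm] at hpos
    exact pos_of_mul_pos_right hpos (normSq_nonneg _)
  set t := √(ε * σ) with ht
  have htpos : 0 < t := Real.sqrt_pos.2 hσpos
  have ht2 : t ^ 2 = ε * σ := Real.sq_sqrt hσpos.le
  refine ⟨t * z j, fun k => x k / t, ?_, ?_⟩
  · change ∑ k, sgnCoeff p k * (x k / t) ^ 2 = ε
    have : ∑ k, sgnCoeff p k * (x k / t) ^ 2 = σ / t ^ 2 := by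
      rw [hσ, Finset.sum_div]
      exact Finset.sum_congr rfl fun k _ => by rw [div_pow, mul_div_assoc]
    have hσ0 : σ ≠ 0 := right_ne_zero_of_mul hσpos.ne'
    rw [this, ht2]
    rcases hε with rfl | rfl
    · simp [hσ0]
    · field_simp
  · have htc : (t : ℂ) ≠ 0 := by exact_mod_cast htpos.ne'
    conv_lhs => rw [hx]
    ext k
    simp only [realVec, Pi.smul_apply, smul_eq_mul, ofReal_div]
    field_simp

variable [IsManifold (𝓡 n) ∞ M]

namespace IsSpecial

/-- Reality of the frame determinants is exactly the vanishing of the differential on tangent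
vectors at points of the form `γ x`. -/
lemma firstIntegral_eq [ConnectedSpace M] (hg : IsSpecial p g) (hn : 2 ≤ n)
    (hP : ∀ x i k, (g x i * (starRingEnd ℂ) (g x k)).im = 0) (x x' : M) :
    firstIntegral p (g x) = firstIntegral p (g x') := by
  refine comp_eq_of_derivative_zero hg.immersion (Φ' := fun z => fderiv ℝ (firstIntegral p) z)
    (fun z => (contDiff_firstIntegral.differentiable (by simp) z).hasFDerivAt)
    (fun x v hv => ?_) x x'
  rw [fderiv_firstIntegral, firstIntegral_derivative_eq hn (hP x)
    fun j hj => hg.im_pow_mul hn x hv hj, sub_self, mul_zero]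

/-- The generic case: the submanifold is contained in a catenoid. -/
lemma isCongruentToModel_of_firstIntegral_ne_zero [ConnectedSpace M] (hg : IsSpecial p g)
    (hn : 2 ≤ n) (hP : ∀ x i k, (g x i * (starRingEnd ℂ) (g x k)).im = 0)
    {C : ℝ} (hC : C ≠ 0) (hgC : ∀ x, firstIntegral p (g x) = C) :
    IsCongruentToModel p (Set.range g) := by
  have hn0 : n ≠ 0 := by omega
  have hgc : Continuous g := hg.immersion.1.continuous
  have hgj : ∀ j, Continuous fun x => g x j := fun j => (continuous_apply j).comp hgc
  have hmc : Continuous fun x => pseudoMetric p (g x) (g x) := by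
    unfold pseudoMetric pseudoHerm
    fun_prop
  obtain ⟨ε, hε, hpos⟩ := exists_sign hmc fun x hx => by
    have h0 : g x ≠ 0 := by
      intro h0
      apply hC
      rw [← hgC x, h0, firstIntegral, pseudoMetric_zero_left, pseudoBilin_zero_left]
      simp [hn0]
    obtain ⟨j, y, hj, hy, -⟩ := exists_smul_realVec_of_ne_zero (hP x) h0
    have hγ : normSq (g x j) ≠ 0 := by simpa using hj
    have h1 := hgC x
    rw [hy, pseudoMetric_smul_realVec_self, mul_eq_zero, or_iff_right hγ] at hx
    rw [hy, firstIntegral_smul_realVec, hx, zero_pow hn0, mul_zero, zero_mul] at h1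
    exact hC h1.symm
  have hε0 : ε ≠ 0 := by rcases hε with rfl | rfl <;> norm_num
  have hεε : ε * ε = 1 := by rcases hε with rfl | rfl <;> norm_num
  choose γ y hy hgy using fun x => exists_smul_realVec_quadric (hP x) hε (hpos x)
  set d := C / (2 * ε ^ n) with hd
  have hd0 : d ≠ 0 := div_ne_zero hC (by positivity)
  have hsq : ∀ x, (γ x ^ n).im ^ 2 = d := fun x => by
    have h1 := hgC x
    have h2 : ∑ j, sgnCoeff p j * y x j ^ 2 = ε := hy x
    rw [hgy x, firstIntegral_smul_realVec, h2] at h1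
    rw [hd, ← h1]
    field_simp
  obtain ⟨x₀⟩ : Nonempty M := inferInstance
  have hc0 : (γ x₀ ^ n).im ≠ 0 := fun h0 => hd0 (by rw [← hsq x₀, h0]; simp)
  refine isCongruentToModel_of_subset (Or.inr ⟨ε, (γ x₀ ^ n).im, hε, hc0, rfl⟩)
    (exists_isOpen_of_subset_catenoid hg.immersion hε0 hc0 ?_)
  rintro _ ⟨x, rfl⟩
  -- The square of `Im γⁿ` is constant, and its sign remains to be fixed. For even `n`, `γⁿ` is a
  -- polynomial in the coordinates of the point, hence continuous. For odd `n`, replacing `(γ, y)`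
  -- by `(-γ, -y)` changes the sign without moving the point.
  rcases Nat.even_or_odd n with hne | hne
  · obtain ⟨m, hm⟩ := hne
    have hγn : ∀ x, γ x ^ n = ((ε : ℂ) * pseudoBilin p (g x) (g x)) ^ m := fun x => by
      have h2 : ∑ j, sgnCoeff p j * y x j ^ 2 = ε := hy x
      have h3 : (ε : ℂ) * ε = 1 := by exact_mod_cast hεε
      rw [hgy x, pseudoBilin_smul_realVec_self, h2, mul_left_comm, h3, mul_one, ← pow_mul, hm,
        two_mul]
    have hcont : Continuous fun x => (γ x ^ n).im := by
      simp only [hγn]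
      unfold pseudoBilin
      fun_prop
    exact ⟨γ x, y x, hy x, eq_of_sq_eq hcont hd0 hsq x x₀, hgy x⟩
  · rcases sq_eq_sq_iff_eq_or_eq_neg.1 ((hsq x).trans (hsq x₀).symm) with h1 | h1
    · exact ⟨γ x, y x, hy x, h1, hgy x⟩
    · refine ⟨-γ x, -y x, ?_, ?_, ?_⟩
      · have h2 : ∑ j, sgnCoeff p j * y x j ^ 2 = ε := hy x
        simpa [quadric] using h2
      · rw [hne.neg_pow, neg_im, h1, neg_neg]
      · rw [hgy x]
        ext k
        simp [realVec]

/-- The set of points where the tangent space is `κ ℝⁿ` is closed. -/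
lemma isClosed_setOf_transverse (hg : IsSpecial p g) (κ : ℂ) :
    IsClosed {x | ∀ v ∈ tangentImage g x, transverse n κ v = 0} := by
  refine isClosed_of_closure_subset fun x hx v hv => ?_
  obtain ⟨η, rfl⟩ := (tangentImage_chartAt hg.immersion x v).1 hv
  set e := chartAt (EuclideanSpace ℝ (Fin n)) x with he
  have hcont : ContinuousAt
      (fun x' => transverse n κ (fderiv ℝ (inChart g x) (e x') η)) x := by
    have h1 : ContinuousAt (fderiv ℝ (inChart g x)) (e x) :=
      ((contDiffOn_inChart hg.immersion x).continuousOn_fderiv_of_isOpen e.open_target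
        (by simp)).continuousAt (e.open_target.mem_nhds (mem_chart_target _ x))
    have h2 : ContinuousAt (fun x' => fderiv ℝ (inChart g x) (e x')) x :=
      ContinuousAt.comp (f := e) h1 (e.continuousAt (mem_chart_source _ x))
    exact (transverse n κ).continuous.continuousAt.comp (h2.clm_apply continuousAt_const)
  refine (isClosed_singleton (x := (0 : Fin n → ℝ))).mem_of_frequently_of_tendsto ?_ hcont
  refine ((mem_closure_iff_frequently.1 hx).and_eventually
    (e.open_source.mem_nhds (mem_chart_source _ x))).mono fun x' hx' => ?_
  refine hx'.1 _ ?_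
  have := (range_fderiv_inChart hg.immersion x (e.map_source hx'.2)
    (fderiv ℝ (inChart g x) (e x') η)).2 ⟨η, rfl⟩
  rwa [← he, e.left_inv hx'.2] at this

/-- The submanifold meets the null cone of the complex bilinear form in a set without interior. -/
lemma dense_setOf_pseudoBilin_ne_zero (hg : IsSpecial p g) (hn : n ≠ 0) :
    Dense {x | pseudoBilin p (g x) (g x) ≠ 0} := by
  intro x
  by_contra hx
  rw [mem_closure_iff_frequently, Filter.not_frequently] at hx
  simp only [Set.mem_ofPred_eq, not_not] at hx
  set e := chartAt (EuclideanSpace ℝ (Fin n)) x with he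
  have ht := mem_chart_target (EuclideanSpace ℝ (Fin n)) x
  have h1 : ∀ᶠ y in 𝓝 (e x), pseudoBilin p (inChart g x y) (inChart g x y) = 0 := by
    have h2 : ContinuousAt e.symm (e x) := e.symm.continuousAt ht
    have h3 : e.symm (e x) = x := e.left_inv (mem_chart_source _ x)
    rw [ContinuousAt, h3] at h2
    exact h2.eventually hx
  have h2 : ∀ᶠ y in 𝓝 (e x), inChart g x y = 0 := by
    -- Differentiating `B(g, g) = 0` gives `B(g, w) = 0` for all tangent `w`, hence `g = 0` on an
    -- open set, which contradicts the immersion property.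
    filter_upwards [h1.eventually_nhds, e.open_target.mem_nhds ht] with y hy hyt
    refine (hg.lagrangian (e.symm y)).smul_eq_zero_of_pseudoBilin fun w hw => ?_
    obtain ⟨η, rfl⟩ := (range_fderiv_inChart hg.immersion x hyt w).1 hw
    have h3 := ((contDiff_pseudoBilin_self (p := p) (n := n)).differentiable (by simp)
      (inChart g x y)).hasFDerivAt.comp y (hasFDerivAt_inChart hg.immersion x hyt)
    have h4 : HasFDerivAt ((fun z => pseudoBilin p z z) ∘ inChart g x)
        (0 : EuclideanSpace ℝ (Fin n) →L[ℝ] ℂ) y :=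
      (hasFDerivAt_const (0 : ℂ) y).congr_of_eventuallyEq hy
    have h5 := congrArg (fun L : EuclideanSpace ℝ (Fin n) →L[ℝ] ℂ => L η) (h3.unique h4)
    have h6 : 2 * pseudoBilin p (inChart g x y) (fderiv ℝ (inChart g x) y η) = 0 := by
      rw [← fderiv_pseudoBilin_self]; exact h5
    simpa using h6
  have h3 : fderiv ℝ (inChart g x) (e x) = 0 :=
    ((hasFDerivAt_const (0 : Fin n → ℂ) (e x)).congr_of_eventuallyEq h2).fderiv
  have hinj := injective_fderiv_inChart hg.immersion x ht
  rw [← he, h3] at hinj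
  have : Nontrivial (EuclideanSpace ℝ (Fin n)) :=
    Module.nontrivial_of_finrank_pos (R := ℝ) (by rw [finrank_euclideanSpace_fin]; omega)
  obtain ⟨a, b, hab⟩ := exists_pair_ne (EuclideanSpace ℝ (Fin n))
  exact hab (hinj rfl)

/-- The degenerate case: the submanifold is contained in an affine plane. -/
lemma isCongruentToModel_of_firstIntegral_eq_zero [ConnectedSpace M] (hg : IsSpecial p g)
    (hn : 2 ≤ n) (hP : ∀ x i k, (g x i * (starRingEnd ℂ) (g x k)).im = 0)
    (hg0 : ∀ x, firstIntegral p (g x) = 0) : IsCongruentToModel p (Set.range g) := by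
  have hn0 : n ≠ 0 := by omega
  set D : ℂ → Set M := fun κ => {x | ∀ v ∈ tangentImage g x, transverse n κ v = 0} with hD
  have hclosed : ∀ κ, IsClosed (D κ) := hg.isClosed_setOf_transverse
  -- Where `B(g, g) ≠ 0`, the tangent space is `κ ℝⁿ` with `κ = γ/|γ|`; a vanishing first integral
  -- makes `κⁿ` real of modulus one, so `κ²ⁿ = 1`. The finitely many closed sets `D κ` cover a dense
  -- set, hence all of `M`.
  set K : Finset ℂ := Polynomial.nthRootsFinset (2 * n) (1 : ℂ) with hK
  have hmemK : ∀ κ, κ ∈ K ↔ κ ^ (2 * n) = 1 := fun κ =>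
    Polynomial.mem_nthRootsFinset (by omega) _
  have hnorm : ∀ κ ∈ K, ‖κ‖ = 1 := fun κ hκ => by
    rw [← pow_eq_one_iff_of_nonneg (norm_nonneg κ) (n := 2 * n) (by omega), ← norm_pow,
      (hmemK κ).1 hκ, norm_one]
  have hcover : ⋃ κ ∈ K, D κ = Set.univ := by
    have hcl : IsClosed (⋃ κ ∈ K, D κ) := K.finite_toSet.isClosed_biUnion fun κ _ => hclosed κ
    rw [← hcl.closure_eq]
    refine ((hg.dense_setOf_pseudoBilin_ne_zero hn0).mono fun x hx => ?_).closure_eq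
    have hx0 : g x ≠ 0 := fun h0 => hx (by rw [h0, pseudoBilin_zero_left])
    obtain ⟨j, y, hj, hy, hyj⟩ := exists_smul_realVec_of_ne_zero (hP x) hx0
    have hσ : ∑ j, sgnCoeff p j * y j ^ 2 ≠ 0 := by
      intro h0
      apply hx
      rw [hy, pseudoBilin_smul_realVec_self, h0]
      simp
    have hγn : (g x j ^ n).im = 0 := by
      have h1 := hg0 x
      rw [hy, firstIntegral_smul_realVec] at h1
      simpa [hσ, hn0] using h1
    have hw : ∀ w ∈ tangentImage g x, ∀ k, ((starRingEnd ℂ) (g x j) * w k).im = 0 :=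
      fun w hw => im_conj_mul_eq_zero hn hy hyj hj hσ hγn (hg.im_pow_mul hn x hw hj)
        (hg.rotation x w hw)
    have hr : ‖g x j‖ ≠ 0 := norm_ne_zero_iff.2 hj
    set κ : ℂ := ((‖g x j‖⁻¹ : ℝ) : ℂ) * g x j with hκ
    have hκ1 : ‖κ‖ = 1 := by
      rw [hκ, norm_mul, norm_real, norm_inv, norm_norm, inv_mul_cancel₀ hr]
    refine Set.mem_biUnion (x := κ) ((hmemK κ).2 ?_) fun w hwT => ?_
    · have h1 : (κ ^ n).im = 0 := by
        rw [hκ, mul_pow, ← ofReal_pow, im_ofReal_mul, hγn, mul_zero]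
      have h2 : κ ^ n = ((κ ^ n).re : ℂ) := by
        apply Complex.ext <;> simp [h1]
      have h3 : normSq (κ ^ n) = 1 := by rw [normSq_eq_norm_sq, norm_pow, hκ1]; simp
      rw [normSq_apply, h1, mul_zero, add_zero] at h3
      rw [mul_comm, pow_mul, sq, h2, ← ofReal_mul, h3, ofReal_one]
    · ext k
      rw [transverse_apply, hκ, map_mul, conj_ofReal, mul_assoc, im_ofReal_mul, hw w hwT k,
        mul_zero]
      rfl
  have hsub : ∀ κ ∈ K, ∀ κ' ∈ K, (D κ ∩ D κ').Nonempty → D κ ⊆ D κ' := by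
    rintro κ hκ κ' hκ' ⟨x, hx, hx'⟩ x' hx1 v hv
    obtain ⟨w, hw, hw0⟩ : ∃ w ∈ tangentImage g x, w ≠ 0 := by
      have h1 := (hg.lagrangian x).finrank_eq
      have : Nontrivial (tangentImage g x) :=
        Module.nontrivial_of_finrank_pos (R := ℝ) (by omega)
      obtain ⟨w, hw⟩ := exists_ne (0 : tangentImage g x)
      exact ⟨w, w.2, by simpa using hw⟩
    obtain ⟨k, hk⟩ := Function.ne_iff.1 hw0
    ext l
    exact im_conj_mul_of_common (hnorm κ hκ) hk (congrFun (hx w hw) k) (congrFun (hx' w hw) k)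
      (congrFun (hx1 v hv) l)
  obtain ⟨x₀⟩ : Nonempty M := inferInstance
  obtain ⟨κ, hκ, hx₀⟩ : ∃ κ ∈ K, x₀ ∈ D κ := by
    simpa using (hcover.symm ▸ Set.mem_univ x₀ : x₀ ∈ ⋃ κ ∈ K, D κ)
  -- Two of the sets `D κ` are equal or disjoint, so the complement of one is a finite union of
  -- others.
  have hclopen : IsClopen (D κ) := by
    refine ⟨hclosed κ, ?_⟩
    rw [← isClosed_compl_iff]
    have : (D κ)ᶜ = ⋃ κ' ∈ {κ' | κ' ∈ K ∧ Disjoint (D κ') (D κ)}, D κ' := by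
      ext x
      simp only [Set.mem_compl_iff, Set.mem_iUnion, exists_prop, Set.mem_ofPred_eq]
      constructor
      · intro hx
        obtain ⟨κ', hκ', hx'⟩ : ∃ κ' ∈ K, x ∈ D κ' := by
          simpa using (hcover.symm ▸ Set.mem_univ x : x ∈ ⋃ κ ∈ K, D κ)
        refine ⟨κ', ⟨hκ', ?_⟩, hx'⟩
        by_contra hdis
        exact hx (hsub κ' hκ' κ hκ (Set.not_disjoint_iff_nonempty_inter.1 hdis) hx')
      · rintro ⟨κ', ⟨-, hdis⟩, hx'⟩ hx
        exact Set.disjoint_left.1 hdis hx' hx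
    rw [this]
    exact (K.finite_toSet.subset fun κ' h => h.1).isClosed_biUnion fun κ' _ => hclosed κ'
  have huniv : D κ = Set.univ := hclopen.eq_univ ⟨x₀, hx₀⟩
  exact isCongruentToModel_of_transverse hg.immersion (hnorm κ hκ) fun x =>
    (huniv.symm ▸ Set.mem_univ x : x ∈ D κ)

lemma isCongruentToModel_of_im_mul_conj [ConnectedSpace M] (hg : IsSpecial p g)
    (hn : 2 ≤ n) (hP : ∀ x i k, (g x i * (starRingEnd ℂ) (g x k)).im = 0) :
    IsCongruentToModel p (Set.range g) := by
  obtain ⟨x₀⟩ : Nonempty M := inferInstance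
  by_cases h0 : firstIntegral p (g x₀) = 0
  · exact hg.isCongruentToModel_of_firstIntegral_eq_zero hn hP fun x =>
      (hg.firstIntegral_eq hn hP x x₀).trans h0
  · exact hg.isCongruentToModel_of_firstIntegral_ne_zero hn hP h0 fun x =>
      hg.firstIntegral_eq hn hP x x₀

end IsSpecial

end

end MinimalLagrangian

namespace MinimalLagrangian

open Complex MeasureTheory Topology

/-! ### Surfaces -/

/-- The map `x + i y ↦ x + i (a + b J) y` of `ℂ²`, where `J` is the rotation by a right angle. -/
def rotateIm (a b : ℝ) : (Fin 2 → ℂ) →ₗ[ℝ] (Fin 2 → ℂ) where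
  toFun z := ![⟨(z 0).re, a * (z 0).im - b * (z 1).im⟩, ⟨(z 1).re, a * (z 1).im + b * (z 0).im⟩]
  map_add' z w := by
    ext k
    fin_cases k <;> apply Complex.ext <;> simp <;> ring
  map_smul' r z := by
    ext k
    fin_cases k <;> apply Complex.ext <;> simp <;> ring

lemma rotateIm_neg_rotateIm {a b : ℝ} (h : a ^ 2 + b ^ 2 = 1) (z : Fin 2 → ℂ) :
    rotateIm a (-b) (rotateIm a b z) = z := by
  ext k
  fin_cases k <;> apply Complex.ext <;> simp [rotateIm]
  · linear_combination (z 0).im * h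
  · linear_combination (z 1).im * h

/-- The rotation of the imaginary part in `ℂ²`. -/
def rotateImEquiv {a b : ℝ} (h : a ^ 2 + b ^ 2 = 1) : (Fin 2 → ℂ) ≃ₗ[ℝ] (Fin 2 → ℂ) :=
  LinearEquiv.ofLinearMap (rotateIm a b) (rotateIm a (-b))
    (LinearMap.ext fun z => by
      have := rotateIm_neg_rotateIm (a := a) (b := -b) (by rwa [neg_sq]) z
      rwa [neg_neg] at this)
    (LinearMap.ext fun z => rotateIm_neg_rotateIm h z)

lemma rotateImEquiv_apply {a b : ℝ} (h : a ^ 2 + b ^ 2 = 1) (z : Fin 2 → ℂ) :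
    rotateImEquiv h z =
      ![⟨(z 0).re, a * (z 0).im - b * (z 1).im⟩, ⟨(z 1).re, a * (z 1).im + b * (z 0).im⟩] := rfl

variable {p : ℕ}

lemma pseudoMetric_rotateImEquiv {e : ℝ} (he : ∀ j : Fin 2, sgnCoeff p j = e) {a b : ℝ}
    (h : a ^ 2 + b ^ 2 = 1) (z w : Fin 2 → ℂ) :
    pseudoMetric p (rotateImEquiv h z) (rotateImEquiv h w) = pseudoMetric p z w := by
  simp only [pseudoMetric, pseudoHerm, Fin.sum_univ_two, he, rotateImEquiv_apply, add_re,
    mul_re, ofReal_re, ofReal_im, zero_mul, sub_zero, conj_re, conj_im, Matrix.cons_val_zero, Matrix.cons_val_one]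
  linear_combination (e * ((z 0).im * (w 0).im + (z 1).im * (w 1).im)) * h

section

variable {M : Type*} [TopologicalSpace M] [ChartedSpace (EuclideanSpace ℝ (Fin 2)) M]
  [IsManifold (𝓡 2) ∞ M] [ConnectedSpace M] {g : M → (Fin 2 → ℂ)}

namespace IsSpecial

/-- The differential of `Im (z₀ z̄₁)` is the infinitesimal invariance condition itself: this is the
moment map of the group, constant on a connected Lagrangian with tangent orbits. -/
lemma im_mul_conj_eq (hg : IsSpecial p g) (x x' : M) :
    (g x 0 * (starRingEnd ℂ) (g x 1)).im = (g x' 0 * (starRingEnd ℂ) (g x' 1)).im := by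
  refine congrFun (comp_eq_of_derivative_zero hg.immersion (Φ := phaseDefect 1)
    (Φ' := fun z => fderiv ℝ (phaseDefect 1) z)
    (fun z => ((contDiff_phaseDefect 1).differentiable (by simp) z).hasFDerivAt)
    (fun x v hv => ?_) x x') 0
  ext k
  rw [fderiv_phaseDefect, hg.rotation x v hv]
  rfl

/-- For `n = 2` the power `zⱼⁿ⁻²` is `1`, so the special Lagrangian condition says directly that
`B(g, v)` is real. -/
lemma im_pseudoBilin_eq (hg : IsSpecial p g) (x x' : M) :
    (pseudoBilin p (g x) (g x)).im = (pseudoBilin p (g x') (g x')).im := by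
  refine comp_eq_of_derivative_zero hg.immersion (Φ := fun z => (pseudoBilin p z z).im)
    (Φ' := fun z => imCLM.comp (fderiv ℝ (fun z => pseudoBilin p z z) z))
    (fun z => imCLM.hasFDerivAt.comp z
      (contDiff_pseudoBilin_self.differentiable (by simp) z).hasFDerivAt)
    (fun x v hv => ?_) x x'
  have h : (pseudoBilin p (g x) v).im = 0 := by
    by_cases h0 : g x = 0
    · rw [h0, pseudoBilin_zero_left, zero_im]
    · obtain ⟨j, hj⟩ := Function.ne_iff.1 h0
      simpa using hg.im_pow_mul le_rfl x hv hj
  rw [ContinuousLinearMap.comp_apply, fderiv_pseudoBilin_self, imCLM_apply, mul_im, h]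
  simp

lemma im_mul_conj_of_im_eq_zero {z : Fin 2 → ℂ}
    (hz : (z 0 * (starRingEnd ℂ) (z 1)).im = 0) (i k : Fin 2) :
    (z i * (starRingEnd ℂ) (z k)).im = 0 := by
  have h : (z 1 * (starRingEnd ℂ) (z 0)).im = 0 := by
    rw [mul_im, conj_re, conj_im] at *
    linarith
  fin_cases i <;> fin_cases k
  · simp [mul_conj]
  · exact hz
  · exact h
  · simp [mul_conj]

/-- Definite surfaces. -/
lemma isCongruentToModel_of_definite (hg : IsSpecial p g) {e : ℝ} (hee : e = 1 ∨ e = -1)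
    (he : ∀ j : Fin 2, sgnCoeff p j = e) {m c : ℝ} (hm : m ≠ 0)
    (hgm : ∀ x, (g x 0 * (starRingEnd ℂ) (g x 1)).im = m)
    (hgc : ∀ x, (pseudoBilin p (g x) (g x)).im = c) : IsCongruentToModel p (Set.range g) := by
  have he2 : e * e = 1 := by rcases hee with rfl | rfl <;> norm_num
  have he0 : e ≠ 0 := by rcases hee with rfl | rfl <;> norm_num
  obtain ⟨c₁, hc₁⟩ : ∃ c₁, c₁ = e * c / 2 := ⟨_, rfl⟩
  set ρ : ℝ := √(c₁ ^ 2 + m ^ 2) with hρ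
  have hρ0 : 0 < ρ := Real.sqrt_pos.2 (by positivity)
  have hρ2 : ρ ^ 2 = c₁ ^ 2 + m ^ 2 := Real.sq_sqrt (by positivity)
  have hrot : (c₁ / ρ) ^ 2 + (m / ρ) ^ 2 = 1 := by
    rw [div_pow, div_pow, ← add_div, ← hρ2, div_self (by positivity)]
  -- With `x` and `y` the real and imaginary parts of a point, `c₁ = x · y` and `m = x₁y₀ - x₀y₁`.
  -- Rotating `y` rotates the pair `(c₁, m)`; the chosen angle takes it to `(ρ, 0)`, so the rotated
  -- point is a complex multiple of a real vector.
  set B := rotateImEquiv hrot with hB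
  have hBm : ∀ z w, pseudoMetric p (B z) (B w) = pseudoMetric p z w :=
    pseudoMetric_rotateImEquiv he hrot
  have hBg : IsSmoothImmersion fun x => B (g x) :=
    isSmoothImmersion_equiv_comp B.toContinuousLinearEquiv hg.immersion
  have hm' : ∀ x, (g x 0).im * (g x 1).re - (g x 0).re * (g x 1).im = m := fun x => by
    have := hgm x
    rw [mul_im, conj_re, conj_im] at this
    linarith
  have hc' : ∀ x, (g x 0).re * (g x 0).im + (g x 1).re * (g x 1).im = c₁ := fun x => by
    have := hgc x
    simp only [pseudoBilin, Fin.sum_univ_two, he, add_im, mul_im, ofReal_re, ofReal_im,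
    zero_mul, add_zero] at this
    rw [hc₁]
    linear_combination (e / 2) * this -
      ((g x 0).re * (g x 0).im + (g x 1).re * (g x 1).im) * he2
  have hsub : Set.range (fun x => B (g x)) ⊆ lagrangianCatenoid p 2 e (2 * ρ) := by
    rintro _ ⟨x, rfl⟩
    set z := B (g x) with hz
    have hz0 : z 0 = ⟨(g x 0).re, c₁ / ρ * (g x 0).im - m / ρ * (g x 1).im⟩ := rfl
    have hz1 : z 1 = ⟨(g x 1).re, c₁ / ρ * (g x 1).im + m / ρ * (g x 0).im⟩ := rfl
    have hzm : (z 0 * (starRingEnd ℂ) (z 1)).im = 0 := by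
      rw [mul_im, conj_re, conj_im, hz0, hz1]
      linear_combination (c₁ / ρ) * hm' x - (m / ρ) * hc' x
    have hzc : (z 0).re * (z 0).im + (z 1).re * (z 1).im = ρ := by
      have h1 : c₁ / ρ * c₁ + m / ρ * m = ρ := by
        field_simp
        exact hρ2.symm
      rw [hz0, hz1]
      linear_combination (c₁ / ρ) * hc' x + (m / ρ) * hm' x + h1
    have hpos : 0 < e * pseudoMetric p z z := by
      have h1 : e * pseudoMetric p z z = normSq (z 0) + normSq (z 1) := by
        simp only [pseudoMetric, pseudoHerm, Fin.sum_univ_two, he, mul_conj, add_re,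
          re_ofReal_mul, ofReal_re]
        linear_combination (normSq (z 0) + normSq (z 1)) * he2
      rw [h1]
      rcases (normSq_nonneg (z 0)).lt_or_eq with h2 | h2
      · exact add_pos_of_pos_of_nonneg h2 (normSq_nonneg _)
      · rcases (normSq_nonneg (z 1)).lt_or_eq with h3 | h3
        · exact add_pos_of_nonneg_of_pos (normSq_nonneg _) h3
        · rw [normSq_eq_zero.1 h2.symm, normSq_eq_zero.1 h3.symm] at hzc
          simp at hzc
          exact absurd hzc.symm hρ0.ne'
    obtain ⟨γ, y, hy, hγ⟩ :=
      exists_smul_realVec_quadric (im_mul_conj_of_im_eq_zero hzm) hee hpos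
    refine ⟨γ, y, hy, ?_, hγ⟩
    have hy' : ∑ j, sgnCoeff p j * y j ^ 2 = e := hy
    have h1 := pseudoBilin_smul_realVec_self (p := p) γ y
    rw [← hγ, hy'] at h1
    have h2 := congrArg im h1
    simp only [pseudoBilin, Fin.sum_univ_two, he, add_im, im_ofReal_mul, im_mul_ofReal] at h2
    rw [mul_im, mul_im] at h2
    linear_combination (-e) * h2 + 2 * hzc +
      (2 * ((z 0).re * (z 0).im + (z 1).re * (z 1).im) - (γ ^ 2).im) * he2
  have h2ρ : 2 * ρ ≠ 0 := by positivity
  have hcong : IsCongruentToModel p (Set.range fun x => B (g x)) :=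
    isCongruentToModel_of_subset (Or.inr ⟨e, 2 * ρ, hee, h2ρ, rfl⟩)
      (exists_isOpen_of_subset_catenoid hBg he0 h2ρ hsub)
  -- The rotation preserves the metric only. The clause on the Hermitian form is void in dimension
  -- two.
  have h := hcong.image B.symm (fun z w => by
    rw [← hBm, B.apply_symm_apply, B.apply_symm_apply]) (fun h => absurd rfl h)
  rwa [← Set.range_comp, show B.symm ∘ (fun x => B (g x)) = g from
    funext fun x => B.symm_apply_apply (g x)] at h

/-- In signature `(1, 1)` the coordinates have the same argument modulo `π`. -/
lemma im_mul_conj_eq_zero_of_indefinite (hg : IsSpecial 1 g)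
    (hneg : ∀ x, ∃ x', g x' = -g x) (x : M) : (g x 0 * (starRingEnd ℂ) (g x 1)).im = 0 := by
  have hgc : Continuous g := hg.immersion.1.continuous
  have hs0 : sgnCoeff 1 (0 : Fin 2) = -1 := by simp [sgnCoeff]
  have hs1 : sgnCoeff 1 (1 : Fin 2) = 1 := by simp [sgnCoeff]
  -- By symmetry under `-1` and connectedness, every such linear function of the real parts has a
  -- zero on `M`. Where `Re z₁ = -Re z₀` the invariants `m = Im (z₀ z̄₁)` and `c = Im B(z, z)`
  -- satisfy `c = 2m`, and where `Re z₁ = Re z₀` they satisfy `c = -2m`; so `m = 0`.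
  have key : ∀ e : ℝ, ∃ y, (g y 1).re + e * (g y 0).re = 0 := by
    intro e
    by_contra! h
    obtain ⟨δ, -, hδ⟩ := exists_sign (h := fun y => (g y 1).re + e * (g y 0).re)
      (by fun_prop) h
    obtain ⟨x', hx'⟩ := hneg x
    have h1 := hδ x
    have h2 := hδ x'
    rw [hx'] at h2
    simp only [Pi.neg_apply, neg_re] at h2
    linarith
  obtain ⟨y, hy⟩ := key 1
  obtain ⟨y', hy'⟩ := key (-1)
  have h1 := hg.im_mul_conj_eq x y
  have h2 := hg.im_mul_conj_eq x y'
  have h3 := hg.im_pseudoBilin_eq y y'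
  simp only [pseudoBilin, Fin.sum_univ_two, hs0, hs1, add_im, mul_im, ofReal_re, ofReal_im,
    zero_mul, add_zero] at h3
  rw [mul_im (g y 0), conj_re, conj_im] at h1
  rw [mul_im (g y' 0), conj_re, conj_im] at h2
  linear_combination (1 / 2) * h1 + (1 / 2) * h2 + (1 / 4) * h3 -
    (((g y 1).im - (g y 0).im) / 2) * hy + (((g y' 1).im + (g y' 0).im) / 2) * hy'

/-- A nonzero moment map value can occur only in definite signature, where the rotation of imaginary
parts applies; the symmetry `hneg` excludes it in signature `(1, 1)`. -/
lemma isCongruentToModel_two (hg : IsSpecial p g) (hp : p ≤ 2)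
    (hneg : ∀ x, ∃ x', g x' = -g x) : IsCongruentToModel p (Set.range g) := by
  obtain ⟨x₀⟩ : Nonempty M := inferInstance
  by_cases hm : (g x₀ 0 * (starRingEnd ℂ) (g x₀ 1)).im = 0
  · exact hg.isCongruentToModel_of_im_mul_conj le_rfl fun x =>
      im_mul_conj_of_im_eq_zero ((hg.im_mul_conj_eq x x₀).trans hm)
  · have hdef : ∀ e : ℝ, e = 1 ∨ e = -1 → (∀ j : Fin 2, sgnCoeff p j = e) →
        IsCongruentToModel p (Set.range g) := fun e hee he =>
      hg.isCongruentToModel_of_definite hee he hm (fun x => hg.im_mul_conj_eq x x₀)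
        fun x => hg.im_pseudoBilin_eq x x₀
    obtain rfl | rfl | rfl : p = 0 ∨ p = 1 ∨ p = 2 := by omega
    · exact hdef 1 (Or.inl rfl) fun j => by simp [sgnCoeff]
    · exact absurd (hg.im_mul_conj_eq_zero_of_indefinite hneg x₀) hm
    · exact hdef (-1) (Or.inr rfl) fun j => if_pos j.isLt

end IsSpecial

end

lemma neg_one_mem_indefiniteSO (p : ℕ) : (-1 : Matrix (Fin 2) (Fin 2) ℝ) ∈ indefiniteSO p 2 := by
  refine ⟨by simp, ?_⟩
  rw [Matrix.det_neg, Matrix.det_one]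
  simp

/-! ### Assembly of the dimensions -/

section

variable {n p : ℕ} {M : Type*} [TopologicalSpace M] [ConnectedSpace M] [SecondCountableTopology M]
  [ChartedSpace (EuclideanSpace ℝ (Fin n)) M] [IsManifold (𝓡 n) ∞ M]

/-- Connected critical Lagrangian immersions with `SO(p, n - p)`-invariant image cover an open part
of an affine Lagrangian plane or of a Lagrangian catenoid. -/
theorem isCongruentToModel_range (hp : p ≤ n) {f : M → (Fin n → ℂ)} (hf : IsSmoothImmersion f)
    (hLag : IsLagrangianImmersion p f) (hmin : IsMinimalImmersion p f)
    (hinv : IsSOInvariant p (Set.range f)) : IsCongruentToModel p (Set.range f) := by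
  rcases Nat.eq_zero_or_pos n with rfl | hn
  · exact isCongruentToModel_of_transverse hf (norm_one (α := ℂ)) fun x v hv =>
      Subsingleton.elim _ _
  obtain ⟨κ, hκ, hg⟩ := exists_isSpecial (by omega) hf hLag hmin hinv
  have hκc : κ * (starRingEnd ℂ) κ = 1 := by rw [mul_conj, normSq_eq_norm_sq, hκ]; simp
  suffices h : IsCongruentToModel p (Set.range fun x => (starRingEnd ℂ) κ • f x) by
    have h1 := h.smul hκ
    rwa [← Set.range_comp, show (fun z => κ • z) ∘ (fun x => (starRingEnd ℂ) κ • f x) = f from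
      funext fun x => by simp [smul_smul, hκc]] at h1
  rcases lt_trichotomy n 2 with h2 | rfl | h2
  · obtain rfl : n = 1 := by omega
    refine isCongruentToModel_of_transverse hg.immersion (norm_one (α := ℂ)) fun x v hv => ?_
    ext k
    have h := hg.det_im x (fun _ => v) fun _ => hv
    rw [Matrix.det_fin_one] at h
    rw [Subsingleton.elim k 0, transverse_apply, map_one, one_mul]
    exact h
  · refine hg.isCongruentToModel_two hp fun x => ?_
    obtain ⟨x', hx'⟩ := hinv _ (neg_one_mem_indefiniteSO p) (f x) ⟨x, rfl⟩
    refine ⟨x', ?_⟩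
    have h1 : f x' = -f x := by
      rw [hx']
      ext k
      fin_cases k <;> simp [Matrix.mulVec, dotProduct, Fin.sum_univ_two]
    rw [h1, smul_neg]
  · exact hg.isCongruentToModel_of_im_mul_conj h2.le fun x => hg.im_mul_conj h2 x

end

end MinimalLagrangian

end

theorem mainTheorem4 (n p : ℕ) (hp : p ≤ n)
    (M : Type*) [TopologicalSpace M] [T2Space M] [SecondCountableTopology M] [ConnectedSpace M]
    [ChartedSpace (EuclideanSpace ℝ (Fin n)) M] [IsManifold (𝓡 n) ∞ M]
    (f : M → (Fin n → ℂ)) (hf : IsSmoothImmersion f)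
    (hLag : IsLagrangianImmersion p f) (hmin : IsMinimalImmersion p f)
    (hinv : IsSOInvariant p (Set.range f)) :
    ∃ (A : (Fin n → ℂ) ≃ₗ[ℝ] (Fin n → ℂ)) (b : Fin n → ℂ) (S U : Set (Fin n → ℂ)),
      (∀ z w, pseudoMetric p (A z) (A w) = pseudoMetric p z w) ∧
      (n ≠ 2 → ∀ z w, pseudoHerm p (A z) (A w) = pseudoHerm p z w) ∧
      ((∃ P : AffineSubspace ℝ (Fin n → ℂ), IsAffineLagrangianPlane p P ∧ S = P) ∨
        ∃ ε c : ℝ, (ε = 1 ∨ ε = -1) ∧ c ≠ 0 ∧ S = lagrangianCatenoid p n ε c) ∧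
      IsOpen U ∧ Set.range f = (fun z => A z + b) '' (S ∩ U) :=
  MinimalLagrangian.isCongruentToModel_range hp hf hLag hmin hinv
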